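/- Let $n\ge 2$ and $E\in \mathrm{GL}_n(\mathbb C)$. Let $\mathcal B(E)$ be the Hopf algebra presented as an algebra by generators $u=(u_{ij})_{1\le i,j\le n}$ and relations $E^{-1}u^tEu=I_n=uE^{-1}u^tE$, with $\Delta(u_{ij})=\sum_k u_{ik}\otimes u_{kj}$, $\varepsilon(u_{ij})=\delta_{ij}$, $S(u)=E^{-1}u^tE$. Let $V_E$ be the right $\mathcal B(E)$-comodule with basis $e_1,\dots,e_n$ and coaction $e_i\mapsto\sum_k e_k\otimes u_{ki}$, and let $V_E^*$ be the dual comodule, with dual basis $e_1^*,\dots,e_n^*$ and coaction $e_i^*\mapsto \sum_k e_k^*\otimes S(u_{ik})$. A (right-right) Yetter–Drinfeld module over a Hopf algebra $A$ is a right $A$-module and right $A$-comodule $M$ with $(m\leftarrow a)_{(0)}\otimes(m\leftarrow a)_{(1)}=m_{(0)}\leftarrow a_{(2)}\otimes S(a_{(1)})m_{(1)}a_{(3)}$; morphisms are the $A$-linear and $A$-colinear maps. For a right $A$-comodule $V$, the free Yetter–Drinfeld module $V\boxtimes A$ is $V\otimes A$ with right multiplication on $A$ and coaction $v\otimes a\mapsto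 v_{(0)}\otimes a_{(2)}\otimes S(a_{(1)})v_{(1)}a_{(3)}$. Let $\mathbb C$ be the trivial Yetter–Drinfeld module (trivial coaction, action through $\varepsilon$). Then there is an exact sequence of Yetter–Drinfeld modules over $\mathcal B(E)$ $$0\to \mathbb C\boxtimes \mathcal B(E)\xrightarrow{\phi_1}(V_E^*\otimes V_E)\boxtimes \mathcal B(E)\xrightarrow{\phi_2}(V_E^*\otimes V_E)\boxtimes \mathcal B(E)\xrightarrow{\phi_3}\mathbb C\boxtimes \mathcal B(E)\xrightarrow{\varepsilon}\mathbb C\to 0,$$ where, for $x\in\mathcal B(E)$ and $1\le i,j\le n$ (identifying $\mathbb C\otimes\mathcal B(E)$ with $\mathcal B(E)$), $\varepsilon$ is the counit and $$\phi_1(x)=\sum_{i,j}e_i^*\otimes e_j\otimes\left((E^tE^{-1})_{ij}-(Eu(E^t)^{-1})_{ij}\right)x,$$ $$\phi_2(e_i^*\otimes e_j\otimes x)=e_i^*\otimes e_j\otimes x+\sum_{k,l}e_k^*\otimes e_l\otimes (u(E^t)^{-1})_{il}E_{jk}\,x,$$ $$\phi_3(e_i^*\otimes e_j\otimes x)=(u_{ij}-\delta_{ij})x.$$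 That is, $\phi_1,\phi_2,\phi_3,\varepsilon$ are morphisms of Yetter–Drinfeld modules and the sequence is exact at every place. Consequently it is a resolution of length $3$ of the trivial Yetter–Drinfeld module $\mathbb C$ (a resolution of the counit) by free Yetter–Drinfeld modules. -/

import Mathlib

namespace BilinHopf
open TensorProduct Coalgebra HopfAlgebra

section General
universe u
variable {k A : Type u} [Field k] [Ring A] [HopfAlgebra k A]

variable (k A) in
/-- The iterated comultiplication `a ↦ a₍₁₎ ⊗ (a₍₂₎ ⊗ a₍₃₎)`. -/
noncomputable def comul₃ : A →ₗ[k] A ⊗[k] (A ⊗[k] A) :=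
  (comul (R := k) (A := A)).lTensor A ∘ₗ comul

theorem comul₃_mul (a b : A) : comul₃ k A (a * b) = comul₃ k A a * comul₃ k A b := by
  have : ∀ s t : A ⊗[k] A, (comul (R := k) (A := A)).lTensor A (s * t)
      = (comul (R := k) (A := A)).lTensor A s * (comul (R := k) (A := A)).lTensor A t := by
    intro s t
    exact map_mul (Algebra.TensorProduct.map (AlgHom.id k A) (Bialgebra.comulAlgHom k A)) s t
  simp [comul₃, this]

theorem comul_antipode (a : A) :
    comul (R := k) (antipode k a) =
      TensorProduct.map (antipode k) (antipode k) (TensorProduct.comm k A A (comul (R := k) a)) := by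
  have key := left_inv_eq_right_inv
    (a := WithConv.toConv (comul (R := k) (A := A)))
    (b := WithConv.toConv (TensorProduct.map (antipode k) (antipode k) ∘ₗ
      (TensorProduct.comm k A A).toLinearMap ∘ₗ comul (R := k) (A := A)))
    (c := WithConv.toConv (comul (R := k) (A := A) ∘ₗ antipode k)) ?_
    (LinearMap.comul_right_inv)
  · have := congr(WithConv.ofConv $key a)
    exact this.symm
  · ext a
    rw [LinearMap.convMul_apply]
    have h4 : TensorProduct.map (comul (R := k) (A := A)) (comul (R := k) (A := A)) (comul (R := k) a) =
       (TensorProduct.assoc k A A (A ⊗[k] A)).symm (((TensorProduct.assoc k A A A).toLinearMap ∘ₗ comul.rTensor A ∘ₗ comul (R := k)).lTensor A (comul (R := k) a)) := by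
      rw [LinearEquiv.eq_symm_apply, coassoc, LinearMap.lTensor_comp_apply, ← coassoc_apply]
      generalize comul (R := k) a = t
      induction t with
      | zero => simp
      | add x y hx hy => simp only [map_add, hx, hy]
      | tmul x y =>
        simp only [TensorProduct.map_tmul, LinearMap.rTensor_tmul]
        generalize comul (R := k) x = s
        induction s with
        | zero => simp
        | add x y hx hy => simp only [map_add, hx, hy, add_tmul]
        | tmul x y => simp
    have h5 : ∀ s : A ⊗[k] A, LinearMap.mul' k (A ⊗[k] A) (TensorProduct.map (TensorProduct.map (antipode k) (antipode k) ∘ₗ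
      (TensorProduct.comm k A A).toLinearMap ∘ₗ comul (R := k) (A := A)) (comul (R := k) (A := A)) s)
      = LinearMap.mul' k (A ⊗[k] A) ((TensorProduct.map (antipode k) (antipode k) ∘ₗ
      (TensorProduct.comm k A A).toLinearMap).rTensor _ (TensorProduct.map (comul (R := k) (A := A)) (comul (R := k) (A := A)) s)) := by
      intro s
      congr 1
      induction s with
      | zero => simp
      | add x y hx hy => simp only [map_add, hx, hy]
      | tmul x y => simp
    have h6 : ∀ (x : A) (t : A ⊗[k] A), LinearMap.mul' k (A ⊗[k] A) ((TensorProduct.map (antipode k) (antipode k) ∘ₗ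
      (TensorProduct.comm k A A).toLinearMap).rTensor _ ((TensorProduct.assoc k A A (A ⊗[k] A)).symm (x ⊗ₜ ((TensorProduct.assoc k A A A).toLinearMap (comul.rTensor A t))))) =
      1 ⊗ₜ (antipode k x * (TensorProduct.lid k A (counit.rTensor A t))) := by
      intro x t
      induction t with
      | zero => simp
      | add a b ha hb => simp only [map_add, tmul_add, mul_add, ha, hb]
      | tmul y z =>
        have := mul_antipode_rTensor_comul_apply (R := k) y
        simp only [LinearMap.rTensor_tmul, lid_tmul]
        have h7 : ∀ s : A ⊗[k] A, LinearMap.mul' k (A ⊗[k] A) ((TensorProduct.map (antipode k) (antipode k) ∘ₗ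
          (TensorProduct.comm k A A).toLinearMap).rTensor _ ((TensorProduct.assoc k A A (A ⊗[k] A)).symm (x ⊗ₜ ((TensorProduct.assoc k A A A).toLinearMap (s ⊗ₜ z))))) =
          (LinearMap.mul' k A ((antipode k).rTensor A s)) ⊗ₜ (antipode k x * z) := by
          intro s
          induction s with
          | zero => simp
          | add a b ha hb => simp only [map_add, tmul_add, add_tmul, ha, hb]
          | tmul y z => simp
        rw [h7, this, Algebra.algebraMap_eq_smul_one, smul_tmul, mul_smul_comm]
    simp only
    rw [h5, h4]
    have h8 : ∀ s : A ⊗[k] A, LinearMap.mul' k (A ⊗[k] A) ((TensorProduct.map (antipode k) (antipode k) ∘ₗ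
      (TensorProduct.comm k A A).toLinearMap).rTensor _ ((TensorProduct.assoc k A A (A ⊗[k] A)).symm
        (((TensorProduct.assoc k A A A).toLinearMap ∘ₗ comul.rTensor A ∘ₗ comul (R := k)).lTensor A s)))
        = 1 ⊗ₜ LinearMap.mul' k A ((antipode k).rTensor A s) := by
      intro s
      induction s with
      | zero => simp
      | add a b ha hb => simp only [map_add, tmul_add, ha, hb]
      | tmul y z =>
        rw [LinearMap.lTensor_tmul]
        simp only [LinearMap.comp_apply]
        rw [h6]; simp
    rw [h8, mul_antipode_rTensor_comul_apply]
    simp [Algebra.algebraMap_eq_smul_one, Algebra.TensorProduct.one_def]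


variable (k A) in
/-- A right comodule over the Hopf algebra `A`. -/
structure RightComodule where
  carrier : Type u
  [addCommGroup : AddCommGroup carrier]
  [module : Module k carrier]
  coact : carrier →ₗ[k] carrier ⊗[k] A
  coassoc : (TensorProduct.assoc k carrier A A).toLinearMap ∘ₗ coact.rTensor A ∘ₗ coact =
    (comul (R := k) (A := A)).lTensor carrier ∘ₗ coact
  counit_coact : (TensorProduct.rid k carrier).toLinearMap ∘ₗ
    (counit (R := k) (A := A)).lTensor carrier ∘ₗ coact = LinearMap.id

attribute [instance] RightComodule.addCommGroup RightComodule.module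

namespace RightComodule

variable (k A) in
/-- The trivial comodule `k`. -/
noncomputable def trivial : RightComodule k A where
  carrier := k
  coact := (TensorProduct.mk k k A).flip 1
  coassoc := by ext; simp [Algebra.TensorProduct.one_def]
  counit_coact := by ext; simp

variable (k A) in
/-- The zero comodule. -/
noncomputable def zero : RightComodule k A where
  carrier := PUnit
  coact := 0
  coassoc := by simp
  counit_coact := by ext

/-- `((v ⊗ a) ⊗ (w ⊗ b)) ↦ (v ⊗ w) ⊗ a b`. -/
noncomputable def tensorAux (V W : Type u) [AddCommGroup V] [Module k V] [AddCommGroup W]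
    [Module k W] : (V ⊗[k] A) ⊗[k] (W ⊗[k] A) →ₗ[k] (V ⊗[k] W) ⊗[k] A :=
  (LinearMap.mul' k A).lTensor (V ⊗[k] W) ∘ₗ
    (TensorProduct.tensorTensorTensorComm k V A W A).toLinearMap

/-- The tensor product of two comodules, `v ⊗ w ↦ v₍₀₎ ⊗ w₍₀₎ ⊗ v₍₁₎ w₍₁₎`. -/
noncomputable def tensor (V W : RightComodule k A) : RightComodule k A where
  carrier := V.carrier ⊗[k] W.carrier
  coact := tensorAux V.carrier W.carrier ∘ₗ TensorProduct.map V.coact W.coact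
  coassoc := by
    have h1 : ∀ (x : V.carrier ⊗[k] A) (y : W.carrier ⊗[k] A),
        TensorProduct.assoc k (V.carrier ⊗[k] W.carrier) A A
          ((tensorAux V.carrier W.carrier ∘ₗ TensorProduct.map V.coact W.coact).rTensor A
            (tensorAux V.carrier W.carrier (x ⊗ₜ y))) =
        tensorAux (A := A ⊗[k] A) V.carrier W.carrier
          ((TensorProduct.assoc k _ A A (V.coact.rTensor A x)) ⊗ₜ
            (TensorProduct.assoc k _ A A (W.coact.rTensor A y))) := by
      intro x y
      induction x with
      | zero => simp
      | add a b ha hb => simp only [map_add, add_tmul, ha, hb]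
      | tmul v a =>
        induction y with
        | zero => simp
        | add a b ha hb => simp only [map_add, tmul_add, ha, hb]
        | tmul w b =>
          simp only [tensorAux, LinearMap.comp_apply, LinearEquiv.coe_coe,
            tensorTensorTensorComm_tmul, LinearMap.lTensor_tmul, LinearMap.rTensor_tmul,
            LinearMap.mul'_apply, map_tmul]
          generalize V.coact v = s
          generalize W.coact w = t
          induction s with
          | zero => simp
          | add a b ha hb => simp only [map_add, add_tmul, ha, hb]
          | tmul v c =>
            induction t with
            | zero => simp
            | add a b ha hb => simp only [map_add, tmul_add, add_tmul, ha, hb]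
            | tmul w d => simp
    have h2 : ∀ (x : V.carrier ⊗[k] A) (y : W.carrier ⊗[k] A),
        (comul (R := k) (A := A)).lTensor (V.carrier ⊗[k] W.carrier)
            (tensorAux V.carrier W.carrier (x ⊗ₜ y)) =
        tensorAux (A := A ⊗[k] A) V.carrier W.carrier
          (((comul (R := k) (A := A)).lTensor _ x) ⊗ₜ
            ((comul (R := k) (A := A)).lTensor _ y)) := by
      intro x y
      induction x with
      | zero => simp
      | add a b ha hb => simp only [map_add, add_tmul, ha, hb]
      | tmul v a =>
        induction y with
        | zero => simp
        | add a b ha hb => simp only [map_add, tmul_add, ha, hb]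
        | tmul w b => simp [tensorAux]
    refine TensorProduct.ext' fun v w => ?_
    have hv := congr($V.coassoc v)
    have hw := congr($W.coassoc w)
    simp only [LinearMap.comp_apply, LinearEquiv.coe_coe, map_tmul] at hv hw ⊢
    rw [h2, ← hv, ← hw, ← h1]
  counit_coact := by
    have h1 : ∀ (x : V.carrier ⊗[k] A) (y : W.carrier ⊗[k] A),
        TensorProduct.rid k (V.carrier ⊗[k] W.carrier)
          ((counit (R := k) (A := A)).lTensor (V.carrier ⊗[k] W.carrier)
            (tensorAux V.carrier W.carrier (x ⊗ₜ y))) =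
        TensorProduct.rid k _ ((counit (R := k) (A := A)).lTensor _ x) ⊗ₜ
          TensorProduct.rid k _ ((counit (R := k) (A := A)).lTensor _ y) := by
      intro x y
      induction x with
      | zero => simp
      | add a b ha hb => simp only [map_add, add_tmul, ha, hb]
      | tmul v a =>
        induction y with
        | zero => simp
        | add a b ha hb => simp only [map_add, tmul_add, ha, hb]
        | tmul w b =>
          simp only [tensorAux, LinearMap.comp_apply, LinearEquiv.coe_coe,
            tensorTensorTensorComm_tmul, LinearMap.lTensor_tmul, LinearMap.mul'_apply,
            Bialgebra.counit_mul, rid_tmul, tmul_smul, ← smul_tmul', smul_smul, mul_comm]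
    refine TensorProduct.ext' fun v w => ?_
    have hv := congr($V.counit_coact v)
    have hw := congr($W.counit_coact w)
    simp only [LinearMap.comp_apply, LinearEquiv.coe_coe, map_tmul, LinearMap.id_apply] at hv hw ⊢
    rw [h1, hv, hw]

/-- The linear map `f ↦ (v ↦ f(v₍₀₎) S(v₍₁₎))`. -/
noncomputable def dualAux (V : RightComodule k A) :
    Module.Dual k V.carrier →ₗ[k] (V.carrier →ₗ[k] A) where
  toFun f := (TensorProduct.lid k A).toLinearMap ∘ₗ TensorProduct.map f (antipode k) ∘ₗ V.coact
  map_add' f g := by ext v; simp [TensorProduct.map_add_left]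
  map_smul' c f := by ext v; simp [TensorProduct.map_smul_left]

theorem dualAux_apply (V : RightComodule k A) (f : Module.Dual k V.carrier) (v : V.carrier) :
    dualAux V f v = TensorProduct.lid k A (TensorProduct.map f (antipode k) (V.coact v)) := rfl

/-- The (left) dual of a finite-dimensional comodule: the coaction
`f ↦ f₍₀₎ ⊗ f₍₁₎` is characterized by `f₍₀₎(v) f₍₁₎ = f(v₍₀₎) S(v₍₁₎)`. -/
noncomputable def dual (V : RightComodule k A) [FiniteDimensional k V.carrier] :
    RightComodule k A where
  carrier := Module.Dual k V.carrier
  coact := (dualTensorHomEquiv k V.carrier A).symm.toLinearMap ∘ₗ dualAux V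
  coassoc := by
    ext f : 1
    apply (dualTensorHomEquiv k V.carrier (A ⊗[k] A)).injective
    ext v
    set c := (dualTensorHomEquiv k V.carrier A).symm.toLinearMap ∘ₗ dualAux V with hc
    have hcf : ∀ g v, dualTensorHomEquiv k V.carrier A (c g) v = dualAux V g v := by
      intro g v; simp [hc]
    have h1 : ∀ t : Module.Dual k V.carrier ⊗[k] A,
        dualTensorHomEquiv k V.carrier (A ⊗[k] A)
          (TensorProduct.assoc k _ A A (c.rTensor A t)) v =
        TensorProduct.comm k A A
          (TensorProduct.map (dualTensorHomEquiv k V.carrier A t) (antipode k) (V.coact v)) := by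
      intro t
      induction t with
      | zero => simp
      | add a b ha hb => simp only [map_add, LinearMap.add_apply, ha, hb, TensorProduct.map_add_left]
      | tmul g a =>
        have h : ∀ s : Module.Dual k V.carrier ⊗[k] A, dualTensorHomEquiv k V.carrier (A ⊗[k] A)
          (TensorProduct.assoc k _ A A (s ⊗ₜ a)) v = dualTensorHomEquiv k V.carrier A s v ⊗ₜ a := by
          intro s
          induction s with
          | zero => simp
          | add a b ha hb => simp only [map_add, LinearMap.add_apply, ha, hb, add_tmul]
          | tmul g b => simp [smul_tmul']
        rw [LinearMap.rTensor_tmul, h, hcf, dualAux_apply]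
        generalize V.coact v = s
        induction s with
        | zero => simp
        | add a b ha hb => simp only [map_add, ha, hb, add_tmul]
        | tmul w b =>
            have h' : dualTensorHomEquiv k V.carrier A (g ⊗ₜ a) w = g w • a := by simp
            simp only [map_tmul, lid_tmul, h', ← smul_tmul', map_smul, comm_tmul]
    have h2 : ∀ t : Module.Dual k V.carrier ⊗[k] A,
        dualTensorHomEquiv k V.carrier (A ⊗[k] A)
          ((comul (R := k) (A := A)).lTensor _ t) v =
        comul (R := k) (dualTensorHomEquiv k V.carrier A t v) := by
      intro t
      induction t with
      | zero => simp
      | add a b ha hb => simp only [map_add, LinearMap.add_apply, ha, hb]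
      | tmul g a => simp
    have h3 : dualTensorHomEquiv k V.carrier A (c f) = dualAux V f := by
      ext v; exact hcf f v
    have hv := congr($V.coassoc v)
    simp only [LinearMap.comp_apply, LinearEquiv.coe_coe] at hv ⊢
    rw [h1, h2, h3]
    have h4 : ∀ s : V.carrier ⊗[k] A, TensorProduct.map (dualAux V f) (antipode k) s =
        TensorProduct.map ((TensorProduct.lid k A).toLinearMap ∘ₗ TensorProduct.map f (antipode k))
          (antipode k) (V.coact.rTensor A s) := by
      intro s
      induction s with
      | zero => simp
      | add a b ha hb => simp only [map_add, ha, hb]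
      | tmul w b => simp [dualAux_apply]
    rw [← LinearEquiv.eq_symm_apply] at hv
    rw [h4, hv, dualAux_apply]
    generalize V.coact v = s
    induction s with
    | zero => simp
    | add a b ha hb => simp only [map_add, ha, hb]
    | tmul w b =>
      simp only [LinearMap.lTensor_tmul, map_tmul, lid_tmul, map_smul, comul_antipode]
      generalize comul (R := k) b = t
      induction t with
      | zero => simp
      | add a b ha hb => simp only [map_add, ha, hb, tmul_add, smul_add]
      | tmul b c => simp [smul_tmul']
  counit_coact := by
    ext f v
    set c := (dualTensorHomEquiv k V.carrier A).symm.toLinearMap ∘ₗ dualAux V with hc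
    have hcf : ∀ g v, dualTensorHomEquiv k V.carrier A (c g) v = dualAux V g v := by
      intro g v; simp [hc]
    have h1 : ∀ t : Module.Dual k V.carrier ⊗[k] A,
        (TensorProduct.rid k _ ((counit (R := k) (A := A)).lTensor _ t)) v =
          counit (R := k) (dualTensorHomEquiv k V.carrier A t v) := by
      intro t
      induction t with
      | zero => simp
      | add a b ha hb => simp only [map_add, LinearMap.add_apply, ha, hb]
      | tmul g a => simp [mul_comm]
    have hv := congr($V.counit_coact v)
    simp only [LinearMap.comp_apply, LinearEquiv.coe_coe, LinearMap.id_apply] at hv ⊢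
    rw [h1, hcf, dualAux_apply]
    conv_rhs => rw [← hv]
    generalize V.coact v = s
    induction s with
    | zero => simp
    | add a b ha hb => simp only [map_add, ha, hb]
    | tmul w b => simp [mul_comm]

end RightComodule

/-- For a bilinear map `g : V × M → W`, the linear map
`(v ⊗ b) ⊗ (a₁ ⊗ m ⊗ a₃) ↦ g(v, m) ⊗ S(a₁) b a₃`. -/
noncomputable def ydTwist {V M W : Type u} [AddCommGroup V] [Module k V] [AddCommGroup M]
    [Module k M] [AddCommGroup W] [Module k W] (g : V →ₗ[k] M →ₗ[k] W) :
    (V ⊗[k] A) ⊗[k] (A ⊗[k] (M ⊗[k] A)) →ₗ[k] W ⊗[k] A :=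
  TensorProduct.map (TensorProduct.lift g)
      (LinearMap.mul' k A ∘ₗ TensorProduct.map (antipode k) (LinearMap.mul' k A) ∘ₗ
        (TensorProduct.leftComm k A A A).toLinearMap) ∘ₗ
    (TensorProduct.tensorTensorTensorComm k V A M (A ⊗[k] A)).toLinearMap ∘ₗ
    (TensorProduct.leftComm k A M A).toLinearMap.lTensor (V ⊗[k] A)

@[simp]
theorem ydTwist_tmul {V M W : Type u} [AddCommGroup V] [Module k V] [AddCommGroup M]
    [Module k M] [AddCommGroup W] [Module k W] (g : V →ₗ[k] M →ₗ[k] W)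
    (v : V) (m : M) (b a₁ a₃ : A) :
    ydTwist g ((v ⊗ₜ b) ⊗ₜ (a₁ ⊗ₜ (m ⊗ₜ a₃))) = g v m ⊗ₜ (antipode k a₁ * b * a₃) := by
  simp [ydTwist, mul_assoc]

variable (k A) in
/-- A (right-right) Yetter-Drinfeld module over `A`: a right comodule with a right action
`act v a = v ← a` of the algebra `A`, such that
`(v ← a)₍₀₎ ⊗ (v ← a)₍₁₎ = v₍₀₎ ← a₍₂₎ ⊗ S(a₍₁₎) v₍₁₎ a₍₃₎`. -/
structure YDModule extends RightComodule k A where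
  act : carrier →ₗ[k] A →ₗ[k] carrier
  act_one : ∀ v, act v 1 = v
  act_mul : ∀ v a b, act v (a * b) = act (act v a) b
  coact_act : ∀ v a, coact (act v a) = ydTwist act (coact v ⊗ₜ comul₃ k A a)

/-- A morphism of Yetter-Drinfeld modules: an `A`-linear and `A`-colinear map. -/
structure YDHom (M N : YDModule k A) extends M.carrier →ₗ[k] N.carrier where
  map_act : ∀ v a, toFun (M.act v a) = N.act (toFun v) a
  map_coact : ∀ v, N.coact (toFun v) = toLinearMap.rTensor A (M.coact v)

instance (M N : YDModule k A) : CoeFun (YDHom M N) (fun _ => M.carrier → N.carrier) :=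
  ⟨fun f => f.toFun⟩

/-- The zero morphism. -/
def YDHom.zero (M N : YDModule k A) : YDHom M N where
  toLinearMap := 0
  map_act := by simp
  map_coact := by simp

namespace YDModule

theorem comul₃_eq (a : A) : comul₃ k A a =
    TensorProduct.assoc k A A A ((comul (R := k)).rTensor A (comul (R := k) a)) :=
  (coassoc_apply a).symm

variable (k A) in
/-- The trivial action `c ← a = c ε(a)`. -/
noncomputable def trivialAct : k →ₗ[k] A →ₗ[k] k :=
  (LinearMap.mul k k).compl₂ (counit (R := k) (A := A))

theorem trivialAct_apply (c : k) (a : A) : trivialAct k A c a = c * counit (R := k) a := rfl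

variable (k A) in
/-- The trivial Yetter-Drinfeld module `k`: trivial coaction, and action through the counit. -/
noncomputable def trivial : YDModule k A where
  toRightComodule := RightComodule.trivial k A
  act := trivialAct k A
  act_one := by intro (v : k); exact (trivialAct_apply v 1).trans (by simp)
  act_mul := by
    intro (v : k) a b
    change trivialAct k A v (a * b) = trivialAct k A (trivialAct k A v a) b
    rw [trivialAct_apply, trivialAct_apply, trivialAct_apply, Bialgebra.counit_mul, mul_assoc]
  coact_act := by
    intro (v : k) a
    have h : ∀ s : A ⊗[k] A, ydTwist (trivialAct k A)
        ((v ⊗ₜ (1 : A)) ⊗ₜ ((comul (R := k) (A := A)).lTensor A s)) =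
        v ⊗ₜ LinearMap.mul' k A ((antipode k).rTensor A s) := by
      intro s
      induction s with
      | zero => simp
      | add a b ha hb => simp only [map_add, tmul_add, ha, hb]
      | tmul x y =>
        have : ∀ t : A ⊗[k] A, ydTwist (trivialAct k A) ((v ⊗ₜ (1 : A)) ⊗ₜ (x ⊗ₜ t)) =
          v ⊗ₜ (antipode k x * TensorProduct.lid k A ((counit (R := k)).rTensor A t)) := by
          intro t
          induction t with
          | zero => simp
          | add a b ha hb => simp only [map_add, tmul_add, mul_add, ha, hb]
          | tmul y z =>
            simp only [ydTwist_tmul, trivialAct_apply, LinearMap.rTensor_tmul, lid_tmul, mul_one,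
              mul_comm v, mul_smul_comm, tmul_smul, smul_tmul', smul_eq_mul]
        rw [LinearMap.lTensor_tmul, this]
        simp
    change (trivialAct k A v a) ⊗ₜ[k] (1 : A) = ydTwist (trivialAct k A) ((v ⊗ₜ[k] (1 : A)) ⊗ₜ[k] _)
    rw [comul₃, LinearMap.comp_apply, h, mul_antipode_rTensor_comul_apply,
      Algebra.algebraMap_eq_smul_one, tmul_smul, trivialAct_apply, mul_comm, smul_tmul',
      smul_eq_mul]

/-- Right multiplication on the second factor of `V ⊗ A`. -/
noncomputable def freeAct (V : Type u) [AddCommGroup V] [Module k V] :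
    V ⊗[k] A →ₗ[k] A →ₗ[k] V ⊗[k] A :=
  (LinearMap.lTensorHom V ∘ₗ (LinearMap.mul k A).flip).flip

@[simp]
theorem freeAct_tmul (V : Type u) [AddCommGroup V] [Module k V] (v : V) (a b : A) :
    freeAct V (v ⊗ₜ[k] a) b = v ⊗ₜ (a * b) := by
  simp [freeAct]

theorem free_coact_mul {V : Type u} [AddCommGroup V] [Module k V] (x : V ⊗[k] A)
    (s t : A ⊗[k] (A ⊗[k] A)) :
    ydTwist (TensorProduct.mk k V A) (x ⊗ₜ (s * t)) =
      ydTwist (freeAct V) (ydTwist (TensorProduct.mk k V A) (x ⊗ₜ s) ⊗ₜ t) := by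
  induction x with
  | zero => simp
  | add a b ha hb => simp only [map_add, add_tmul, ha, hb]
  | tmul v b =>
    induction s with
    | zero => simp
    | add a b ha hb => simp only [map_add, add_tmul, tmul_add, add_mul, ha, hb]
    | tmul s₁ s =>
      induction s with
      | zero => simp
      | add a b ha hb => simp only [map_add, add_tmul, tmul_add, add_mul, ha, hb]
      | tmul s₂ s₃ =>
        induction t with
        | zero => simp
        | add a b ha hb => simp only [map_add, tmul_add, mul_add, ha, hb]
        | tmul t₁ t =>
          induction t with
          | zero => simp
          | add a b ha hb => simp only [map_add, tmul_add, mul_add, ha, hb]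
          | tmul t₂ t₃ => simp [antipode_mul_antidistrib, mul_assoc]

/-- The coaction of the free Yetter-Drinfeld module. -/
noncomputable def freeCoact (V : RightComodule k A) :
    V.carrier ⊗[k] A →ₗ[k] (V.carrier ⊗[k] A) ⊗[k] A :=
  ydTwist (TensorProduct.mk k V.carrier A) ∘ₗ TensorProduct.map V.coact (comul₃ k A)

theorem freeCoact_tmul (V : RightComodule k A) (v : V.carrier) (a : A) :
    freeCoact V (v ⊗ₜ a) = ydTwist (TensorProduct.mk k V.carrier A) (V.coact v ⊗ₜ comul₃ k A a) :=
  rfl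

/-- `((v ⊗ b) ⊗ c) ⊗ (a₁ ⊗ (a₂ ⊗ a₃ ⊗ a₄) ⊗ a₅) ↦ (v ⊗ a₃) ⊗ S(a₂) b a₄ ⊗ S(a₁) c a₅`. -/
noncomputable def freeCoactIter (V : Type u) [AddCommGroup V] [Module k V] :
    ((V ⊗[k] A) ⊗[k] A) ⊗[k] (A ⊗[k] ((A ⊗[k] (A ⊗[k] A)) ⊗[k] A)) →ₗ[k]
      (V ⊗[k] A) ⊗[k] (A ⊗[k] A) :=
  (TensorProduct.assoc k _ A A).toLinearMap ∘ₗ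
    (ydTwist (TensorProduct.mk k V A)).rTensor A ∘ₗ
    ydTwist (TensorProduct.mk k (V ⊗[k] A) (A ⊗[k] (A ⊗[k] A)))

theorem freeCoact_rTensor (V : RightComodule k A) (x : V.carrier ⊗[k] A)
    (t : A ⊗[k] (A ⊗[k] A)) :
    TensorProduct.assoc k _ A A ((freeCoact V).rTensor A
      (ydTwist (TensorProduct.mk k V.carrier A) (x ⊗ₜ t))) =
    freeCoactIter V.carrier (V.coact.rTensor A x ⊗ₜ (((comul₃ k A).rTensor A).lTensor A t)) := by
  induction x with
  | zero => simp
  | add a b ha hb => simp only [map_add, add_tmul, ha, hb]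
  | tmul v b =>
    induction t with
    | zero => simp
    | add a b ha hb => simp only [map_add, tmul_add, ha, hb]
    | tmul t₁ t =>
      induction t with
      | zero => simp
      | add a b ha hb => simp only [map_add, tmul_add, ha, hb]
      | tmul t₂ t₃ => simp [freeCoactIter, freeCoact_tmul]

variable (k A) in
/-- The reassociation `(a₁ ⊗ a₂) ⊗ (a₃ ⊗ (a₄ ⊗ a₅)) ↦ a₁ ⊗ ((a₂ ⊗ (a₃ ⊗ a₄)) ⊗ a₅)`. -/
noncomputable def reassoc : (A ⊗[k] A) ⊗[k] (A ⊗[k] (A ⊗[k] A)) →ₗ[k]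
    A ⊗[k] ((A ⊗[k] (A ⊗[k] A)) ⊗[k] A) :=
  (TensorProduct.assoc k A (A ⊗[k] A) A).symm.toLinearMap.lTensor A ∘ₗ
    ((TensorProduct.assoc k A A A).symm.toLinearMap.lTensor A).lTensor A ∘ₗ
    (TensorProduct.assoc k A A (A ⊗[k] (A ⊗[k] A))).toLinearMap

theorem comul_lTensor_free {V : Type u} [AddCommGroup V] [Module k V] (x : V ⊗[k] A)
    (t : A ⊗[k] (A ⊗[k] A)) :
    (comul (R := k) (A := A)).lTensor _ (ydTwist (TensorProduct.mk k V A) (x ⊗ₜ t)) =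
    freeCoactIter V ((TensorProduct.assoc k V A A).symm
        ((comul (R := k) (A := A)).lTensor V x) ⊗ₜ
      reassoc k A (TensorProduct.map (comul (R := k) (A := A))
        ((comul (R := k) (A := A)).lTensor A) t)) := by
  induction x with
  | zero => simp
  | add a b ha hb => simp only [map_add, add_tmul, ha, hb]
  | tmul v b =>
    induction t with
    | zero => simp
    | add a b ha hb => simp only [map_add, tmul_add, ha, hb]
    | tmul t₁ t =>
      induction t with
      | zero => simp
      | add a b ha hb => simp only [map_add, tmul_add, ha, hb]
      | tmul t₂ t₃ =>
        simp only [ydTwist_tmul, LinearMap.lTensor_tmul, map_tmul, Bialgebra.comul_mul,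
          comul_antipode]
        generalize comul (R := k) t₁ = p
        generalize comul (R := k) b = q
        generalize comul (R := k) t₃ = r
        induction p with
        | zero => simp
        | add a b ha hb => simp only [map_add, tmul_add, add_tmul, add_mul, ha, hb]
        | tmul p₁ p₂ =>
          induction q with
          | zero => simp
          | add a b ha hb => simp only [map_add, tmul_add, add_tmul, add_mul, mul_add, ha, hb]
          | tmul q₁ q₂ =>
            induction r with
            | zero => simp
            | add a b ha hb => simp only [map_add, tmul_add, mul_add, ha, hb]
            | tmul r₁ r₂ => simp [freeCoactIter, reassoc]

theorem comul₃_tree (a : A) :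
    reassoc k A (TensorProduct.map (comul (R := k) (A := A))
        ((comul (R := k) (A := A)).lTensor A) (comul₃ k A a)) =
      ((comul₃ k A).rTensor A).lTensor A (comul₃ k A a) := by
  have : reassoc k A ∘ₗ TensorProduct.map (comul (R := k) (A := A))
        ((comul (R := k) (A := A)).lTensor A) ∘ₗ (comul₃ k A) =
      ((comul₃ k A).rTensor A).lTensor A ∘ₗ (comul₃ k A) := by
    simp only [comul₃, reassoc, coassoc_simps]
  exact congr($this a)

/-- The free Yetter-Drinfeld module `V ⊠ A` on a comodule `V`: the space `V ⊗ A` with right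
multiplication and the coaction `v ⊗ a ↦ v₍₀₎ ⊗ a₍₂₎ ⊗ S(a₍₁₎) v₍₁₎ a₍₃₎`. -/
noncomputable def free (V : RightComodule k A) : YDModule k A where
  carrier := V.carrier ⊗[k] A
  coact := freeCoact V
  coassoc := by
    refine TensorProduct.ext' fun v a => ?_
    have hv := congr($V.coassoc v)
    simp only [LinearMap.comp_apply, LinearEquiv.coe_coe] at hv ⊢
    rw [freeCoact_tmul, freeCoact_rTensor, comul_lTensor_free, comul₃_tree, ← hv,
      LinearEquiv.symm_apply_apply]
  counit_coact := by
    have h1 : ∀ (x : V.carrier ⊗[k] A) (t : A ⊗[k] (A ⊗[k] A)),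
        TensorProduct.rid k _ ((counit (R := k) (A := A)).lTensor _
          (ydTwist (TensorProduct.mk k V.carrier A) (x ⊗ₜ t))) =
        TensorProduct.rid k _ ((counit (R := k) (A := A)).lTensor _ x) ⊗ₜ
          (TensorProduct.lid k A ((counit (R := k) (A := A)).rTensor A
            ((TensorProduct.rid k A).toLinearMap.lTensor A
              ((counit (R := k) (A := A)).lTensor A |>.lTensor A t)))) := by
      intro x t
      induction x with
      | zero => simp
      | add a b ha hb => simp only [map_add, add_tmul, ha, hb]
      | tmul v b =>
        induction t with
        | zero => simp
        | add a b ha hb => simp only [map_add, tmul_add, ha, hb]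
        | tmul t₁ t =>
          induction t with
          | zero => simp
          | add a b ha hb => simp only [map_add, tmul_add, ha, hb]
          | tmul t₂ t₃ =>
            simp [← smul_tmul', smul_smul, mul_comm, mul_left_comm]
    refine TensorProduct.ext' fun v a => ?_
    have hv := congr($V.counit_coact v)
    simp only [LinearMap.comp_apply, LinearEquiv.coe_coe, LinearMap.id_apply] at hv ⊢
    rw [freeCoact_tmul, h1, hv, comul₃, LinearMap.comp_apply]
    have h2 : (TensorProduct.rid k A).toLinearMap.lTensor A
        ((counit (R := k) (A := A)).lTensor A |>.lTensor A
          ((comul (R := k) (A := A)).lTensor A (comul (R := k) a))) = comul (R := k) a := by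
      generalize comul (R := k) a = t
      induction t with
      | zero => simp
      | add a b ha hb => simp only [map_add, ha, hb]
      | tmul x y => simp
    rw [h2]
    simp
  act := freeAct V.carrier
  act_one := by
    intro v
    induction v with
    | zero => simp
    | add a b ha hb => simp only [map_add, LinearMap.add_apply, ha, hb]
    | tmul v a => simp
  act_mul := by
    intro v a b
    induction v with
    | zero => simp
    | add a b ha hb => simp only [map_add, LinearMap.add_apply, ha, hb]
    | tmul v a => simp [mul_assoc]
  coact_act := by
    intro v a
    induction v with
    | zero => simp
    | add a b ha hb => simp only [map_add, LinearMap.add_apply, add_tmul, ha, hb]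
    | tmul v b => rw [freeAct_tmul, freeCoact_tmul, freeCoact_tmul, comul₃_mul, free_coact_mul]

end YDModule
end General

section BilinearForm
universe u
open Matrix

/-- A matrix of scalars, seen as a matrix over the algebra `A`. -/
def scalarMat {k : Type u} [CommSemiring k] {n : ℕ} (A : Type u) [Semiring A] [Algebra k A]
    (M : Matrix (Fin n) (Fin n) k) : Matrix (Fin n) (Fin n) A :=
  M.map (algebraMap k A)

variable {k : Type u} [Field k] {n : ℕ}

/-- The matrix of generators of the free algebra on `u i j`. -/
def freeGen (k : Type u) [Field k] (n : ℕ) :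
    Matrix (Fin n) (Fin n) (FreeAlgebra k (Fin n × Fin n)) :=
  Matrix.of fun i j => FreeAlgebra.ι k (i, j)

/-- The defining relations `E⁻¹ uᵗ E u = 1 = u E⁻¹ uᵗ E`, entry by entry. -/
inductive BRel (E : GeneralLinearGroup (Fin n) k) :
    FreeAlgebra k (Fin n × Fin n) → FreeAlgebra k (Fin n × Fin n) → Prop
  | left (i j : Fin n) : BRel E
      ((scalarMat (FreeAlgebra k (Fin n × Fin n)) (E : Matrix (Fin n) (Fin n) k)⁻¹ * (freeGen k n)ᵀ *
        scalarMat (FreeAlgebra k (Fin n × Fin n)) (E : Matrix (Fin n) (Fin n) k) * freeGen k n :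
        Matrix (Fin n) (Fin n) (FreeAlgebra k (Fin n × Fin n))) i j)
      ((1 : Matrix (Fin n) (Fin n) (FreeAlgebra k (Fin n × Fin n))) i j)
  | right (i j : Fin n) : BRel E
      ((freeGen k n * scalarMat (FreeAlgebra k (Fin n × Fin n)) (E : Matrix (Fin n) (Fin n) k)⁻¹ * (freeGen k n)ᵀ *
        scalarMat (FreeAlgebra k (Fin n × Fin n)) (E : Matrix (Fin n) (Fin n) k) :
        Matrix (Fin n) (Fin n) (FreeAlgebra k (Fin n × Fin n))) i j)
      ((1 : Matrix (Fin n) (Fin n) (FreeAlgebra k (Fin n × Fin n))) i j)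

/-- The algebra `B(E)`, presented by the generators `u i j` and the relations
`E⁻¹ uᵗ E u = 1 = u E⁻¹ uᵗ E`. -/
def B (E : GeneralLinearGroup (Fin n) k) : Type u := RingQuot (BRel E)

namespace B

noncomputable instance (E : GeneralLinearGroup (Fin n) k) : Ring (B E) :=
  inferInstanceAs (Ring (RingQuot (BRel E)))

noncomputable instance instAlgebra (E : GeneralLinearGroup (Fin n) k) : Algebra k (B E) :=
  inferInstanceAs (Algebra k (RingQuot (BRel E)))

/-- The matrix `u` of generators of `B(E)`. -/
noncomputable def gen (E : GeneralLinearGroup (Fin n) k) : Matrix (Fin n) (Fin n) (B E) :=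
  Matrix.of fun i j => RingQuot.mkAlgHom k (BRel E) (FreeAlgebra.ι k (i, j))

variable {A : Type u} [Ring A] [Algebra k A]

theorem map_scalarMat {A' : Type u} [Ring A'] [Algebra k A'] (f : A →ₐ[k] A')
    (M : Matrix (Fin n) (Fin n) k) : (scalarMat A M).map f = scalarMat A' M := by
  ext i j; simp [scalarMat]

theorem map_freeGen (E : GeneralLinearGroup (Fin n) k) :
    (freeGen k n).map (RingQuot.mkAlgHom k (BRel E)) = (gen E : Matrix _ _ (RingQuot (BRel E))) :=
  rfl

theorem rel_left (E : GeneralLinearGroup (Fin n) k) :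
    scalarMat (B E) (E : Matrix (Fin n) (Fin n) k)⁻¹ * (gen E)ᵀ *
      scalarMat (B E) (E : Matrix (Fin n) (Fin n) k) * gen E = 1 := by
  ext i j
  have h := RingQuot.mkAlgHom_rel k (BRel.left (E := E) i j)
  rw [← Matrix.map_apply (f := RingQuot.mkAlgHom k (BRel E)),
    ← Matrix.map_apply (f := RingQuot.mkAlgHom k (BRel E)), Matrix.map_mul, Matrix.map_mul,
    Matrix.map_mul, map_scalarMat, map_scalarMat, Matrix.map_one _ (map_zero _) (map_one _)] at h
  exact h

theorem rel_right (E : GeneralLinearGroup (Fin n) k) :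
    gen E * scalarMat (B E) (E : Matrix (Fin n) (Fin n) k)⁻¹ * (gen E)ᵀ *
      scalarMat (B E) (E : Matrix (Fin n) (Fin n) k) = 1 := by
  ext i j
  have h := RingQuot.mkAlgHom_rel k (BRel.right (E := E) i j)
  rw [← Matrix.map_apply (f := RingQuot.mkAlgHom k (BRel E)),
    ← Matrix.map_apply (f := RingQuot.mkAlgHom k (BRel E)), Matrix.map_mul, Matrix.map_mul,
    Matrix.map_mul, map_scalarMat, map_scalarMat, Matrix.map_one _ (map_zero _) (map_one _)] at h
  exact h

theorem map_lift_freeGen (w : Matrix (Fin n) (Fin n) A) :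
    (freeGen k n).map (FreeAlgebra.lift k fun p : Fin n × Fin n => w p.1 p.2) = w := by
  ext i j; simp [freeGen]

/-- The universal property of `B(E)`. -/
noncomputable def lift (E : GeneralLinearGroup (Fin n) k) (w : Matrix (Fin n) (Fin n) A)
    (h₁ : scalarMat A (E : Matrix (Fin n) (Fin n) k)⁻¹ * wᵀ *
      scalarMat A (E : Matrix (Fin n) (Fin n) k) * w = 1)
    (h₂ : w * scalarMat A (E : Matrix (Fin n) (Fin n) k)⁻¹ * wᵀ *
      scalarMat A (E : Matrix (Fin n) (Fin n) k) = 1) : B E →ₐ[k] A :=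
  RingQuot.liftAlgHom k ⟨FreeAlgebra.lift k fun p : Fin n × Fin n => w p.1 p.2, by
    intro x y h
    cases h with
    | left i j =>
      rw [← Matrix.map_apply (f := FreeAlgebra.lift k fun p : Fin n × Fin n => w p.1 p.2),
        ← Matrix.map_apply (f := FreeAlgebra.lift k fun p : Fin n × Fin n => w p.1 p.2),
        Matrix.map_mul, Matrix.map_mul, Matrix.map_mul, map_scalarMat, map_scalarMat,
        Matrix.map_one _ (map_zero _) (map_one _), Matrix.transpose_map, map_lift_freeGen, h₁]
    | right i j =>
      rw [← Matrix.map_apply (f := FreeAlgebra.lift k fun p : Fin n × Fin n => w p.1 p.2),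
        ← Matrix.map_apply (f := FreeAlgebra.lift k fun p : Fin n × Fin n => w p.1 p.2),
        Matrix.map_mul, Matrix.map_mul, Matrix.map_mul, map_scalarMat, map_scalarMat,
        Matrix.map_one _ (map_zero _) (map_one _), Matrix.transpose_map, map_lift_freeGen, h₂]⟩

@[simp]
theorem lift_gen (E : GeneralLinearGroup (Fin n) k) (w : Matrix (Fin n) (Fin n) A)
    (h₁ h₂) (i j : Fin n) : lift E w h₁ h₂ (gen E i j) = w i j :=
  (RingQuot.liftAlgHom_mkAlgHom_apply k _ _ _).trans (by simp)

theorem algHom_ext {E : GeneralLinearGroup (Fin n) k} {f g : B E →ₐ[k] A}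
    (h : ∀ i j, f (gen E i j) = g (gen E i j)) : f = g := by
  apply RingQuot.ringQuot_ext' k f g
  apply FreeAlgebra.hom_ext
  funext p
  exact h p.1 p.2

theorem scalarMat_mul (M N : Matrix (Fin n) (Fin n) k) :
    scalarMat A (M * N) = scalarMat A M * scalarMat A N := Matrix.map_mul

theorem scalarMat_one : scalarMat A (1 : Matrix (Fin n) (Fin n) k) = 1 :=
  Matrix.map_one _ (map_zero _) (map_one _)

theorem scalarMat_inv_mul (E : GeneralLinearGroup (Fin n) k) :
    scalarMat A (E : Matrix (Fin n) (Fin n) k)⁻¹ * scalarMat A (E : Matrix (Fin n) (Fin n) k) = 1 := by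
  rw [← scalarMat_mul, Matrix.nonsing_inv_mul _ (Matrix.isUnits_det_units E), scalarMat_one]

theorem scalarMat_mul_inv (E : GeneralLinearGroup (Fin n) k) :
    scalarMat A (E : Matrix (Fin n) (Fin n) k) * scalarMat A (E : Matrix (Fin n) (Fin n) k)⁻¹ = 1 := by
  rw [← scalarMat_mul, Matrix.mul_nonsing_inv _ (Matrix.isUnits_det_units E), scalarMat_one]

/-- `u ⊗ 1`. -/
noncomputable def genL (E : GeneralLinearGroup (Fin n) k) :
    Matrix (Fin n) (Fin n) (B E ⊗[k] B E) :=
  (gen E).map (Algebra.TensorProduct.includeLeft : B E →ₐ[k] B E ⊗[k] B E)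

/-- `1 ⊗ u`. -/
noncomputable def genR (E : GeneralLinearGroup (Fin n) k) :
    Matrix (Fin n) (Fin n) (B E ⊗[k] B E) :=
  (gen E).map (Algebra.TensorProduct.includeRight : B E →ₐ[k] B E ⊗[k] B E)

theorem rel_left_map (E : GeneralLinearGroup (Fin n) k) (f : B E →ₐ[k] A) :
    scalarMat A (E : Matrix (Fin n) (Fin n) k)⁻¹ * ((gen E).map f)ᵀ *
      scalarMat A (E : Matrix (Fin n) (Fin n) k) * (gen E).map f = 1 := by
  have h := congrArg (fun M => M.map f) (rel_left E)
  simpa only [Matrix.map_mul, map_scalarMat, Matrix.map_one _ (map_zero f) (map_one f),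
    ← Matrix.transpose_map] using h

theorem rel_right_map (E : GeneralLinearGroup (Fin n) k) (f : B E →ₐ[k] A) :
    (gen E).map f * scalarMat A (E : Matrix (Fin n) (Fin n) k)⁻¹ * ((gen E).map f)ᵀ *
      scalarMat A (E : Matrix (Fin n) (Fin n) k) = 1 := by
  have h := congrArg (fun M => M.map f) (rel_right E)
  simpa only [Matrix.map_mul, map_scalarMat, Matrix.map_one _ (map_zero f) (map_one f),
    ← Matrix.transpose_map] using h

theorem transpose_genL_mul_genR (E : GeneralLinearGroup (Fin n) k) :
    (genL E * genR E)ᵀ = (genR E)ᵀ * (genL E)ᵀ := by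
  ext i j
  simp [Matrix.mul_apply, genL, genR]

/-- The comultiplication `u i j ↦ ∑ l, u i l ⊗ u l j`. -/
noncomputable def comulHom (E : GeneralLinearGroup (Fin n) k) : B E →ₐ[k] B E ⊗[k] B E :=
  lift E (genL E * genR E)
    (by
      rw [transpose_genL_mul_genR]
      calc _ = scalarMat _ (E : Matrix (Fin n) (Fin n) k)⁻¹ * (genR E)ᵀ * ((genL E)ᵀ *
              scalarMat _ (E : Matrix (Fin n) (Fin n) k) * genL E) * genR E := by
            simp only [mul_assoc]
        _ = scalarMat _ (E : Matrix (Fin n) (Fin n) k)⁻¹ * (genR E)ᵀ *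
              (scalarMat _ (E : Matrix (Fin n) (Fin n) k) *
              (scalarMat _ (E : Matrix (Fin n) (Fin n) k)⁻¹ * (genL E)ᵀ *
              scalarMat _ (E : Matrix (Fin n) (Fin n) k) * genL E)) * genR E := by
            simp only [← mul_assoc]
            rw [mul_assoc _ (scalarMat _ (E : Matrix (Fin n) (Fin n) k))
              (scalarMat _ (E : Matrix (Fin n) (Fin n) k)⁻¹), scalarMat_mul_inv, mul_one]
        _ = _ := by
            rw [genL, rel_left_map, mul_one]
            exact rel_left_map E _)
    (by
      rw [transpose_genL_mul_genR]
      calc _ = genL E * (genR E * scalarMat _ (E : Matrix (Fin n) (Fin n) k)⁻¹ * (genR E)ᵀ) *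
              (genL E)ᵀ * scalarMat _ (E : Matrix (Fin n) (Fin n) k) := by
            simp only [mul_assoc]
        _ = genL E * ((genR E * scalarMat _ (E : Matrix (Fin n) (Fin n) k)⁻¹ * (genR E)ᵀ *
              scalarMat _ (E : Matrix (Fin n) (Fin n) k)) *
              scalarMat _ (E : Matrix (Fin n) (Fin n) k)⁻¹) *
              (genL E)ᵀ * scalarMat _ (E : Matrix (Fin n) (Fin n) k) := by
            rw [mul_assoc _ (scalarMat _ (E : Matrix (Fin n) (Fin n) k))
              (scalarMat _ (E : Matrix (Fin n) (Fin n) k)⁻¹), scalarMat_mul_inv, mul_one]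
        _ = _ := by
            rw [genR, rel_right_map, one_mul]
            exact rel_right_map E _)

@[simp]
theorem comulHom_gen (E : GeneralLinearGroup (Fin n) k) (i j : Fin n) :
    comulHom E (gen E i j) = ∑ l, gen E i l ⊗ₜ[k] gen E l j := by
  simp [comulHom, Matrix.mul_apply, genL, genR]

/-- The counit `u i j ↦ δ i j`. -/
noncomputable def counitHom (E : GeneralLinearGroup (Fin n) k) : B E →ₐ[k] k :=
  lift E 1 (by rw [Matrix.transpose_one, mul_one, mul_one, scalarMat_inv_mul])
    (by rw [Matrix.transpose_one, one_mul, mul_one, scalarMat_inv_mul])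

@[simp]
theorem counitHom_gen (E : GeneralLinearGroup (Fin n) k) (i j : Fin n) :
    counitHom E (gen E i j) = (1 : Matrix (Fin n) (Fin n) k) i j := by
  simp [counitHom]

noncomputable instance instBialgebra (E : GeneralLinearGroup (Fin n) k) : Bialgebra k (B E) :=
  Bialgebra.ofAlgHom (comulHom E) (counitHom E)
    (by
      apply algHom_ext
      intro i j
      simp [sum_tmul, tmul_sum]
      rw [Finset.sum_comm])
    (by
      apply algHom_ext
      intro i j
      simp [Matrix.one_apply, ite_tmul])
    (by
      apply algHom_ext
      intro i j
      simp [Matrix.one_apply, tmul_ite])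

theorem comul_gen (E : GeneralLinearGroup (Fin n) k) (i j : Fin n) :
    comul (R := k) (gen E i j) = ∑ l, gen E i l ⊗ₜ[k] gen E l j := comulHom_gen E i j

theorem counit_gen (E : GeneralLinearGroup (Fin n) k) (i j : Fin n) :
    counit (R := k) (gen E i j) = (1 : Matrix (Fin n) (Fin n) k) i j := counitHom_gen E i j

/-- The matrix `S(u) = E⁻¹ uᵗ E`. -/
noncomputable def antipodeMat (E : GeneralLinearGroup (Fin n) k) : Matrix (Fin n) (Fin n) (B E) :=
  scalarMat (B E) (E : Matrix (Fin n) (Fin n) k)⁻¹ * (gen E)ᵀ *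
    scalarMat (B E) (E : Matrix (Fin n) (Fin n) k)

theorem antipodeMat_mul (E : GeneralLinearGroup (Fin n) k) : antipodeMat E * gen E = 1 := rel_left E

theorem mul_antipodeMat (E : GeneralLinearGroup (Fin n) k) : gen E * antipodeMat E = 1 := by
  rw [antipodeMat, ← mul_assoc, ← mul_assoc, rel_right]

theorem scalarMat_mul_transpose (M : Matrix (Fin n) (Fin n) k) (X : Matrix (Fin n) (Fin n) A) :
    (scalarMat A M * X)ᵀ = Xᵀ * scalarMat A Mᵀ := by
  ext i j
  simp [Matrix.mul_apply, scalarMat, Algebra.commutes]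

theorem mul_scalarMat_transpose (M : Matrix (Fin n) (Fin n) k) (X : Matrix (Fin n) (Fin n) A) :
    (X * scalarMat A M)ᵀ = scalarMat A Mᵀ * Xᵀ := by
  ext i j
  simp [Matrix.mul_apply, scalarMat, Algebra.commutes]

theorem transpose_antipodeMat (E : GeneralLinearGroup (Fin n) k) :
    (antipodeMat E)ᵀ = scalarMat (B E) (E : Matrix (Fin n) (Fin n) k)ᵀ * gen E *
      scalarMat (B E) ((E : Matrix (Fin n) (Fin n) k)⁻¹)ᵀ := by
  rw [antipodeMat, mul_scalarMat_transpose, scalarMat_mul_transpose, Matrix.transpose_transpose,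
    mul_assoc]

theorem map_op_mul (X Y : Matrix (Fin n) (Fin n) A) :
    X.map MulOpposite.op * Y.map MulOpposite.op = ((Yᵀ * Xᵀ)ᵀ).map MulOpposite.op := by
  ext i j
  simp [Matrix.mul_apply]

theorem scalarMat_op (M : Matrix (Fin n) (Fin n) k) :
    scalarMat Aᵐᵒᵖ M = (scalarMat A M).map MulOpposite.op := rfl

theorem scalarMat_transpose (M : Matrix (Fin n) (Fin n) k) :
    (scalarMat A M)ᵀ = scalarMat A Mᵀ := rfl

theorem scalarMat_transpose_inv_mul (E : GeneralLinearGroup (Fin n) k) :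
    scalarMat A ((E : Matrix (Fin n) (Fin n) k)⁻¹)ᵀ *
      scalarMat A (E : Matrix (Fin n) (Fin n) k)ᵀ = 1 := by
  rw [← scalarMat_mul, ← Matrix.transpose_mul,
    Matrix.mul_nonsing_inv _ (Matrix.isUnits_det_units E), Matrix.transpose_one, scalarMat_one]

theorem scalarMat_transpose_mul_inv (E : GeneralLinearGroup (Fin n) k) :
    scalarMat A (E : Matrix (Fin n) (Fin n) k)ᵀ *
      scalarMat A ((E : Matrix (Fin n) (Fin n) k)⁻¹)ᵀ = 1 := by
  rw [← scalarMat_mul, ← Matrix.transpose_mul,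
    Matrix.nonsing_inv_mul _ (Matrix.isUnits_det_units E), Matrix.transpose_one, scalarMat_one]

/-- The antipode `S(u) = E⁻¹ uᵗ E`, as an algebra map to the opposite algebra. -/
noncomputable def antipodeHom (E : GeneralLinearGroup (Fin n) k) : B E →ₐ[k] (B E)ᵐᵒᵖ :=
  lift E ((antipodeMat E).map MulOpposite.op)
    (by
      rw [scalarMat_op, scalarMat_op, ← Matrix.transpose_map, map_op_mul, map_op_mul, map_op_mul]
      simp only [Matrix.transpose_transpose, scalarMat_transpose]
      have : (antipodeMat E)ᵀ *
          (scalarMat (B E) (E : Matrix (Fin n) (Fin n) k)ᵀ *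
            (antipodeMat E * scalarMat (B E) ((E : Matrix (Fin n) (Fin n) k)⁻¹)ᵀ)) = 1 := by
        rw [transpose_antipodeMat]
        simp only [← mul_assoc]
        rw [mul_assoc _ (scalarMat (B E) ((E : Matrix (Fin n) (Fin n) k)⁻¹)ᵀ)
          (scalarMat (B E) (E : Matrix (Fin n) (Fin n) k)ᵀ), scalarMat_transpose_inv_mul, mul_one,
          mul_assoc _ (gen E), mul_antipodeMat, mul_one, scalarMat_transpose_mul_inv]
      rw [this, Matrix.transpose_one, Matrix.map_one _ rfl rfl])
    (by
      rw [scalarMat_op, scalarMat_op, ← Matrix.transpose_map, map_op_mul, map_op_mul, map_op_mul]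
      simp only [Matrix.transpose_transpose, scalarMat_transpose]
      have : scalarMat (B E) (E : Matrix (Fin n) (Fin n) k)ᵀ *
          (antipodeMat E * (scalarMat (B E) ((E : Matrix (Fin n) (Fin n) k)⁻¹)ᵀ *
          (antipodeMat E)ᵀ)) = 1 := by
        rw [transpose_antipodeMat]
        simp only [← mul_assoc]
        rw [mul_assoc _ (scalarMat (B E) ((E : Matrix (Fin n) (Fin n) k)⁻¹)ᵀ)
          (scalarMat (B E) (E : Matrix (Fin n) (Fin n) k)ᵀ), scalarMat_transpose_inv_mul, mul_one,
          mul_assoc _ (antipodeMat E), antipodeMat_mul, mul_one, scalarMat_transpose_mul_inv]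
      rw [this, Matrix.transpose_one, Matrix.map_one _ rfl rfl])

/-- The antipode, as a linear map. -/
noncomputable def antipodeLin (E : GeneralLinearGroup (Fin n) k) : B E →ₗ[k] B E :=
  (MulOpposite.opLinearEquiv k).symm.toLinearMap ∘ₗ (antipodeHom E).toLinearMap

theorem antipodeLin_gen (E : GeneralLinearGroup (Fin n) k) (i j : Fin n) :
    antipodeLin E (gen E i j) = antipodeMat E i j := by
  simp [antipodeLin, antipodeHom]

theorem antipodeLin_mul (E : GeneralLinearGroup (Fin n) k) (a b : B E) :
    antipodeLin E (a * b) = antipodeLin E b * antipodeLin E a := by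
  simp [antipodeLin]

theorem antipodeLin_algebraMap (E : GeneralLinearGroup (Fin n) k) (c : k) :
    antipodeLin E (algebraMap k (B E) c) = algebraMap k (B E) c := by
  simp [antipodeLin]

theorem induction {E : GeneralLinearGroup (Fin n) k} {P : B E → Prop}
    (hc : ∀ c, P (algebraMap k (B E) c)) (hg : ∀ i j, P (gen E i j))
    (hm : ∀ a b, P a → P b → P (a * b)) (ha : ∀ a b, P a → P b → P (a + b)) (a : B E) : P a := by
  obtain ⟨x, rfl⟩ := RingQuot.mkAlgHom_surjective k (BRel E) a
  induction x using FreeAlgebra.induction with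
  | grade0 c => rw [AlgHom.commutes]; exact hc c
  | grade1 p => exact hg p.1 p.2
  | mul a b h₁ h₂ => rw [map_mul]; exact hm _ _ h₁ h₂
  | add a b h₁ h₂ => rw [map_add]; exact ha _ _ h₁ h₂

theorem antipode_left (E : GeneralLinearGroup (Fin n) k) (a : B E) :
    LinearMap.mul' k (B E) ((antipodeLin E).rTensor (B E) (comul (R := k) a)) =
      algebraMap k (B E) (counit (R := k) a) := by
  induction a using induction with
  | hc c =>
    rw [Bialgebra.comul_algebraMap, Bialgebra.counit_algebraMap,
      Algebra.TensorProduct.algebraMap_apply]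
    simp [antipodeLin_algebraMap]
  | hg i j =>
    rw [comul_gen, counit_gen]
    have h := congrFun (congrFun (antipodeMat_mul E) i) j
    simp only [Matrix.mul_apply] at h
    simp only [map_sum, LinearMap.rTensor_tmul, LinearMap.mul'_apply, antipodeLin_gen, h]
    rw [Matrix.one_apply, Matrix.one_apply]
    split_ifs <;> simp
  | hm a b h₁ h₂ =>
    have h : ∀ s t : B E ⊗[k] B E, ∀ c : k,
        LinearMap.mul' k (B E) ((antipodeLin E).rTensor (B E) s) = algebraMap k (B E) c →
        LinearMap.mul' k (B E) ((antipodeLin E).rTensor (B E) (s * t)) =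
        algebraMap k (B E) c * LinearMap.mul' k (B E) ((antipodeLin E).rTensor (B E) t) := by
      intro s t c hs
      induction t with
      | zero => simp
      | add a b ha hb => simp only [map_add, mul_add, ha, hb]
      | tmul x y =>
        have h' : LinearMap.mul' k (B E) ((antipodeLin E).rTensor (B E) (s * x ⊗ₜ[k] y)) =
            antipodeLin E x * LinearMap.mul' k (B E) ((antipodeLin E).rTensor (B E) s) * y := by
          clear hs
          induction s with
          | zero => simp
          | add a b ha hb => simp only [map_add, add_mul, mul_add, ha, hb]
          | tmul v w => simp [antipodeLin_mul, mul_assoc]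
        rw [h', hs, ← Algebra.commutes c, mul_assoc]
        simp
    rw [Bialgebra.comul_mul, h _ _ _ h₁, h₂, Bialgebra.counit_mul, map_mul]
  | ha a b h₁ h₂ => simp only [map_add, h₁, h₂]

theorem antipode_right (E : GeneralLinearGroup (Fin n) k) (a : B E) :
    LinearMap.mul' k (B E) ((antipodeLin E).lTensor (B E) (comul (R := k) a)) =
      algebraMap k (B E) (counit (R := k) a) := by
  induction a using induction with
  | hc c =>
    rw [Bialgebra.comul_algebraMap, Bialgebra.counit_algebraMap,
      Algebra.TensorProduct.algebraMap_apply']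
    simp [antipodeLin_algebraMap]
  | hg i j =>
    rw [comul_gen, counit_gen]
    have h := congrFun (congrFun (mul_antipodeMat E) i) j
    simp only [Matrix.mul_apply] at h
    simp only [map_sum, LinearMap.lTensor_tmul, LinearMap.mul'_apply, antipodeLin_gen, h]
    rw [Matrix.one_apply, Matrix.one_apply]
    split_ifs <;> simp
  | hm a b h₁ h₂ =>
    have h : ∀ s t : B E ⊗[k] B E, ∀ c : k,
        LinearMap.mul' k (B E) ((antipodeLin E).lTensor (B E) t) = algebraMap k (B E) c →
        LinearMap.mul' k (B E) ((antipodeLin E).lTensor (B E) (s * t)) =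
        LinearMap.mul' k (B E) ((antipodeLin E).lTensor (B E) s) * algebraMap k (B E) c := by
      intro s t c ht
      induction s with
      | zero => simp
      | add a b ha hb => simp only [map_add, add_mul, ha, hb]
      | tmul x y =>
        have h' : LinearMap.mul' k (B E) ((antipodeLin E).lTensor (B E) (x ⊗ₜ[k] y * t)) =
            x * LinearMap.mul' k (B E) ((antipodeLin E).lTensor (B E) t) * antipodeLin E y := by
          clear ht
          induction t with
          | zero => simp
          | add a b ha hb => simp only [map_add, add_mul, mul_add, ha, hb]
          | tmul v w => simp [antipodeLin_mul, mul_assoc]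
        rw [h', ht, mul_assoc, Algebra.commutes c, ← mul_assoc]
        simp
    rw [Bialgebra.comul_mul, h _ _ _ h₂, h₁, Bialgebra.counit_mul, map_mul]
  | ha a b h₁ h₂ => simp only [map_add, h₁, h₂]

noncomputable instance instHopfAlgebra (E : GeneralLinearGroup (Fin n) k) :
    HopfAlgebra k (B E) where
  antipode := antipodeLin E
  mul_antipode_rTensor_comul := LinearMap.ext (antipode_left E)
  mul_antipode_lTensor_comul := LinearMap.ext (antipode_right E)

end B

/-- The coaction `e i ↦ ∑ l, e l ⊗ u l i` on `k ^ n`. -/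
noncomputable def fundCoact (E : GeneralLinearGroup (Fin n) k) :
    (Fin n → k) →ₗ[k] (Fin n → k) ⊗[k] B E :=
  (Pi.basisFun k (Fin n)).constr k fun i => ∑ l, Pi.single l (1 : k) ⊗ₜ[k] B.gen E l i

theorem fundCoact_single (E : GeneralLinearGroup (Fin n) k) (i : Fin n) :
    fundCoact E (Pi.single i 1) = ∑ l, Pi.single l (1 : k) ⊗ₜ[k] B.gen E l i := by
  rw [fundCoact, ← Pi.basisFun_apply k (Fin n) i, Module.Basis.constr_basis]

/-- The fundamental comodule `V_E`. -/
noncomputable def fundComodule (E : GeneralLinearGroup (Fin n) k) : RightComodule k (B E) where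
  carrier := Fin n → k
  coact := fundCoact E
  coassoc := by
    apply (Pi.basisFun k (Fin n)).ext
    intro i
    simp only [Pi.basisFun_apply, LinearMap.comp_apply, fundCoact_single, map_sum,
      LinearMap.rTensor_tmul, LinearMap.lTensor_tmul, B.comul_gen, sum_tmul, tmul_sum,
      LinearEquiv.coe_coe, TensorProduct.assoc_tmul]
    rw [Finset.sum_comm]
  counit_coact := by
    apply (Pi.basisFun k (Fin n)).ext
    intro i
    simp only [Pi.basisFun_apply, LinearMap.comp_apply, fundCoact_single, map_sum,
      LinearMap.lTensor_tmul, B.counit_gen, LinearEquiv.coe_coe, TensorProduct.rid_tmul]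
    simp [Matrix.one_apply]

instance (E : GeneralLinearGroup (Fin n) k) : FiniteDimensional k (fundComodule E).carrier :=
  inferInstanceAs (FiniteDimensional k (Fin n → k))

end BilinearForm
section Resolution
universe u
variable {k A : Type u} [Field k] [Ring A] [HopfAlgebra k A]

/-- A Yetter-Drinfeld module is free if it is isomorphic to `V ⊠ A` for some comodule `V`. -/
def YDModule.IsFree (M : YDModule k A) : Prop :=
  ∃ (V : RightComodule k A) (f : YDHom M (YDModule.free V)), Function.Bijective f.toLinearMap

/-- The sequence `⋯ → P 2 → P 1 → P 0 → M → 0`, with maps `d` and augmentation `aug`, is a free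
Yetter-Drinfeld resolution of `M`: the `P i` are free Yetter-Drinfeld modules and it is exact. -/
def IsFreeYDResolution {M : YDModule k A} (P : ℕ → YDModule k A)
    (d : ∀ i, YDHom (P (i + 1)) (P i)) (aug : YDHom (P 0) M) : Prop :=
  (∀ i, (P i).IsFree) ∧
    (∀ i, Function.Exact (d (i + 1)).toLinearMap (d i).toLinearMap) ∧
    Function.Exact (d 0).toLinearMap aug.toLinearMap ∧
    Function.Surjective aug.toLinearMap

/-- The terms `⋯ 0, 0, P₃, P₂, P₁, P₀` of a complex of length three. -/
noncomputable def threeTerm (P₀ P₁ P₂ P₃ : YDModule k A) : ℕ → YDModule k A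
  | 0 => P₀
  | 1 => P₁
  | 2 => P₂
  | 3 => P₃
  | _ + 4 => YDModule.free (RightComodule.zero k A)

/-- The maps `⋯ → 0 → 0 → P₃ → P₂ → P₁ → P₀` of a complex of length three. -/
noncomputable def threeMap {P₀ P₁ P₂ P₃ : YDModule k A} (f₃ : YDHom P₃ P₂) (f₂ : YDHom P₂ P₁)
    (f₁ : YDHom P₁ P₀) : ∀ i, YDHom (threeTerm P₀ P₁ P₂ P₃ (i + 1)) (threeTerm P₀ P₁ P₂ P₃ i)
  | 0 => f₁
  | 1 => f₂
  | 2 => f₃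
  | 3 => YDHom.zero _ _
  | _ + 4 => YDHom.zero _ _

end Resolution

section Terms
universe u
open Matrix
variable {k : Type u} [Field k] {n : ℕ}

/-- `k ⊠ B(E)`. -/
noncomputable def freeOne (E : GeneralLinearGroup (Fin n) k) : YDModule k (B E) :=
  YDModule.free (RightComodule.trivial k (B E))

/-- `(V_E* ⊗ V_E) ⊠ B(E)`. -/
noncomputable def freeDualTensor (E : GeneralLinearGroup (Fin n) k) : YDModule k (B E) :=
  YDModule.free (RightComodule.tensor (fundComodule E).dual (fundComodule E))

/-- The element `1 ⊗ x` of `k ⊠ B(E)`. -/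
noncomputable def oneTensor (E : GeneralLinearGroup (Fin n) k) (x : B E) : (freeOne E).carrier :=
  (1 : k) ⊗ₜ[k] x

/-- The element `e i * ⊗ e j ⊗ x` of `(V_E* ⊗ V_E) ⊠ B(E)`, where `e` is the canonical basis of
`V_E = k ^ n` and `e i *` is the `i`-th coordinate function. -/
noncomputable def dualTensor (E : GeneralLinearGroup (Fin n) k) (i j : Fin n) (x : B E) :
    (freeDualTensor E).carrier :=
  ((LinearMap.proj i : Module.Dual k (Fin n → k)) ⊗ₜ[k] (Pi.single j 1 : Fin n → k)) ⊗ₜ[k] x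

end Terms
end BilinHopf

open Matrix BilinHopf

namespace BilinHopf
open TensorProduct Coalgebra HopfAlgebra

section Triangular
universe u v
variable {k : Type u} [Field k] {C : Type v} [AddCommGroup C] [Module k C]

/-- The operator `(t, m) ↦ (e t, t c + R m)` on `k × C`. -/
noncomputable def triangular : (k × C × Module.End k C) →ₗ[k] Module.End k (k × C) where
  toFun a := LinearMap.prod (a.1 • LinearMap.fst k k C)
    (LinearMap.coprod (LinearMap.toSpanSingleton k C a.2.1) a.2.2)
  map_add' a b := by
    refine LinearMap.ext fun m => ?_
    simp [add_mul, add_add_add_comm]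
  map_smul' c a := by
    refine LinearMap.ext fun m => ?_
    simp [mul_assoc, smul_comm c]

theorem triangular_apply (a : k × C × Module.End k C) (t : k) (m : C) :
    triangular a (t, m) = (a.1 * t, t • a.2.1 + a.2.2 m) := rfl

theorem triangular_mul (a b : k × C × Module.End k C) :
    triangular a * triangular b = triangular (a.1 * b.1, b.1 • a.2.1 + a.2.2 b.2.1, a.2.2 * b.2.2) := by
  refine LinearMap.ext fun m => ?_
  obtain ⟨t, m⟩ := m
  simp only [Module.End.mul_apply, triangular_apply, mul_assoc, map_add, map_smul, smul_add,
    smul_smul, add_assoc, mul_comm t]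

theorem triangular_one : triangular ((1 : k), (0 : C), (1 : Module.End k C)) = 1 := by
  refine LinearMap.ext fun m => ?_
  obtain ⟨t, m⟩ := m
  simp [triangular_apply]

end Triangular

section QuadraticAlgebra
universe u
variable {k : Type u} [Field k] {n : ℕ}

/-- The single quadratic relation `∑ F a b x a x b = 0`. -/
inductive QRel (F : Matrix (Fin n) (Fin n) k) :
    FreeAlgebra k (Fin n) → FreeAlgebra k (Fin n) → Prop
  | rel : QRel F (∑ a, ∑ b, F a b • (FreeAlgebra.ι k a * FreeAlgebra.ι k b)) 0

/-- The quadratic algebra with generators `x i` and the relation `∑ F a b x a x b = 0`. -/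
def QuadAlg (F : Matrix (Fin n) (Fin n) k) : Type u := RingQuot (QRel F)

namespace QuadAlg

noncomputable instance (F : Matrix (Fin n) (Fin n) k) : Ring (QuadAlg F) :=
  inferInstanceAs (Ring (RingQuot (QRel F)))

noncomputable instance (F : Matrix (Fin n) (Fin n) k) : Algebra k (QuadAlg F) :=
  inferInstanceAs (Algebra k (RingQuot (QRel F)))

/-- The projection from the free algebra. -/
noncomputable def mk (F : Matrix (Fin n) (Fin n) k) : FreeAlgebra k (Fin n) →ₐ[k] QuadAlg F :=
  RingQuot.mkAlgHom k (QRel F)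

theorem mk_surjective (F : Matrix (Fin n) (Fin n) k) : Function.Surjective (mk F) :=
  RingQuot.mkAlgHom_surjective k (QRel F)

/-- The generators. -/
noncomputable def x (F : Matrix (Fin n) (Fin n) k) (i : Fin n) : QuadAlg F :=
  mk F (FreeAlgebra.ι k i)

theorem rel (F : Matrix (Fin n) (Fin n) k) : ∑ a, ∑ b, F a b • (x F a * x F b) = 0 := by
  have h : mk F _ = mk F _ := RingQuot.mkAlgHom_rel k (QRel.rel (F := F))
  simp only [map_sum, map_smul, map_mul, map_zero] at h
  exact h

variable {A : Type u} [Ring A] [Algebra k A]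

/-- The universal property of `QuadAlg F`. -/
noncomputable def lift (F : Matrix (Fin n) (Fin n) k) (w : Fin n → A)
    (h : ∑ a, ∑ b, F a b • (w a * w b) = 0) : QuadAlg F →ₐ[k] A :=
  RingQuot.liftAlgHom k ⟨FreeAlgebra.lift k w, by
    intro x y hr
    cases hr
    simpa using h⟩

@[simp]
theorem lift_x (F : Matrix (Fin n) (Fin n) k) (w : Fin n → A) (h) (i : Fin n) :
    lift F w h (x F i) = w i :=
  (RingQuot.liftAlgHom_mkAlgHom_apply k _ _ _).trans (by simp)

/-- Induction by multiplying with generators from the left. -/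
theorem induction {F : Matrix (Fin n) (Fin n) k} {P : QuadAlg F → Prop}
    (one : P 1) (mul : ∀ i p, P p → P (x F i * p))
    (add : ∀ p q, P p → P q → P (p + q)) (smul : ∀ (c : k) p, P p → P (c • p))
    (p : QuadAlg F) : P p := by
  obtain ⟨f, rfl⟩ := mk_surjective F p
  have : ∀ q : QuadAlg F, P q → P (mk F f * q) := by
    induction f using FreeAlgebra.induction with
    | grade0 c =>
      intro q hq
      rw [AlgHom.commutes, ← Algebra.smul_def]
      exact smul c q hq
    | grade1 i => exact fun q hq => mul i q hq
    | mul a b h₁ h₂ =>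
      intro q hq
      rw [map_mul, mul_assoc]
      exact h₁ _ (h₂ q hq)
    | add a b h₁ h₂ =>
      intro q hq
      rw [map_add, add_mul]
      exact add _ _ (h₁ q hq) (h₂ q hq)
  have h := this 1 one
  rwa [mul_one] at h

section Grading

open Polynomial

/-- The algebra map `x i ↦ x i T` that records the degree. -/
noncomputable def degHom (F : Matrix (Fin n) (Fin n) k) : QuadAlg F →ₐ[k] (QuadAlg F)[X] :=
  lift F (fun i => C (x F i) * X) (by
    have : ∀ a b, F a b • ((C (x F a) * X) * (C (x F b) * X)) =
        C (F a b • (x F a * x F b)) * X ^ 2 := by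
      intro a b
      rw [mul_assoc, ← mul_assoc X, X_mul_C, mul_assoc, ← mul_assoc, ← C_mul, ← sq,
        ← smul_mul_assoc, smul_C]
    simp only [this, ← Finset.sum_mul, ← map_sum, rel, map_zero, zero_mul])

theorem degHom_x_mul (F : Matrix (Fin n) (Fin n) k) (i : Fin n) (p : QuadAlg F) :
    degHom F (x F i * p) = C (x F i) * (X * degHom F p) := by
  simp [degHom, mul_assoc]

/-- The projection to the homogeneous component of degree `d`. -/
noncomputable def proj (F : Matrix (Fin n) (Fin n) k) (d : ℕ) : QuadAlg F →ₗ[k] QuadAlg F where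
  toFun p := (degHom F p).coeff d
  map_add' := by simp
  map_smul' := by simp

variable {F : Matrix (Fin n) (Fin n) k}

theorem proj_apply (d : ℕ) (p : QuadAlg F) : proj F d p = (degHom F p).coeff d := rfl

@[simp]
theorem proj_zero_x_mul (i : Fin n) (p : QuadAlg F) : proj F 0 (x F i * p) = 0 := by
  simp [proj_apply, degHom_x_mul]

@[simp]
theorem proj_succ_x_mul (d : ℕ) (i : Fin n) (p : QuadAlg F) :
    proj F (d + 1) (x F i * p) = x F i * proj F d p := by
  simp [proj_apply, degHom_x_mul]

@[simp]
theorem proj_zero_one : proj F 0 1 = 1 := by simp [proj_apply]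

@[simp]
theorem proj_succ_one (d : ℕ) : proj F (d + 1) 1 = 0 := by
  simp [proj_apply, coeff_one]

theorem proj_proj (d : ℕ) (p : QuadAlg F) : proj F d (proj F d p) = proj F d p := by
  induction p using QuadAlg.induction generalizing d with
  | one => cases d <;> simp
  | mul i p h => cases d <;> simp [h]
  | add p q h₁ h₂ => simp [h₁, h₂]
  | smul c p h => simp [h]

theorem eq_zero_of_proj {p : QuadAlg F} (h : ∀ d, proj F d p = 0) : p = 0 := by
  have h0 : degHom F p = 0 := Polynomial.ext h
  have h1 : ∀ p : QuadAlg F, (degHom F p).sum (fun _ a => a) = p := by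
    intro p
    have hs : ∀ f : (QuadAlg F)[X], f.sum (fun _ a => a) = Polynomial.eval 1 f := by
      intro f; simp [Polynomial.eval_eq_sum]
    rw [hs]
    induction p using QuadAlg.induction with
    | one => simp
    | mul i p h =>
      rw [degHom_x_mul, eval_C_mul, X_mul, eval_mul_X, mul_one, h]
    | add p q h₁ h₂ => simp [h₁, h₂]
    | smul c p h => simp [h]
  rw [← h1 p, h0, Polynomial.sum_zero_index]

theorem exists_proj_succ (p : QuadAlg F) :
    ∃ q : Fin n → QuadAlg F, ∀ d, proj F (d + 1) p = ∑ i, x F i * proj F d (q i) := by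
  induction p using QuadAlg.induction with
  | one => exact ⟨0, by simp⟩
  | mul i p h =>
    refine ⟨Pi.single i p, fun d => ?_⟩
    rw [proj_succ_x_mul, Finset.sum_eq_single i] <;> simp +contextual
  | add p q h₁ h₂ =>
    obtain ⟨f, hf⟩ := h₁
    obtain ⟨g, hg⟩ := h₂
    exact ⟨f + g, fun d => by simp [hf, hg, mul_add, Finset.sum_add_distrib]⟩
  | smul c p h =>
    obtain ⟨f, hf⟩ := h
    exact ⟨c • f, fun d => by simp [hf, Finset.smul_sum]⟩

theorem exists_proj_zero (p : QuadAlg F) : ∃ c : k, proj F 0 p = c • 1 := by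
  induction p using QuadAlg.induction with
  | one => exact ⟨1, by simp⟩
  | mul i p h => exact ⟨0, by simp⟩
  | add p q h₁ h₂ =>
    obtain ⟨f, hf⟩ := h₁
    obtain ⟨g, hg⟩ := h₂
    exact ⟨f + g, by simp [hf, hg, add_smul]⟩
  | smul c p h =>
    obtain ⟨f, hf⟩ := h
    exact ⟨c • f, by simp [hf, smul_smul]⟩

end Grading

section Exactness

variable (F : Matrix (Fin n) (Fin n) k)

/-- The linear form `∑ c i x i`. -/
noncomputable def form (c : Fin n → k) : QuadAlg F := ∑ i, c i • x F i

/-- The map `r ↦ ((F x) i r)`. -/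
noncomputable def syz : QuadAlg F →ₗ[k] (Fin n → QuadAlg F) :=
  LinearMap.pi fun i => LinearMap.mulLeft k (form F (F i))

theorem syz_apply (r : QuadAlg F) (i : Fin n) : syz F r i = form F (F i) * r := rfl

/-- Right multiplication on the cokernel of `syz`. -/
noncomputable def cokMul (b : QuadAlg F) :
    ((Fin n → QuadAlg F) ⧸ LinearMap.range (syz F)) →ₗ[k]
      ((Fin n → QuadAlg F) ⧸ LinearMap.range (syz F)) :=
  Submodule.mapQ _ _ (LinearMap.pi fun i => LinearMap.mulRight k b ∘ₗ LinearMap.proj i) (by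
    rintro _ ⟨r, rfl⟩
    exact ⟨r * b, by ext i; simp [syz_apply, mul_assoc]⟩)

theorem cokMul_mk (b : QuadAlg F) (v : Fin n → QuadAlg F) :
    cokMul F b (Submodule.Quotient.mk v) = Submodule.Quotient.mk fun i => v i * b := rfl

/-- The right action of `QuadAlg F` on `k × coker`. -/
noncomputable def foxHom : QuadAlg F →ₐ[k]
    (Module.End k (k × ((Fin n → QuadAlg F) ⧸ LinearMap.range (syz F))))ᵐᵒᵖ :=
  lift F (fun b => MulOpposite.op
      (triangular (0, Submodule.Quotient.mk (Pi.single b 1), cokMul F (x F b)))) (by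
    simp only [← MulOpposite.op_mul, ← MulOpposite.op_smul, ← Finset.op_sum, triangular_mul,
      ← map_smul, ← map_sum]
    rw [← MulOpposite.op_zero, ← map_zero triangular]
    congr 2
    refine Prod.ext (by simp [Prod.fst_sum]) (Prod.ext ?_ ?_)
    · simp only [zero_smul, zero_add, cokMul_mk, Prod.snd_sum, Prod.fst_sum, Prod.smul_mk,
        Prod.snd_zero, Prod.fst_zero, ← Submodule.Quotient.mk_smul]
      simp only [← Submodule.mkQ_apply, ← map_sum]
      rw [Submodule.mkQ_apply, Submodule.Quotient.mk_eq_zero]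
      refine ⟨1, ?_⟩
      ext i
      simp [syz_apply, form, Finset.sum_apply, Pi.single_apply, Finset.sum_ite_eq]
    · simp only [Prod.snd_sum, Prod.smul_mk, Prod.snd_zero]
      refine LinearMap.ext fun m => ?_
      obtain ⟨v, rfl⟩ := Submodule.Quotient.mk_surjective _ m
      simp only [LinearMap.sum_apply, LinearMap.smul_apply, Module.End.mul_apply, cokMul_mk,
        ← Submodule.Quotient.mk_smul]
      simp only [← Submodule.mkQ_apply, ← map_sum]
      rw [LinearMap.zero_apply, ← map_zero (Submodule.mkQ _)]
      congr 1
      ext i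
      have := congrArg (v i * ·) (rel F)
      simpa [Finset.sum_apply, Finset.mul_sum, mul_assoc] using this)

theorem foxHom_x (b : Fin n) : (foxHom F (x F b)).unop =
    triangular (0, Submodule.Quotient.mk (Pi.single b 1), cokMul F (x F b)) := by
  simp [foxHom]

theorem foxHom_apply_mk (q : QuadAlg F) (v : Fin n → QuadAlg F) :
    (foxHom F q).unop (0, Submodule.Quotient.mk v) =
      (0, Submodule.Quotient.mk fun i => v i * q) := by
  induction q using QuadAlg.induction generalizing v with
  | one => simp
  | mul i p h =>
    rw [map_mul, MulOpposite.unop_mul, Module.End.mul_apply, foxHom_x, triangular_apply, zero_mul,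
      zero_smul, zero_add, cokMul_mk, h]
    simp only [mul_assoc]
  | add p q h₁ h₂ =>
    rw [map_add, MulOpposite.unop_add, LinearMap.add_apply, h₁, h₂, Prod.mk_add_mk, add_zero,
      ← Submodule.Quotient.mk_add]
    simp only [mul_add]
    rfl
  | smul c p h =>
    rw [map_smul, MulOpposite.unop_smul, LinearMap.smul_apply, h, Prod.smul_mk, smul_zero,
      ← Submodule.Quotient.mk_smul]
    simp only [mul_smul_comm]
    rfl

/-- The sequence `P → Pⁿ → P`, `r ↦ ((F x) i r)`, `p ↦ ∑ x i p i`, is exact. -/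
theorem exists_syz {p : Fin n → QuadAlg F} (h : ∑ i, x F i * p i = 0) :
    ∃ r, ∀ i, p i = form F (F i) * r := by
  have h1 : ∀ i, (foxHom F (x F i * p i)).unop (1, 0) =
      (0, Submodule.Quotient.mk (Pi.single i (p i))) := by
    intro i
    rw [map_mul, MulOpposite.unop_mul, Module.End.mul_apply, foxHom_x, triangular_apply, zero_mul,
      one_smul, map_zero, add_zero, foxHom_apply_mk]
    congr 2
    ext j
    by_cases hj : j = i
    · subst hj; simp
    · simp [hj]
  have h2 : (∑ i, (foxHom F (x F i * p i)).unop) (1, 0) = 0 := by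
    rw [← Finset.unop_sum, ← map_sum, h, map_zero, MulOpposite.unop_zero, LinearMap.zero_apply]
  rw [LinearMap.sum_apply] at h2
  simp only [h1] at h2
  have h3 := congrArg Prod.snd h2
  simp only [Prod.snd_sum, Prod.snd_zero, ← Submodule.mkQ_apply, ← map_sum] at h3
  rw [Submodule.mkQ_apply, Submodule.Quotient.mk_eq_zero] at h3
  obtain ⟨r, hr⟩ := h3
  refine ⟨r, fun i => ?_⟩
  have := congrFun hr i
  rw [syz_apply] at this
  rw [this, Finset.sum_apply, Finset.sum_eq_single i] <;> simp +contextual [eq_comm]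

theorem proj_zero_form_mul (c : Fin n → k) (p : QuadAlg F) :
    proj F 0 (form F c * p) = 0 := by
  simp [form, Finset.sum_mul]

theorem proj_succ_form_mul (d : ℕ) (c : Fin n → k) (p : QuadAlg F) :
    proj F (d + 1) (form F c * p) = form F c * proj F d p := by
  simp [form, Finset.sum_mul]

theorem sum_smul_form_mul (c : Fin n → k) (r : QuadAlg F) :
    ∑ i, c i • (form F (F i) * r) = form F (c ᵥ* F) * r := by
  simp only [form, Finset.sum_mul, Finset.smul_sum, Matrix.vecMul, dotProduct, Finset.sum_smul,
    smul_mul_assoc, smul_smul]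
  rw [Finset.sum_comm]

variable {F}

/-- Left multiplication by a nonzero linear form is injective. -/
theorem eq_zero_of_form_mul (hn : 2 ≤ n) (hF : IsUnit F) {c : Fin n → k} (hc : c ≠ 0)
    {p : QuadAlg F} (h : form F c * p = 0) : p = 0 := by
  have key : ∀ d, ∀ c : Fin n → k, c ≠ 0 → ∀ p : QuadAlg F, form F c * proj F d p = 0 →
      proj F d p = 0 := by
    intro d
    induction d with
    | zero =>
      intro c hc p hp
      obtain ⟨i, hi⟩ := Function.ne_iff.1 hc
      obtain ⟨r, hr⟩ := exists_syz F (p := fun i => c i • proj F 0 p) (by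
        rw [← hp, form, Finset.sum_mul]
        simp)
      have h1 := congrArg (proj F 0) (hr i)
      rw [proj_zero_form_mul, map_smul, proj_proj] at h1
      exact (smul_eq_zero.1 h1).resolve_left hi
    | succ d ih =>
      intro c hc p hp
      obtain ⟨i, hi⟩ := Function.ne_iff.1 hc
      obtain ⟨r, hr⟩ := exists_syz F (p := fun i => c i • proj F (d + 1) p) (by
        rw [← hp, form, Finset.sum_mul]
        simp)
      have hr' : ∀ i, c i • proj F (d + 1) p = form F (F i) * proj F d r := by
        intro i
        have h1 := congrArg (proj F (d + 1)) (hr i)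
        rwa [proj_succ_form_mul, map_smul, proj_proj] at h1
      obtain ⟨j, hj⟩ : ∃ j, j ≠ i := by
        have : Nontrivial (Fin n) := Fin.nontrivial_iff_two_le.2 hn
        exact exists_ne i
      set m : Fin n → k := Pi.single i (c j) - Pi.single j (c i) with hm
      have hm0 : m ≠ 0 := by
        intro h0
        have := congrFun h0 j
        simp [hm, hj] at this
        exact hi this
      have h2 : form F (m ᵥ* F) * proj F d r = 0 := by
        rw [← sum_smul_form_mul]
        simp only [← hr', smul_smul, ← Finset.sum_smul]
        have : ∑ l, m l * c l = 0 := by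
          simp [hm, sub_mul, Finset.sum_sub_distrib, Pi.single_apply]
          ring
        rw [this, zero_smul]
      have h3 : m ᵥ* F ≠ 0 := by
        intro h0
        apply hm0
        obtain ⟨F', rfl⟩ := hF
        have := congrArg (· ᵥ* (↑F'⁻¹ : Matrix (Fin n) (Fin n) k)) h0
        simpa [Matrix.vecMul_vecMul] using this
      have h4 := ih _ h3 r h2
      have h5 := hr' i
      rw [h4, mul_zero] at h5
      exact (smul_eq_zero.1 h5).resolve_left hi
  apply eq_zero_of_proj
  intro d
  refine key d c hc p ?_
  rw [← proj_succ_form_mul, h, map_zero]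

/-- The anti-isomorphism to the algebra with the transposed relation. -/
noncomputable def rev (F F' : Matrix (Fin n) (Fin n) k) (h : ∀ a b, F' a b = F b a) :
    QuadAlg F →ₐ[k] (QuadAlg F')ᵐᵒᵖ :=
  lift F (fun i => MulOpposite.op (x F' i)) (by
    simp only [← MulOpposite.op_mul, ← MulOpposite.op_smul, ← Finset.op_sum]
    rw [Finset.sum_comm]
    simp only [← h, rel, MulOpposite.op_zero])

theorem rev_x (F F' : Matrix (Fin n) (Fin n) k) (h : ∀ a b, F' a b = F b a) (i : Fin n) :
    rev F F' h (x F i) = MulOpposite.op (x F' i) := by simp [rev]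

theorem rev_form (F F' : Matrix (Fin n) (Fin n) k) (h : ∀ a b, F' a b = F b a) (c : Fin n → k) :
    rev F F' h (form F c) = MulOpposite.op (form F' c) := by simp [form, rev_x]

theorem rev_rev (F F' : Matrix (Fin n) (Fin n) k) (h : ∀ a b, F' a b = F b a)
    (h' : ∀ a b, F a b = F' b a) (p : QuadAlg F) :
    (rev F' F h' (rev F F' h p).unop).unop = p := by
  induction p using QuadAlg.induction with
  | one => simp
  | mul i p h => simp [rev_x, h]
  | add p q h₁ h₂ => simp [h₁, h₂]
  | smul c p h => simp [h]

/-- Right multiplication by a nonzero linear form is injective. -/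
theorem eq_zero_of_mul_form (hn : 2 ≤ n) (hF : IsUnit F) {c : Fin n → k} (hc : c ≠ 0)
    {p : QuadAlg F} (h : p * form F c = 0) : p = 0 := by
  have hT : ∀ a b, Fᵀ a b = F b a := fun _ _ => rfl
  have h1 : (rev F Fᵀ hT (p * form F c)).unop = 0 := by rw [h]; simp
  rw [map_mul, rev_form, MulOpposite.unop_mul, MulOpposite.unop_op] at h1
  have h2 := eq_zero_of_form_mul hn ((Matrix.isUnit_transpose F).2 hF) hc h1
  rw [← rev_rev F Fᵀ hT (fun a b => (hT b a).symm) p, h2]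
  simp

end Exactness
end QuadAlg
end QuadraticAlgebra

section Telescope
universe u
variable {k : Type u} [Field k] {A : Type u} [Ring A] [Algebra k A]

variable (k) in
/-- The colimit of `A → A → A → ⋯`, where all maps are the right multiplication by `ξ`. -/
def Telescope (ξ : A) : Type u :=
  Module.DirectLimit (R := k) (fun _ : ℕ => A) fun i j _ => LinearMap.mulRight k (ξ ^ (j - i))

namespace Telescope

noncomputable instance (ξ : A) : AddCommGroup (Telescope k ξ) :=
  inferInstanceAs (AddCommGroup (Module.DirectLimit (R := k) (fun _ : ℕ => A)
    fun i j _ => LinearMap.mulRight k (ξ ^ (j - i))))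

noncomputable instance (ξ : A) : Module k (Telescope k ξ) :=
  inferInstanceAs (Module k (Module.DirectLimit (R := k) (fun _ : ℕ => A)
    fun i j _ => LinearMap.mulRight k (ξ ^ (j - i))))

instance (ξ : A) : DirectedSystem (fun _ : ℕ => A)
    (fun i j (_ : i ≤ j) => LinearMap.mulRight k (ξ ^ (j - i))) where
  map_self i x := by simp
  map_map i j l h₁ h₂ x := by
    simp only [LinearMap.mulRight_apply, mul_assoc, ← pow_add]
    congr 2
    omega

variable (k) in
/-- The element of the telescope represented by `p` at place `m`. -/
noncomputable def of (ξ : A) (m : ℕ) : A →ₗ[k] Telescope k ξ :=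
  Module.DirectLimit.of k ℕ (fun _ : ℕ => A) _ m

theorem of_succ (ξ : A) (m : ℕ) (p : A) : of k ξ (m + 1) (p * ξ) = of k ξ m p := by
  have h := Module.DirectLimit.of_f (R := k) (G := fun _ : ℕ => A)
    (f := fun i j _ => LinearMap.mulRight k (ξ ^ (j - i))) (hij := Nat.le_succ m) (x := p)
  have hp : p * ξ = LinearMap.mulRight k (ξ ^ (m.succ - m)) p := by simp
  rw [hp]
  exact h

theorem exists_of {ξ : A} (v : Telescope k ξ) : ∃ m p, of k ξ m p = v :=
  Module.DirectLimit.exists_of v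

theorem eq_zero_of {ξ : A} (hξ : ∀ p : A, p * ξ = 0 → p = 0) {m : ℕ} {p : A}
    (h : of k ξ m p = 0) : p = 0 := by
  obtain ⟨j, hj, h⟩ := Module.DirectLimit.of.zero_exact h
  have : ∀ (i : ℕ), p * ξ ^ i = 0 → p = 0 := by
    intro i
    induction i with
    | zero => simp
    | succ i ih =>
      intro h
      rw [pow_succ, ← mul_assoc] at h
      exact ih (hξ _ h)
  exact this _ h

/-- The universal property of the telescope. -/
noncomputable def lift {N : Type u} [AddCommGroup N] [Module k N] (ξ : A) (g : ℕ → A →ₗ[k] N)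
    (hg : ∀ m p, g (m + 1) (p * ξ) = g m p) : Telescope k ξ →ₗ[k] N :=
  Module.DirectLimit.lift k ℕ _ _ g (by
    intro i j hij x
    induction j, hij using Nat.le_induction with
    | base => simp
    | succ j hj ih =>
      simp only [LinearMap.mulRight_apply] at ih ⊢
      rw [Nat.succ_sub hj, Nat.succ_eq_add_one, pow_succ, ← mul_assoc, hg, ih])

theorem lift_of {N : Type u} [AddCommGroup N] [Module k N] (ξ : A) (g : ℕ → A →ₗ[k] N)
    (hg : ∀ m p, g (m + 1) (p * ξ) = g m p) (m : ℕ) (p : A) :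
    lift ξ g hg (of k ξ m p) = g m p :=
  Module.DirectLimit.lift_of _ _ _

variable (k) in
/-- Left multiplication by `a` on the telescope. -/
noncomputable def leftMulEnd (ξ a : A) : Module.End k (Telescope k ξ) :=
  lift ξ (fun m => of k ξ m ∘ₗ LinearMap.mulLeft k a) fun m p => by simp [← mul_assoc, of_succ]

theorem leftMulEnd_of (ξ a : A) (m : ℕ) (p : A) :
    leftMulEnd k ξ a (of k ξ m p) = of k ξ m (a * p) :=
  lift_of _ _ _ _ _

variable (k) in
/-- The left action of `A` on the telescope. -/
noncomputable def leftMul (ξ : A) : A →ₐ[k] Module.End k (Telescope k ξ) :=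
  AlgHom.ofLinearMap
    { toFun := leftMulEnd k ξ
      map_add' := by
        intro a b
        refine LinearMap.ext fun v => ?_
        obtain ⟨m, p, rfl⟩ := exists_of v
        simp [leftMulEnd_of, add_mul]
      map_smul' := by
        intro a b
        refine LinearMap.ext fun v => ?_
        obtain ⟨m, p, rfl⟩ := exists_of v
        simp [leftMulEnd_of] }
    (by
      refine LinearMap.ext fun v => ?_
      obtain ⟨m, p, rfl⟩ := exists_of v
      simp [leftMulEnd_of])
    (by
      intro a b
      refine LinearMap.ext fun v => ?_
      obtain ⟨m, p, rfl⟩ := exists_of v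
      simp [leftMulEnd_of, mul_assoc])

theorem leftMul_of (ξ : A) (a : A) (m : ℕ) (p : A) :
    leftMul k ξ a (of k ξ m p) = of k ξ m (a * p) := by
  simp [leftMul, leftMulEnd_of]

end Telescope
end Telescope

section Oscillator
universe u
variable {k : Type u} [Field k] {n : ℕ}

namespace QuadAlg

variable {E : Matrix (Fin n) (Fin n) k} {M : Type u} [AddCommGroup M] [Module k M]

/-- The map `ζ ↦ ∑ E a b x a ζ b`. -/
noncomputable def contract (f : QuadAlg E →ₐ[k] Module.End k M) : (Fin n → M) →ₗ[k] M :=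
  ∑ a, ∑ b, E a b • (f (x E a) ∘ₗ LinearMap.proj b)

theorem contract_apply (f : QuadAlg E →ₐ[k] Module.End k M) (z : Fin n → M) :
    contract f z = ∑ a, ∑ b, E a b • f (x E a) (z b) := by
  simp [contract, LinearMap.sum_apply]

/-- The operator `ζ ↦ (q x i ζ j + (E⁻¹) i j ∑ E a b x a ζ b)`. -/
noncomputable def braid (q : k) (f : QuadAlg E →ₐ[k] Module.End k M) (j : Fin n) :
    Module.End k (Fin n → M) :=
  LinearMap.pi fun i => q • (f (x E i) ∘ₗ LinearMap.proj j) + E⁻¹ i j • contract f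

theorem braid_apply (q : k) (f : QuadAlg E →ₐ[k] Module.End k M) (j : Fin n) (z : Fin n → M)
    (i : Fin n) : braid q f j z i = q • f (x E i) (z j) + E⁻¹ i j • contract f z := rfl

theorem contract_braid (hE : IsUnit E) (q : k) (f : QuadAlg E →ₐ[k] Module.End k M) (j : Fin n)
    (z : Fin n → M) : contract f (braid q f j z) = f (x E j) (contract f z) := by
  have h1 : ∑ a, ∑ b, E a b • f (x E a) (f (x E b) (z j)) = 0 := by
    have := LinearMap.congr_fun (congrArg f (rel E)) (z j)
    simpa [LinearMap.sum_apply] using this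
  have h2 : ∀ a, ∑ b, E a b * E⁻¹ b j = (1 : Matrix (Fin n) (Fin n) k) a j := by
    intro a
    rw [← Matrix.mul_apply, Matrix.mul_nonsing_inv _ ((Matrix.isUnit_iff_isUnit_det E).1 hE)]
  rw [contract_apply]
  simp only [braid_apply, map_add, map_smul, smul_add, Finset.sum_add_distrib, smul_comm _ q,
    ← Finset.smul_sum, h1, smul_zero, zero_add]
  simp only [smul_smul, ← Finset.sum_smul, h2]
  simp [Matrix.one_apply, ite_smul]

/-- The extension of the action on `M` to `Mⁿ`. -/
noncomputable def braidHom (hE : IsUnit E) (q : k)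
    (hq : q * q + q * (∑ a, ∑ b, E a b * E⁻¹ a b) + 1 = 0)
    (f : QuadAlg E →ₐ[k] Module.End k M) : QuadAlg E →ₐ[k] Module.End k (Fin n → M) :=
  lift E (braid q f) (by
    refine LinearMap.ext fun z => funext fun i => ?_
    simp only [LinearMap.sum_apply, LinearMap.smul_apply, Module.End.mul_apply, Finset.sum_apply,
      Pi.smul_apply, LinearMap.zero_apply, Pi.zero_apply, braid_apply, contract_braid hE, map_add,
      map_smul]
    have h2 : ∀ b, ∑ a, E⁻¹ i a * E a b = (1 : Matrix (Fin n) (Fin n) k) i b := by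
      intro b
      rw [← Matrix.mul_apply, Matrix.nonsing_inv_mul _ ((Matrix.isUnit_iff_isUnit_det E).1 hE)]
    have h3 : ∑ a, ∑ b, E a b • q • q • f (x E i) (f (x E a) (z b)) =
        (q * q) • f (x E i) (contract f z) := by
      simp only [contract_apply, map_sum, map_smul, Finset.smul_sum, smul_smul]
      refine Finset.sum_congr rfl fun a _ => Finset.sum_congr rfl fun b _ => ?_
      congr 1; ring
    have h4 : ∑ a, ∑ b, E a b • q • E⁻¹ a b • f (x E i) (contract f z) =
        (q * ∑ a, ∑ b, E a b * E⁻¹ a b) • f (x E i) (contract f z) := by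
      simp only [smul_smul, ← Finset.sum_smul, Finset.mul_sum]
      congr 1
      refine Finset.sum_congr rfl fun a _ => Finset.sum_congr rfl fun b _ => ?_
      ring
    have h5 : ∑ a, ∑ b, E a b • E⁻¹ i a • f (x E b) (contract f z) =
        f (x E i) (contract f z) := by
      rw [Finset.sum_comm]
      simp only [smul_smul, ← Finset.sum_smul, mul_comm (E _ _), h2]
      simp [Matrix.one_apply, ite_smul]
    simp only [smul_add, Finset.sum_add_distrib, h3, h4, h5]
    rw [← add_smul]
    refine Eq.trans (b := (q * q + q * (∑ a, ∑ b, E a b * E⁻¹ a b) + 1) •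
      f (x E i) (contract f z)) ?_ ?_
    · rw [add_smul _ 1, one_smul]
    · rw [hq, zero_smul])

theorem braidHom_x (hE : IsUnit E) (q : k) (hq)
    (f : QuadAlg E →ₐ[k] Module.End k M) (j : Fin n) :
    braidHom hE q hq f (x E j) = braid q f j := by simp [braidHom]

theorem contract_braidHom (hE : IsUnit E) (q : k) (hq)
    (f : QuadAlg E →ₐ[k] Module.End k M) (p : QuadAlg E) (z : Fin n → M) :
    contract f (braidHom hE q hq f p z) = f p (contract f z) := by
  induction p using QuadAlg.induction with
  | one => simp
  | mul i p h => simp [braidHom_x, contract_braid hE, h]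
  | add p q h₁ h₂ => simp [h₁, h₂]
  | smul c p h => simp [h]

/-- There is an algebra that contains `QuadAlg E` and elements `z i` with `∑ E a b x a z b = 1`,
`∑ E a b z a z b = 0` and `z i x j = q x i z j + (E⁻¹) i j`. -/
theorem exists_oscillator (hn : 2 ≤ n) (hE : IsUnit E) (q : k)
    (hq : q * q + q * (∑ a, ∑ b, E a b * E⁻¹ a b) + 1 = 0)
    (c : Fin n → k) (hc : c ≠ 0) (hc' : c ⬝ᵥ (E *ᵥ c) = 0) :
    ∃ (L : Type u) (_ : Ring L) (_ : Algebra k L) (f : QuadAlg E →ₐ[k] L) (z : Fin n → L),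
      Function.Injective f ∧
      ∑ a, ∑ b, E a b • (f (x E a) * z b) = 1 ∧
      ∑ a, ∑ b, E a b • (z a * z b) = 0 ∧
      ∀ i j, z i * f (x E j) = q • (f (x E i) * z j) + algebraMap k L (E⁻¹ i j) := by
  obtain ⟨ξ, hξ⟩ : ∃ ξ, ξ = form E (E *ᵥ c) := ⟨_, rfl⟩
  have hmap : ∀ {N : Type u} [AddCommGroup N] [Module k N] (g : QuadAlg E →ₗ[k] N),
      g ξ = ∑ a, (E *ᵥ c) a • g (x E a) := by
    intro N _ _ g
    rw [hξ, form, map_sum]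
    simp only [map_smul]
  set f := Telescope.leftMul k ξ with hf
  have hξ0 : E *ᵥ c ≠ 0 := by
    intro h
    apply hc
    obtain ⟨E', rfl⟩ := hE
    have := congrArg ((↑E'⁻¹ : Matrix (Fin n) (Fin n) k) *ᵥ ·) h
    simpa [Matrix.mulVec_mulVec] using this
  have hinj : ∀ p : QuadAlg E, p * ξ = 0 → p = 0 := by
    rw [hξ]
    exact fun p h => eq_zero_of_mul_form hn hE hξ0 h
  set ζ : ℕ → Fin n → Telescope k ξ := fun m i => c i • Telescope.of k ξ (m + 1) 1 with hζ
  have hcξ : ∀ m, contract f (ζ m) = Telescope.of k ξ m 1 := by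
    intro m
    rw [contract_apply, ← Telescope.of_succ, one_mul, hmap]
    refine Finset.sum_congr rfl fun a _ => ?_
    simp only [hζ, map_smul, hf, Telescope.leftMul_of, mul_one, smul_smul, ← Finset.sum_smul]
    rfl
  have hρξ : ∀ m, braidHom hE q hq f ξ (ζ (m + 1)) = ζ m := by
    intro m
    funext i
    rw [← AlgHom.toLinearMap_apply, hmap]
    simp only [AlgHom.toLinearMap_apply, braidHom_x, LinearMap.sum_apply, LinearMap.smul_apply,
      Finset.sum_apply, Pi.smul_apply, braid_apply, hcξ, smul_add, Finset.sum_add_distrib]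
    have h1 : ∑ j, (E *ᵥ c) j • q • f (x E i) (ζ (m + 1) j) = 0 := by
      simp only [hζ, map_smul, smul_smul, ← Finset.sum_smul]
      rw [dotProduct_comm] at hc'
      simp only [mul_left_comm _ q, ← Finset.mul_sum]
      rw [show ∑ j, (E *ᵥ c) j * c j = 0 from hc', mul_zero, zero_smul]
    have h2 : ∑ j, E⁻¹ i j * (E *ᵥ c) j = c i := by
      have : (E⁻¹ *ᵥ (E *ᵥ c)) i = c i := by
        rw [Matrix.mulVec_mulVec,
          Matrix.nonsing_inv_mul _ ((Matrix.isUnit_iff_isUnit_det E).1 hE), Matrix.one_mulVec]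
      exact this
    rw [h1, zero_add]
    simp only [smul_smul, ← Finset.sum_smul, mul_comm ((E *ᵥ c) _), h2]
    rfl
  set Z : Telescope k ξ →ₗ[k] (Fin n → Telescope k ξ) := Telescope.lift ξ
    (fun m => LinearMap.applyₗ (ζ m) ∘ₗ (braidHom hE q hq f).toLinearMap) (by
      intro m p
      simp [hρξ]) with hZ
  have hZof : ∀ m p, Z (Telescope.of k ξ m p) = braidHom hE q hq f p (ζ m) := by
    intro m p
    rw [hZ, Telescope.lift_of]
    rfl
  have hcZ : ∀ v, contract f (Z v) = v := by
    intro v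
    obtain ⟨m, p, rfl⟩ := Telescope.exists_of v
    rw [hZof, contract_braidHom, hcξ, hf, Telescope.leftMul_of, mul_one]
  have hZx : ∀ j v, Z (f (x E j) v) = braid q f j (Z v) := by
    intro j v
    obtain ⟨m, p, rfl⟩ := Telescope.exists_of v
    rw [hf, Telescope.leftMul_of, hZof, hZof, map_mul, braidHom_x]
    rfl
  have hZx' : ∀ i j v, Z (f (x E j) v) i = q • f (x E i) (Z v j) + E⁻¹ i j • v := by
    intro i j v
    rw [hZx, braid_apply, hcZ]
  have hspan : ∀ v, ∃ w : Fin n → Telescope k ξ, v = ∑ j, f (x E j) (w j) := by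
    intro v
    refine ⟨fun j => ∑ b, E j b • Z v b, ?_⟩
    conv_lhs => rw [← hcZ v, contract_apply]
    simp
  refine ⟨Module.End k (Telescope k ξ), inferInstance, inferInstance, f,
    fun i => LinearMap.proj i ∘ₗ Z, ?_, ?_, ?_, ?_⟩
  · rw [injective_iff_map_eq_zero]
    intro p hp
    have := LinearMap.congr_fun hp (Telescope.of k ξ 0 1)
    rw [hf, Telescope.leftMul_of, mul_one] at this
    exact Telescope.eq_zero_of hinj this
  · refine LinearMap.ext fun v => ?_
    have := hcZ v
    rw [contract_apply] at this
    simpa [LinearMap.sum_apply] using this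
  · refine LinearMap.ext fun v => ?_
    have key : ∀ j v, ∑ a, ∑ b, E a b • Z (Z (f (x E j) v) b) a = 0 := by
      intro j v
      have e1 : ∀ a b, E a b • Z (Z (f (x E j) v) b) a =
          (q * q) • (E a b • f (x E a) (Z (Z v j) b)) + q • ((E a b * E⁻¹ a b) • Z v j) +
            (E a b * E⁻¹ b j) • Z v a := by
        intro a b
        rw [hZx', map_add, map_smul, map_smul, Pi.add_apply, Pi.smul_apply, Pi.smul_apply, hZx']
        simp only [smul_add, smul_smul]
        congr 2
        · congr 1; ring
        · congr 1; ring
      have h2 : ∀ a, ∑ b, E a b * E⁻¹ b j = (1 : Matrix (Fin n) (Fin n) k) a j := by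
        intro a
        rw [← Matrix.mul_apply, Matrix.mul_nonsing_inv _ ((Matrix.isUnit_iff_isUnit_det E).1 hE)]
      simp only [e1, Finset.sum_add_distrib, ← Finset.smul_sum, ← contract_apply, hcZ,
        ← Finset.sum_smul, h2]
      have h3 : ∑ a, (1 : Matrix (Fin n) (Fin n) k) a j • Z v a = (1 : k) • Z v j := by
        simp [Matrix.one_apply, ite_smul]
      rw [h3, smul_smul, ← add_smul, ← add_smul, hq, zero_smul]
    obtain ⟨w, rfl⟩ := hspan v
    rw [map_sum]
    simp only [LinearMap.zero_apply]
    refine Finset.sum_eq_zero fun j _ => ?_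
    have := key j (w j)
    simpa [LinearMap.sum_apply] using this
  · intro i j
    refine LinearMap.ext fun v => ?_
    simpa [Algebra.algebraMap_eq_smul_one] using hZx' i j v

end QuadAlg
end Oscillator

section Segre
universe u
variable {k : Type u} [Field k] {n : ℕ}

namespace QuadAlg

theorem rTensor_mulLeft {A B : Type u} [Ring A] [Algebra k A] [Ring B] [Algebra k B] (a : A)
    (g : A ⊗[k] B) : (LinearMap.mulLeft k a).rTensor B g = (a ⊗ₜ 1) * g := by
  induction g with
  | zero => simp
  | add x y hx hy => rw [map_add, hx, hy, mul_add]
  | tmul x y => simp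

theorem lTensor_mulLeft {A B : Type u} [Ring A] [Algebra k A] [Ring B] [Algebra k B] (b : B)
    (g : A ⊗[k] B) : (LinearMap.mulLeft k b).lTensor A g = (1 ⊗ₜ b) * g := by
  induction g with
  | zero => simp
  | add x y hx hy => rw [map_add, hx, hy, mul_add]
  | tmul x y => simp

/-- The map `p ↦ ∑ x i p i`. -/
noncomputable def gensMap (F : Matrix (Fin n) (Fin n) k) : (Fin n → QuadAlg F) →ₗ[k] QuadAlg F :=
  ∑ i, LinearMap.mulLeft k (x F i) ∘ₗ LinearMap.proj i

theorem gensMap_apply (F : Matrix (Fin n) (Fin n) k) (p : Fin n → QuadAlg F) :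
    gensMap F p = ∑ i, x F i * p i := by
  simp [gensMap, LinearMap.sum_apply]

theorem exact_syz (F : Matrix (Fin n) (Fin n) k) : Function.Exact (syz F) (gensMap F) := by
  intro p
  constructor
  · intro h
    obtain ⟨r, hr⟩ := exists_syz F (p := p) (by simpa [gensMap_apply] using h)
    exact ⟨r, funext fun i => (hr i).symm⟩
  · rintro ⟨r, rfl⟩
    have h := congrArg (· * r) (rel F)
    simpa [gensMap_apply, syz_apply, form, Finset.sum_mul, Finset.mul_sum, mul_assoc] using h

variable (F F' : Matrix (Fin n) (Fin n) k)

/-- The projection to the component of bidegree `(d, e)`. -/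
noncomputable def biproj (d e : ℕ) : QuadAlg F ⊗[k] QuadAlg F' →ₗ[k] QuadAlg F ⊗[k] QuadAlg F' :=
  TensorProduct.map (proj F d) (proj F' e)

variable {F F'}

theorem biproj_succ_left (d e : ℕ) (i : Fin n) (g : QuadAlg F ⊗[k] QuadAlg F') :
    biproj F F' (d + 1) e ((x F i ⊗ₜ 1) * g) = (x F i ⊗ₜ 1) * biproj F F' d e g := by
  induction g with
  | zero => simp
  | add x y hx hy => simp only [mul_add, map_add, hx, hy]
  | tmul x y => simp [biproj]

theorem biproj_succ_right (d e : ℕ) (i : Fin n) (g : QuadAlg F ⊗[k] QuadAlg F') :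
    biproj F F' d (e + 1) ((1 ⊗ₜ x F' i) * g) = (1 ⊗ₜ x F' i) * biproj F F' d e g := by
  induction g with
  | zero => simp
  | add x y hx hy => simp only [mul_add, map_add, hx, hy]
  | tmul x y => simp [biproj]

theorem biproj_zero_left (e : ℕ) (i : Fin n) (g : QuadAlg F ⊗[k] QuadAlg F') :
    biproj F F' 0 e ((x F i ⊗ₜ 1) * g) = 0 := by
  induction g with
  | zero => simp
  | add x y hx hy => simp only [mul_add, map_add, hx, hy, add_zero]
  | tmul x y => simp [biproj]

theorem biproj_zero_right (d : ℕ) (i : Fin n) (g : QuadAlg F ⊗[k] QuadAlg F') :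
    biproj F F' d 0 ((1 ⊗ₜ x F' i) * g) = 0 := by
  induction g with
  | zero => simp
  | add x y hx hy => simp only [mul_add, map_add, hx, hy, add_zero]
  | tmul x y => simp [biproj]

theorem biproj_biproj (d e : ℕ) (g : QuadAlg F ⊗[k] QuadAlg F') :
    biproj F F' d e (biproj F F' d e g) = biproj F F' d e g := by
  induction g with
  | zero => simp
  | add x y hx hy => simp only [map_add, hx, hy]
  | tmul x y => simp [biproj, proj_proj]

theorem biproj_zero_one : biproj F F' 0 0 1 = 1 := by
  simp [biproj, Algebra.TensorProduct.one_def]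

theorem exists_biproj_zero (g : QuadAlg F ⊗[k] QuadAlg F') :
    ∃ c : k, biproj F F' 0 0 g = c • 1 := by
  induction g with
  | zero => exact ⟨0, by simp⟩
  | add x y hx hy =>
    obtain ⟨a, ha⟩ := hx
    obtain ⟨b, hb⟩ := hy
    exact ⟨a + b, by rw [map_add, ha, hb, add_smul]⟩
  | tmul x y =>
    obtain ⟨a, ha⟩ := exists_proj_zero x
    obtain ⟨b, hb⟩ := exists_proj_zero y
    exact ⟨a * b, by
      simp [biproj, ha, hb, Algebra.TensorProduct.one_def, smul_tmul', smul_smul, mul_comm]⟩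

theorem exists_biproj_left (g : QuadAlg F ⊗[k] QuadAlg F') :
    ∃ r : Fin n → QuadAlg F ⊗[k] QuadAlg F', ∀ d e,
      biproj F F' (d + 1) e g = ∑ i, (x F i ⊗ₜ 1) * biproj F F' d e (r i) := by
  induction g with
  | zero => exact ⟨0, by simp⟩
  | add x y hx hy =>
    obtain ⟨a, ha⟩ := hx
    obtain ⟨b, hb⟩ := hy
    exact ⟨a + b, fun d e => by simp [ha, hb, mul_add, Finset.sum_add_distrib]⟩
  | tmul x y =>
    obtain ⟨a, ha⟩ := exists_proj_succ x
    exact ⟨fun i => a i ⊗ₜ y, fun d e => by simp [biproj, ha, sum_tmul]⟩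

theorem exists_biproj_right (g : QuadAlg F ⊗[k] QuadAlg F') :
    ∃ r : Fin n → QuadAlg F ⊗[k] QuadAlg F', ∀ d e,
      biproj F F' d (e + 1) g = ∑ i, (1 ⊗ₜ x F' i) * biproj F F' d e (r i) := by
  induction g with
  | zero => exact ⟨0, by simp⟩
  | add x y hx hy =>
    obtain ⟨a, ha⟩ := hx
    obtain ⟨b, hb⟩ := hy
    exact ⟨a + b, fun d e => by simp [ha, hb, mul_add, Finset.sum_add_distrib]⟩
  | tmul x y =>
    obtain ⟨a, ha⟩ := exists_proj_succ y
    exact ⟨fun i => x ⊗ₜ a i, fun d e => by simp [biproj, ha, tmul_sum]⟩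

theorem exists_syz_left {g : Fin n → QuadAlg F ⊗[k] QuadAlg F'}
    (h : ∑ i, (x F i ⊗ₜ 1) * g i = 0) : ∃ r, ∀ i, g i = (form F (F i) ⊗ₜ 1) * r := by
  have hex := Module.Flat.rTensor_exact (QuadAlg F') (exact_syz F)
  obtain ⟨r, hr⟩ := (hex (∑ i, (LinearMap.single k (fun _ => QuadAlg F) i).rTensor _ (g i))).1 (by
    rw [← h, map_sum]
    refine Finset.sum_congr rfl fun i _ => ?_
    rw [← LinearMap.rTensor_comp_apply, ← rTensor_mulLeft]
    congr 2
    refine LinearMap.ext fun p => ?_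
    simp only [LinearMap.comp_apply, gensMap_apply, LinearMap.single_apply,
      LinearMap.mulLeft_apply]
    rw [Finset.sum_eq_single i] <;> simp +contextual)
  refine ⟨r, fun i => ?_⟩
  have h1 := congrArg ((LinearMap.proj (R := k) (φ := fun _ : Fin n => QuadAlg F) i).rTensor _) hr
  rw [← LinearMap.rTensor_comp_apply, map_sum, Finset.sum_eq_single i] at h1
  · rw [← LinearMap.rTensor_comp_apply, LinearMap.proj_comp_single_same, LinearMap.rTensor_id,
      LinearMap.id_apply] at h1
    rw [← h1, ← rTensor_mulLeft]
    rfl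
  · intro j _ hj
    rw [← LinearMap.rTensor_comp_apply, LinearMap.proj_comp_single_ne _ _ _ _ hj.symm,
      LinearMap.rTensor_zero, LinearMap.zero_apply]
  · simp

theorem exists_syz_right {g : Fin n → QuadAlg F ⊗[k] QuadAlg F'}
    (h : ∑ i, (1 ⊗ₜ x F' i) * g i = 0) : ∃ r, ∀ i, g i = (1 ⊗ₜ form F' (F' i)) * r := by
  have hex := Module.Flat.lTensor_exact (QuadAlg F) (exact_syz F')
  obtain ⟨r, hr⟩ := (hex (∑ i, (LinearMap.single k (fun _ => QuadAlg F') i).lTensor _ (g i))).1 (by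
    rw [← h, map_sum]
    refine Finset.sum_congr rfl fun i _ => ?_
    rw [← LinearMap.lTensor_comp_apply, ← lTensor_mulLeft]
    congr 2
    refine LinearMap.ext fun p => ?_
    simp only [LinearMap.comp_apply, gensMap_apply, LinearMap.single_apply,
      LinearMap.mulLeft_apply]
    rw [Finset.sum_eq_single i] <;> simp +contextual)
  refine ⟨r, fun i => ?_⟩
  have h1 := congrArg ((LinearMap.proj (R := k) (φ := fun _ : Fin n => QuadAlg F') i).lTensor _) hr
  rw [← LinearMap.lTensor_comp_apply, map_sum, Finset.sum_eq_single i] at h1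
  · rw [← LinearMap.lTensor_comp_apply, LinearMap.proj_comp_single_same, LinearMap.lTensor_id,
      LinearMap.id_apply] at h1
    rw [← h1, ← lTensor_mulLeft]
    rfl
  · intro j _ hj
    rw [← LinearMap.lTensor_comp_apply, LinearMap.proj_comp_single_ne _ _ _ _ hj.symm,
      LinearMap.lTensor_zero, LinearMap.zero_apply]
  · simp

theorem eq_zero_of_form_left (hn : 2 ≤ n) (hF : IsUnit F) {c : Fin n → k} (hc : c ≠ 0)
    {g : QuadAlg F ⊗[k] QuadAlg F'} (h : (form F c ⊗ₜ 1) * g = 0) : g = 0 := by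
  have hinj := Module.Flat.rTensor_preserves_injective_linearMap (M := QuadAlg F')
    (LinearMap.mulLeft k (form F c)) ((injective_iff_map_eq_zero _).2 fun p hp =>
      eq_zero_of_form_mul hn hF hc hp)
  exact (injective_iff_map_eq_zero _).1 hinj g (by rw [rTensor_mulLeft, h])

theorem eq_zero_of_form_right (hn : 2 ≤ n) (hF' : IsUnit F') {c : Fin n → k} (hc : c ≠ 0)
    {g : QuadAlg F ⊗[k] QuadAlg F'} (h : (1 ⊗ₜ form F' c) * g = 0) : g = 0 := by
  have hinj := Module.Flat.lTensor_preserves_injective_linearMap (M := QuadAlg F)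
    (LinearMap.mulLeft k (form F' c)) ((injective_iff_map_eq_zero _).2 fun p hp =>
      eq_zero_of_form_mul hn hF' hc hp)
  exact (injective_iff_map_eq_zero _).1 hinj g (by rw [lTensor_mulLeft, h])

theorem form_single (i : Fin n) : form F (Pi.single i 1) = x F i := by
  rw [form, Finset.sum_eq_single i] <;> simp +contextual

/-- The syzygies of degree `d` of the generators `x i ⊗ y j` of the Segre product. -/
theorem exists_syz_segre (d : ℕ) {s : Fin n → Fin n → QuadAlg F ⊗[k] QuadAlg F'}
    (hs : ∀ i j, biproj F F' (d + 1) (d + 1) (s i j) = s i j)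
    (h : ∑ i, ∑ j, (x F i ⊗ₜ x F' j) * s i j = 0) :
    ∃ r t : Fin n → Fin n → QuadAlg F ⊗[k] QuadAlg F', ∀ i j,
      s i j = (∑ l, (form F (F i) ⊗ₜ x F' l) * biproj F F' d d (r j l)) +
        ∑ l, (x F l ⊗ₜ form F' (F' j)) * biproj F F' d d (t i l) := by
  have hform : ∀ (c : Fin n → k) (d e : ℕ) (g : QuadAlg F ⊗[k] QuadAlg F'),
      biproj F F' (d + 1) e ((form F c ⊗ₜ 1) * g) = (form F c ⊗ₜ 1) * biproj F F' d e g := by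
    intro c d e g
    simp only [form, sum_tmul, Finset.sum_mul, map_sum, ← smul_tmul', smul_mul_assoc, map_smul,
      biproj_succ_left]
  have hform' : ∀ (c : Fin n → k) (d e : ℕ) (g : QuadAlg F ⊗[k] QuadAlg F'),
      biproj F F' d (e + 1) ((1 ⊗ₜ form F' c) * g) = (1 ⊗ₜ form F' c) * biproj F F' d e g := by
    intro c d e g
    simp only [form, tmul_sum, Finset.sum_mul, map_sum, tmul_smul, smul_mul_assoc, map_smul,
      biproj_succ_right]
  obtain ⟨r, hr⟩ := exists_syz_left (g := fun i => ∑ j, (1 ⊗ₜ x F' j) * s i j) (by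
    rw [← h]
    simp only [Finset.mul_sum, ← mul_assoc, Algebra.TensorProduct.tmul_mul_tmul, mul_one, one_mul])
  obtain ⟨r₁, hr₁⟩ := exists_biproj_right r
  have hr₂ : ∀ i, ∑ j, (1 ⊗ₜ x F' j) * (s i j - (form F (F i) ⊗ₜ 1) *
      biproj F F' d (d + 1) (r₁ j)) = 0 := by
    intro i
    have h1 := congrArg (biproj F F' (d + 1) (d + 2)) (hr i)
    rw [hform, hr₁, map_sum] at h1
    simp only [biproj_succ_right, hs] at h1
    simp only [mul_sub, Finset.sum_sub_distrib]
    rw [h1, Finset.mul_sum, sub_eq_zero]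
    simp only [← mul_assoc, Algebra.TensorProduct.tmul_mul_tmul, mul_one, one_mul]
  choose t ht using fun i => exists_syz_right (hr₂ i)
  choose r₂ hr₂' using fun j => exists_biproj_right (r₁ j)
  choose t₂ ht₂ using fun j => exists_biproj_left (t j)
  refine ⟨r₂, t₂, fun i j => ?_⟩
  have h1 := congrArg (biproj F F' (d + 1) (d + 1)) (ht i j)
  rw [map_sub, hs, hform, biproj_biproj, hform', ht₂, hr₂', sub_eq_iff_eq_add'] at h1
  rw [h1]
  simp only [Finset.mul_sum, ← mul_assoc, Algebra.TensorProduct.tmul_mul_tmul, mul_one, one_mul]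

theorem eq_zero_of_segre {s : Fin n → Fin n → QuadAlg F ⊗[k] QuadAlg F'}
    (hs : ∀ i j, biproj F F' 0 0 (s i j) = s i j)
    (h : ∑ i, ∑ j, (x F i ⊗ₜ x F' j) * s i j = 0) (i j : Fin n) : s i j = 0 := by
  obtain ⟨r, hr⟩ := exists_syz_left (g := fun i => ∑ j, (1 ⊗ₜ x F' j) * s i j) (by
    rw [← h]
    simp only [Finset.mul_sum, ← mul_assoc, Algebra.TensorProduct.tmul_mul_tmul, mul_one, one_mul])
  have h1 : ∑ j, (1 ⊗ₜ x F' j) * s i j = 0 := by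
    have := congrArg (biproj F F' 0 1) (hr i)
    simp only [map_sum, biproj_succ_right, hs, form, sum_tmul, Finset.sum_mul, ← smul_tmul',
      smul_mul_assoc, map_smul, biproj_zero_left, smul_zero, Finset.sum_const_zero] at this
    exact this
  obtain ⟨t, ht⟩ := exists_syz_right h1
  have := congrArg (biproj F F' 0 0) (ht j)
  simpa only [hs, form, tmul_sum, Finset.sum_mul, tmul_smul, map_sum, map_smul,
      smul_mul_assoc, biproj_zero_right, smul_zero, Finset.sum_const_zero] using this

end QuadAlg
end Segre

section Symbols
universe u
variable {k : Type u} [Field k] {n : ℕ}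

theorem scalarMat_apply {A : Type u} [Ring A] [Algebra k A] (M : Matrix (Fin n) (Fin n) k)
    (i j : Fin n) : scalarMat A M i j = algebraMap k A (M i j) := rfl

theorem transpose_mul_scalarMat_mul_apply {A : Type u} [Ring A] [Algebra k A]
    (M : Matrix (Fin n) (Fin n) k) (w : Matrix (Fin n) (Fin n) A) (i j : Fin n) :
    (wᵀ * scalarMat A M * w) i j = ∑ a, ∑ b, M a b • (w a i * w b j) := by
  simp only [Matrix.mul_apply, Finset.sum_mul, Matrix.transpose_apply, scalarMat_apply]
  rw [Finset.sum_comm]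
  refine Finset.sum_congr rfl fun a _ => Finset.sum_congr rfl fun b _ => ?_
  rw [← Algebra.commutes, mul_assoc, Algebra.smul_def]

theorem mul_scalarMat_mul_transpose_apply {A : Type u} [Ring A] [Algebra k A]
    (M : Matrix (Fin n) (Fin n) k) (w : Matrix (Fin n) (Fin n) A) (i j : Fin n) :
    (w * scalarMat A M * wᵀ) i j = ∑ a, ∑ b, M a b • (w i a * w j b) := by
  have := transpose_mul_scalarMat_mul_apply M wᵀ i j
  rwa [Matrix.transpose_transpose] at this

namespace B

theorem transpose_gen_mul_gen (E : GeneralLinearGroup (Fin n) k) :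
    (gen E)ᵀ * scalarMat (B E) (E : Matrix (Fin n) (Fin n) k) * gen E =
      scalarMat (B E) (E : Matrix (Fin n) (Fin n) k) := by
  have h := congrArg (scalarMat (B E) (E : Matrix (Fin n) (Fin n) k) * ·) (rel_left E)
  simp only [← mul_assoc, scalarMat_mul_inv, one_mul, mul_one] at h
  exact h

theorem gen_mul_transpose_gen (E : GeneralLinearGroup (Fin n) k) :
    gen E * scalarMat (B E) (E : Matrix (Fin n) (Fin n) k)⁻¹ * (gen E)ᵀ =
      scalarMat (B E) (E : Matrix (Fin n) (Fin n) k)⁻¹ := by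
  have h := congrArg (· * scalarMat (B E) (E : Matrix (Fin n) (Fin n) k)⁻¹) (rel_right E)
  simp only [mul_assoc, scalarMat_mul_inv, one_mul, mul_one] at h
  simpa only [mul_assoc] using h

theorem sum_gen_mul_gen (E : GeneralLinearGroup (Fin n) k) (i j : Fin n) :
    ∑ a, ∑ b, (E : Matrix (Fin n) (Fin n) k) a b • (gen E a i * gen E b j) =
      (E : Matrix (Fin n) (Fin n) k) i j • (1 : B E) := by
  rw [← transpose_mul_scalarMat_mul_apply, transpose_gen_mul_gen, scalarMat_apply,
    Algebra.algebraMap_eq_smul_one]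

theorem sum_inv_gen_mul_gen (E : GeneralLinearGroup (Fin n) k) (i j : Fin n) :
    ∑ a, ∑ b, (E : Matrix (Fin n) (Fin n) k)⁻¹ a b • (gen E i a * gen E j b) =
      (E : Matrix (Fin n) (Fin n) k)⁻¹ i j • (1 : B E) := by
  rw [← mul_scalarMat_mul_transpose_apply, gen_mul_transpose_gen, scalarMat_apply,
    Algebra.algebraMap_eq_smul_one]

variable {A : Type u} [Ring A] [Algebra k A]

/-- The universal property of `B(E)`, in terms of the relations between the entries. -/
theorem exists_lift (E : GeneralLinearGroup (Fin n) k) (w : Matrix (Fin n) (Fin n) A)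
    (h₁ : ∀ i j, ∑ a, ∑ b, (E : Matrix (Fin n) (Fin n) k) a b • (w a i * w b j) =
      (E : Matrix (Fin n) (Fin n) k) i j • 1)
    (h₂ : ∀ i j, ∑ a, ∑ b, (E : Matrix (Fin n) (Fin n) k)⁻¹ a b • (w i a * w j b) =
      (E : Matrix (Fin n) (Fin n) k)⁻¹ i j • 1) :
    ∃ f : B E →ₐ[k] A, ∀ i j, f (gen E i j) = w i j := by
  have e₁ : wᵀ * scalarMat A (E : Matrix (Fin n) (Fin n) k) * w =
      scalarMat A (E : Matrix (Fin n) (Fin n) k) := by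
    ext i j
    rw [transpose_mul_scalarMat_mul_apply, h₁, scalarMat_apply, Algebra.algebraMap_eq_smul_one]
  have e₂ : w * scalarMat A (E : Matrix (Fin n) (Fin n) k)⁻¹ * wᵀ =
      scalarMat A (E : Matrix (Fin n) (Fin n) k)⁻¹ := by
    ext i j
    rw [mul_scalarMat_mul_transpose_apply, h₂, scalarMat_apply, Algebra.algebraMap_eq_smul_one]
  refine ⟨lift E w ?_ ?_, fun i j => lift_gen E w _ _ i j⟩
  · rw [mul_assoc, mul_assoc, ← mul_assoc wᵀ, e₁, scalarMat_inv_mul]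
  · rw [e₂, scalarMat_inv_mul]

/-- Induction by multiplying with generators from the left. -/
theorem induction_left {E : GeneralLinearGroup (Fin n) k} {P : B E → Prop}
    (one : P 1) (mul : ∀ i j p, P p → P (gen E i j * p))
    (add : ∀ p q, P p → P q → P (p + q)) (smul : ∀ (c : k) p, P p → P (c • p))
    (p : B E) : P p := by
  have : ∀ q, P q → P (p * q) := by
    induction p using B.induction with
    | hc c =>
      intro q hq
      rw [← Algebra.smul_def]
      exact smul c q hq
    | hg i j => exact fun q hq => mul i j q hq
    | hm a b h₁ h₂ =>
      intro q hq
      rw [mul_assoc]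
      exact h₁ _ (h₂ q hq)
    | ha a b h₁ h₂ =>
      intro q hq
      rw [add_mul]
      exact add _ _ (h₁ q hq) (h₂ q hq)
  have h := this 1 one
  rwa [mul_one] at h

end B

section Rep
variable {R : Type u} [Ring R] [Algebra k R]

variable (k R) in
/-- The operator `v ↦ (m ↦ α v (m - 2) + β v m + γ v (m + 2))`. -/
noncomputable def shiftTwo : (R × R × R) →ₗ[k] Module.End k (ℤ → R) where
  toFun c :=
    { toFun := fun v m => c.1 * v (m - 2) + c.2.1 * v m + c.2.2 * v (m + 2)
      map_add' := fun v w => by ext m; simp [mul_add]; abel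
      map_smul' := fun a v => by ext m; simp }
  map_add' c d := by ext v m; simp [add_mul]; abel
  map_smul' a c := by ext v m; simp

theorem shiftTwo_apply (c : R × R × R) (v : ℤ → R) (m : ℤ) :
    shiftTwo k R c v m = c.1 * v (m - 2) + c.2.1 * v m + c.2.2 * v (m + 2) := rfl

variable (k) in
/-- The operator `v ↦ (m ↦ α v (m - 1) + β v (m + 1))`. -/
noncomputable def shiftOne (α β : R) : Module.End k (ℤ → R) where
  toFun v m := α * v (m - 1) + β * v (m + 1)
  map_add' v w := by ext m; simp [mul_add]; abel
  map_smul' a v := by ext m; simp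

theorem shiftOne_apply (α β : R) (v : ℤ → R) (m : ℤ) :
    shiftOne k α β v m = α * v (m - 1) + β * v (m + 1) := rfl

theorem shiftOne_mul (α β α' β' : R) : shiftOne k α β * shiftOne k α' β' =
    shiftTwo k R (α * α', α * β' + β * α', β * β') := by
  ext v m
  simp only [Module.End.mul_apply, shiftOne_apply, shiftTwo_apply, mul_add, add_mul, ← mul_assoc]
  rw [show m - 1 - 1 = m - 2 by ring, show m - 1 + 1 = m by ring, show m + 1 - 1 = m by ring,
    show m + 1 + 1 = m + 2 by ring]
  abel

theorem shiftTwo_one (c : k) : shiftTwo k R (0, c • 1, 0) = c • 1 := by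
  ext v m
  simp [shiftTwo_apply]

end Rep

/-- The Segre product whose bigraded components are the symbols of elements of `B(E)`. -/
abbrev Segre (E : GeneralLinearGroup (Fin n) k) : Type u :=
  QuadAlg (E : Matrix (Fin n) (Fin n) k) ⊗[k] QuadAlg (E : Matrix (Fin n) (Fin n) k)⁻¹

open QuadAlg in
/-- A representation of `B(E)` that detects symbols. -/
theorem exists_symbolRep (hn : 2 ≤ n) (E : GeneralLinearGroup (Fin n) k) (q : k)
    (hq : q * q + q * (∑ a, ∑ b, (E : Matrix (Fin n) (Fin n) k) a b *
      (E : Matrix (Fin n) (Fin n) k)⁻¹ a b) + 1 = 0)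
    (c : Fin n → k) (hc : c ≠ 0) (hc' : c ⬝ᵥ ((E : Matrix (Fin n) (Fin n) k) *ᵥ c) = 0) :
    ∃ (R : Type u) (_ : Ring R) (_ : Algebra k R) (f : Segre E →ₐ[k] R)
      (z : Fin n → Fin n → R) (Φ : B E →ₐ[k] Module.End k (ℤ → R)),
      Function.Injective f ∧ ∀ i j, Φ (B.gen E i j) = shiftOne k (f (x _ i ⊗ₜ x _ j)) (z i j) := by
  have hE : IsUnit (E : Matrix (Fin n) (Fin n) k) := E.isUnit
  have hE' : IsUnit (E : Matrix (Fin n) (Fin n) k)⁻¹ := by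
    rw [Matrix.isUnit_nonsing_inv_iff]; exact hE
  have hinv : ((E : Matrix (Fin n) (Fin n) k)⁻¹)⁻¹ = E :=
    Matrix.nonsing_inv_nonsing_inv _ ((Matrix.isUnit_iff_isUnit_det _).1 hE)
  have hEc : (E : Matrix (Fin n) (Fin n) k) *ᵥ c ≠ 0 := by
    intro h
    apply hc
    have := congrArg ((E : Matrix (Fin n) (Fin n) k)⁻¹ *ᵥ ·) h
    simpa [Matrix.mulVec_mulVec] using this
  obtain ⟨L, _, _, f, z, hf, h1, h2, h3⟩ := exists_oscillator hn hE q hq c hc hc'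
  obtain ⟨L', _, _, f', z', hf', h1', h2', h3'⟩ := exists_oscillator hn hE' q
    (by rw [hinv]; simpa only [mul_comm (((E : Matrix (Fin n) (Fin n) k)⁻¹ : Matrix _ _ k) _ _)] using hq)
    ((E : Matrix (Fin n) (Fin n) k) *ᵥ c) hEc
    (by
      rw [Matrix.mulVec_mulVec, Matrix.nonsing_inv_mul _ ((Matrix.isUnit_iff_isUnit_det _).1 hE),
        Matrix.one_mulVec, dotProduct_comm, hc'])
  rw [hinv] at h3'
  set τ := ∑ a, ∑ b, (E : Matrix (Fin n) (Fin n) k) a b * (E : Matrix (Fin n) (Fin n) k)⁻¹ a b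
    with hτ
  have h4 : ∑ a, ∑ b, (E : Matrix (Fin n) (Fin n) k) a b • (z a * f (x _ b)) =
      (q + τ) • (1 : L) := by
    simp only [h3, smul_add, Finset.sum_add_distrib, smul_comm _ q, ← Finset.smul_sum, h1]
    simp only [Algebra.algebraMap_eq_smul_one, smul_smul, ← Finset.sum_smul]
    rw [add_smul, hτ]
  have h4' : ∑ a, ∑ b, (E : Matrix (Fin n) (Fin n) k)⁻¹ a b • (z' a * f' (x _ b)) =
      (q + τ) • (1 : L') := by
    simp only [h3', smul_add, Finset.sum_add_distrib, smul_comm _ q, ← Finset.smul_sum, h1']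
    simp only [Algebra.algebraMap_eq_smul_one, smul_smul, ← Finset.sum_smul]
    rw [add_smul, hτ]
    simp only [mul_comm]
  have hqτ : q * (q + τ) = -1 := by linear_combination hq
  have h0 := congrArg f (rel (E : Matrix (Fin n) (Fin n) k))
  have h0' := congrArg f' (rel (E : Matrix (Fin n) (Fin n) k)⁻¹)
  simp only [map_sum, map_smul, map_mul, map_zero] at h0 h0'
  set w : Matrix (Fin n) (Fin n) (Module.End k (ℤ → L ⊗[k] L')) := Matrix.of fun i j =>
    shiftOne k (f (x _ i) ⊗ₜ f' (x _ j)) ((-q) • (z i ⊗ₜ z' j)) with hw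
  obtain ⟨Φ, hΦ⟩ := B.exists_lift E w (by
    intro i j
    simp only [hw, Matrix.of_apply, shiftOne_mul, ← map_smul, ← map_sum]
    rw [← shiftTwo_one]
    congr 1
    simp only [Prod.smul_mk, Algebra.TensorProduct.tmul_mul_tmul, smul_mul_assoc, mul_smul_comm,
      smul_add]
    refine Prod.ext ?_ (Prod.ext ?_ ?_)
    · simp only [Prod.fst_sum, smul_tmul', ← sum_tmul, h0, zero_tmul]
    · simp only [Prod.fst_sum, Prod.snd_sum, Finset.sum_add_distrib, smul_comm _ (-q),
        ← Finset.smul_sum]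
      simp only [smul_tmul', ← sum_tmul, h1, h4]
      rw [smul_tmul, ← smul_tmul', ← tmul_smul, ← smul_tmul', ← tmul_smul, ← tmul_add, smul_smul,
        mul_neg, mul_comm (q + τ) q, hqτ, neg_neg, one_smul, h3', neg_smul, neg_add_cancel_left,
        Algebra.algebraMap_eq_smul_one, tmul_smul, Algebra.TensorProduct.one_def]
    · simp only [Prod.snd_sum, smul_comm _ (-q), ← Finset.smul_sum]
      simp only [smul_tmul', ← sum_tmul, h2, zero_tmul, smul_zero]) (by
    intro i j
    simp only [hw, Matrix.of_apply, shiftOne_mul, ← map_smul, ← map_sum]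
    rw [← shiftTwo_one]
    congr 1
    simp only [Prod.smul_mk, Algebra.TensorProduct.tmul_mul_tmul, smul_mul_assoc, mul_smul_comm,
      smul_add]
    refine Prod.ext ?_ (Prod.ext ?_ ?_)
    · simp only [Prod.fst_sum, ← tmul_smul, ← tmul_sum, h0', tmul_zero]
    · simp only [Prod.fst_sum, Prod.snd_sum, Finset.sum_add_distrib, smul_comm _ (-q),
        ← Finset.smul_sum]
      simp only [← tmul_smul, ← tmul_sum, h1', h4']
      simp only [tmul_smul, smul_tmul', ← add_tmul, smul_smul]
      rw [neg_mul, hqτ, neg_neg, one_smul, h3, neg_smul, neg_add_cancel_left,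
        Algebra.algebraMap_eq_smul_one, Algebra.TensorProduct.one_def, smul_tmul']
    · simp only [Prod.snd_sum, smul_comm _ (-q), ← Finset.smul_sum]
      simp only [← tmul_smul, ← tmul_sum, h2', tmul_zero, smul_zero])
  refine ⟨L ⊗[k] L', inferInstance, inferInstance, Algebra.TensorProduct.map f f',
    fun i j => (-q) • (z i ⊗ₜ z' j), Φ, ?_, ?_⟩
  · exact TensorProduct.map_injective_of_flat_flat f.toLinearMap f'.toLinearMap hf hf'
  · intro i j
    rw [hΦ]
    simp [hw]

end Symbols

section HasSymbol
universe u
variable {k : Type u} [Field k] {n : ℕ}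
open QuadAlg

/-- `HasSymbol E d a s` means that `a` has degree at most `d` in the generators and that `s` is its
homogeneous component of degree `d`. -/
def HasSymbol (E : GeneralLinearGroup (Fin n) k) : ℕ → B E → Segre E → Prop
  | 0, a, s => ∃ c : k, a = c • 1 ∧ s = c • 1
  | d + 1, a, s => ∃ (a' : Fin n → Fin n → B E) (s' : Fin n → Fin n → Segre E) (b : B E),
      (∀ i j, HasSymbol E d (a' i j) (s' i j)) ∧ (∃ t, HasSymbol E d b t) ∧
      a = ∑ i, ∑ j, B.gen E i j * a' i j + b ∧ s = ∑ i, ∑ j, (x _ i ⊗ₜ x _ j) * s' i j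

namespace HasSymbol

variable {E : GeneralLinearGroup (Fin n) k}

theorem add {d : ℕ} {a b : B E} {s t : Segre E} (h₁ : HasSymbol E d a s)
    (h₂ : HasSymbol E d b t) : HasSymbol E d (a + b) (s + t) := by
  induction d generalizing a b s t with
  | zero =>
    obtain ⟨c, rfl, rfl⟩ := h₁
    obtain ⟨c', rfl, rfl⟩ := h₂
    exact ⟨c + c', (add_smul _ _ _).symm, (add_smul _ _ _).symm⟩
  | succ d ih =>
    obtain ⟨a', s', a₀, ha, ⟨s₀, h₀⟩, rfl, rfl⟩ := h₁
    obtain ⟨b', t', b₀, hb, ⟨t₀, h₀'⟩, rfl, rfl⟩ := h₂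
    refine ⟨a' + b', s' + t', a₀ + b₀, fun i j => ih (ha i j) (hb i j), ⟨_, ih h₀ h₀'⟩, ?_, ?_⟩
    · simp only [Pi.add_apply, mul_add, Finset.sum_add_distrib]
      abel
    · simp only [Pi.add_apply, mul_add, Finset.sum_add_distrib]

theorem smul (c : k) {d : ℕ} {a : B E} {s : Segre E} (h : HasSymbol E d a s) :
    HasSymbol E d (c • a) (c • s) := by
  induction d generalizing a s with
  | zero =>
    obtain ⟨e, rfl, rfl⟩ := h
    exact ⟨c * e, smul_smul _ _ _, smul_smul _ _ _⟩
  | succ d ih =>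
    obtain ⟨a', s', a₀, ha, ⟨s₀, h₀⟩, rfl, rfl⟩ := h
    refine ⟨c • a', c • s', c • a₀, fun i j => ih (ha i j), ⟨_, ih h₀⟩, ?_, ?_⟩
    · simp only [Pi.smul_apply, mul_smul_comm, Finset.smul_sum, smul_add]
    · simp only [Pi.smul_apply, mul_smul_comm, Finset.smul_sum]

theorem zero (d : ℕ) : HasSymbol E d 0 0 := by
  induction d with
  | zero => exact ⟨0, by simp, by simp⟩
  | succ d ih => exact ⟨0, 0, 0, fun _ _ => ih, ⟨_, ih⟩, by simp, by simp⟩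

theorem neg {d : ℕ} {a : B E} {s : Segre E} (h : HasSymbol E d a s) :
    HasSymbol E d (-a) (-s) := by
  simpa using h.smul (-1)

theorem sub {d : ℕ} {a b : B E} {s t : Segre E} (h₁ : HasSymbol E d a s)
    (h₂ : HasSymbol E d b t) : HasSymbol E d (a - b) (s - t) := by
  simpa only [sub_eq_add_neg] using h₁.add h₂.neg

theorem sum {ι : Type*} (S : Finset ι) {d : ℕ} {a : ι → B E} {s : ι → Segre E}
    (h : ∀ i ∈ S, HasSymbol E d (a i) (s i)) : HasSymbol E d (∑ i ∈ S, a i) (∑ i ∈ S, s i) := by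
  classical
  induction S using Finset.induction_on with
  | empty => simpa using zero d
  | insert i S hi ih =>
    rw [Finset.sum_insert hi, Finset.sum_insert hi]
    exact (h i (Finset.mem_insert_self _ _)).add
      (ih fun j hj => h j (Finset.mem_insert_of_mem hj))

theorem lower {d : ℕ} {a : B E} {s : Segre E} (h : HasSymbol E d a s) :
    HasSymbol E (d + 1) a 0 :=
  ⟨0, 0, a, fun _ _ => zero d, ⟨_, h⟩, by simp, by simp⟩

theorem gen_mul (i j : Fin n) {d : ℕ} {a : B E} {s : Segre E} (h : HasSymbol E d a s) :
    HasSymbol E (d + 1) (B.gen E i j * a) ((x _ i ⊗ₜ x _ j) * s) := by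
  refine ⟨Pi.single i (Pi.single j a), Pi.single i (Pi.single j s), 0, fun i' j' => ?_,
    ⟨_, zero d⟩, ?_, ?_⟩
  · by_cases hi : i' = i
    · subst hi
      by_cases hj : j' = j
      · subst hj; simpa using h
      · simpa [hj] using zero d
    · simpa [hi] using zero d
  · rw [Finset.sum_eq_single i, Finset.sum_eq_single j] <;> simp +contextual
  · rw [Finset.sum_eq_single i, Finset.sum_eq_single j] <;> simp +contextual

theorem exists_symbol (a : B E) : ∃ d s, HasSymbol E d a s := by
  have hle : ∀ {d e : ℕ} {a : B E} {s : Segre E}, d ≤ e → HasSymbol E d a s →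
      ∃ t, HasSymbol E e a t := by
    intro d e a s hde h
    induction e, hde using Nat.le_induction with
    | base => exact ⟨s, h⟩
    | succ e _ ih =>
      obtain ⟨t, ht⟩ := ih
      exact ⟨_, ht.lower⟩
  induction a using B.induction_left with
  | one => exact ⟨0, 1, 1, by simp, by simp⟩
  | mul i j p h =>
    obtain ⟨d, s, h⟩ := h
    exact ⟨_, _, h.gen_mul i j⟩
  | add p q h₁ h₂ =>
    obtain ⟨d, s, h₁⟩ := h₁
    obtain ⟨e, t, h₂⟩ := h₂
    obtain ⟨s', h₁⟩ := hle (le_max_left d e) h₁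
    obtain ⟨t', h₂⟩ := hle (le_max_right d e) h₂
    exact ⟨_, _, h₁.add h₂⟩
  | smul c p h =>
    obtain ⟨d, s, h⟩ := h
    exact ⟨_, _, h.smul c⟩

/-- A common bound for the degrees of finitely many elements. -/
theorem exists_symbol_family {ι : Type*} [Fintype ι] (a : ι → B E) :
    ∃ d, ∀ i, ∃ s, HasSymbol E d (a i) s := by
  have hle : ∀ {d e : ℕ} {a : B E} {s : Segre E}, d ≤ e → HasSymbol E d a s →
      ∃ t, HasSymbol E e a t := by
    intro d e a s hde h
    induction e, hde using Nat.le_induction with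
    | base => exact ⟨s, h⟩
    | succ e _ ih =>
      obtain ⟨t, ht⟩ := ih
      exact ⟨_, ht.lower⟩
  choose d s h using fun i => exists_symbol (a i)
  exact ⟨Finset.univ.sup d, fun i => hle (Finset.le_sup (Finset.mem_univ i)) (h i)⟩

theorem biproj_eq {d : ℕ} {a : B E} {s : Segre E} (h : HasSymbol E d a s) :
    biproj _ _ d d s = s := by
  have hxy : ∀ d i j (g : Segre E), biproj (E : Matrix (Fin n) (Fin n) k)
      (E : Matrix (Fin n) (Fin n) k)⁻¹ (d + 1) (d + 1) ((x _ i ⊗ₜ x _ j) * g) =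
      (x _ i ⊗ₜ x _ j) * biproj _ _ d d g := by
    intro d i j g
    have : ∀ g : Segre E, (x (E : Matrix (Fin n) (Fin n) k) i ⊗ₜ[k] x (E : Matrix (Fin n) (Fin n) k)⁻¹ j) * g =
        (x _ i ⊗ₜ 1) * ((1 ⊗ₜ x _ j) * g) := by
      intro g
      rw [← mul_assoc, Algebra.TensorProduct.tmul_mul_tmul, mul_one, one_mul]
    rw [this, biproj_succ_left, biproj_succ_right, ← this]
  induction d generalizing a s with
  | zero =>
    obtain ⟨e, rfl, rfl⟩ := h
    rw [map_smul, biproj_zero_one]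
  | succ d ih =>
    obtain ⟨a', s', a₀, ha, ⟨s₀, h₀⟩, rfl, rfl⟩ := h
    simp only [map_sum, hxy, ih (ha _ _)]

theorem exists_of_biproj (d : ℕ) (g : Segre E) : ∃ a, HasSymbol E d a (biproj _ _ d d g) := by
  induction d generalizing g with
  | zero =>
    obtain ⟨c, hc⟩ := exists_biproj_zero g
    exact ⟨c • 1, c, rfl, hc⟩
  | succ d ih =>
    obtain ⟨r, hr⟩ := exists_biproj_left g
    choose t ht using fun i => exists_biproj_right (r i)
    choose a ha using fun i j => ih (t i j)
    refine ⟨∑ i, ∑ j, B.gen E i j * a i j, ?_⟩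
    rw [hr]
    simp only [ht, Finset.mul_sum, ← mul_assoc, Algebra.TensorProduct.tmul_mul_tmul, mul_one,
      one_mul]
    exact sum _ fun i _ => sum _ fun j _ => (ha i j).gen_mul i j

/-- The symbol of the zero element is zero. -/
theorem eq_zero [IsAlgClosed k] [NeZero (2 : k)] (hn : 2 ≤ n) {d : ℕ} {s : Segre E}
    (h : HasSymbol E d 0 s) : s = 0 := by
  obtain ⟨q, hq⟩ : ∃ q : k, q * q + q * (∑ a, ∑ b, (E : Matrix (Fin n) (Fin n) k) a b *
      (E : Matrix (Fin n) (Fin n) k)⁻¹ a b) + 1 = 0 := by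
    obtain ⟨r, hr⟩ := IsAlgClosed.exists_eq_mul_self (discrim (1 : k)
      (∑ a, ∑ b, (E : Matrix (Fin n) (Fin n) k) a b * (E : Matrix (Fin n) (Fin n) k)⁻¹ a b) 1)
    obtain ⟨q, hq⟩ := exists_quadratic_eq_zero one_ne_zero ⟨r, hr⟩
    exact ⟨q, by linear_combination hq⟩
  obtain ⟨c, hc, hc'⟩ : ∃ c : Fin n → k, c ≠ 0 ∧
      c ⬝ᵥ ((E : Matrix (Fin n) (Fin n) k) *ᵥ c) = 0 := by
    set M := (E : Matrix (Fin n) (Fin n) k)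
    let i₀ : Fin n := ⟨0, by omega⟩
    let i₁ : Fin n := ⟨1, by omega⟩
    have hi : i₀ ≠ i₁ := by simp [i₀, i₁]
    have hval : ∀ s t : k, (Pi.single i₀ s + Pi.single i₁ t : Fin n → k) ⬝ᵥ
        (M *ᵥ (Pi.single i₀ s + Pi.single i₁ t)) =
        s * s * M i₀ i₀ + s * t * (M i₀ i₁ + M i₁ i₀) + t * t * M i₁ i₁ := by
      intro s t
      simp [Matrix.mulVec_add, add_dotProduct, dotProduct_add]
      ring
    by_cases h1 : M i₁ i₁ = 0
    · refine ⟨Pi.single i₀ 0 + Pi.single i₁ 1, fun h => ?_, by rw [hval, h1]; ring⟩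
      have := congrFun h i₁
      simp at this
    · obtain ⟨r, hr⟩ := IsAlgClosed.exists_eq_mul_self (discrim (M i₁ i₁) (M i₀ i₁ + M i₁ i₀)
        (M i₀ i₀))
      obtain ⟨t, ht⟩ := exists_quadratic_eq_zero h1 ⟨r, hr⟩
      refine ⟨Pi.single i₀ 1 + Pi.single i₁ t, fun h => ?_, by
        rw [hval]; linear_combination ht⟩
      have := congrFun h i₀
      simp [hi] at this
  obtain ⟨R, _, _, f, z, Φ, hf, hΦ⟩ := exists_symbolRep hn E q hq c hc hc'
  have key : ∀ (d : ℕ) (a : B E) (s : Segre E), HasSymbol E d a s →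
      Φ a (Pi.single 0 1) d = f s ∧ ∀ m : ℤ, d < m → Φ a (Pi.single 0 1) m = 0 := by
    intro d
    induction d with
    | zero =>
      rintro a s ⟨e, rfl, rfl⟩
      refine ⟨by simp, fun m hm => ?_⟩
      have hm : m ≠ 0 := by rintro rfl; simp at hm
      simp [hm]
    | succ d ih =>
      rintro a s ⟨a', s', b, ha, ⟨t, hb⟩, rfl, rfl⟩
      have hg : ∀ i j (m : ℤ), Φ (B.gen E i j * a' i j) (Pi.single 0 1) m =
          f (x _ i ⊗ₜ x _ j) * Φ (a' i j) (Pi.single 0 1) (m - 1) +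
            z i j * Φ (a' i j) (Pi.single 0 1) (m + 1) := by
        intro i j m
        rw [map_mul, hΦ]
        rfl
      have hs : ∀ m : ℤ, Φ (∑ i, ∑ j, B.gen E i j * a' i j + b) (Pi.single 0 1) m =
          ∑ i, ∑ j, (f (x _ i ⊗ₜ x _ j) * Φ (a' i j) (Pi.single 0 1) (m - 1) +
            z i j * Φ (a' i j) (Pi.single 0 1) (m + 1)) + Φ b (Pi.single 0 1) m := by
        intro m
        simp only [map_add, map_sum, LinearMap.add_apply, LinearMap.sum_apply, Pi.add_apply,
          Finset.sum_apply, hg]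
      constructor
      · rw [hs, (ih b t hb).2 _ (by push_cast; omega), add_zero, map_sum]
        refine Finset.sum_congr rfl fun i _ => ?_
        rw [map_sum]
        refine Finset.sum_congr rfl fun j _ => ?_
        rw [(ih _ _ (ha i j)).2 (↑(d + 1) + 1) (by push_cast; omega), mul_zero, add_zero, map_mul,
          ← (ih _ _ (ha i j)).1]
        push_cast
        rw [add_sub_cancel_right]
      · intro m hm
        push_cast at hm
        rw [hs, (ih b t hb).2 _ (by omega), add_zero]
        refine Finset.sum_eq_zero fun i _ => Finset.sum_eq_zero fun j _ => ?_
        rw [(ih _ _ (ha i j)).2 (m - 1) (by omega), (ih _ _ (ha i j)).2 (m + 1) (by omega), mul_zero, mul_zero,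
          add_zero]
  have := (key d 0 s h).1
  rw [map_zero, LinearMap.zero_apply, Pi.zero_apply] at this
  exact (injective_iff_map_eq_zero f).1 hf s this.symm

theorem smul_one_injective {c : k} (h : (0 : Segre E) = c • 1) : c = 0 := by
  let ε : ∀ F : Matrix (Fin n) (Fin n) k, QuadAlg F →ₐ[k] k := fun F =>
    QuadAlg.lift F (fun _ => 0) (by simp)
  have := congrArg (Algebra.TensorProduct.lift (ε (E : Matrix (Fin n) (Fin n) k))
    (ε (E : Matrix (Fin n) (Fin n) k)⁻¹) fun _ _ => Commute.all _ _) h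
  simpa using this.symm

theorem eq_zero_of_degree_zero {a : B E} (h : HasSymbol E 0 a 0) : a = 0 := by
  obtain ⟨c, rfl, hc⟩ := h
  rw [smul_one_injective hc, zero_smul]

/-- An element with vanishing symbol has smaller degree. -/
theorem exists_lower {d : ℕ} {a : B E} (h : HasSymbol E (d + 1) a 0) :
    ∃ t, HasSymbol E d a t := by
  induction d generalizing a with
  | zero =>
    obtain ⟨a', s', b, ha, hb, rfl, hs⟩ := h
    have h0 := eq_zero_of_segre (fun i j => (ha i j).biproj_eq) hs.symm
    have ha' : ∀ i j, a' i j = 0 := by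
      intro i j
      have := ha i j
      rw [h0] at this
      exact this.eq_zero_of_degree_zero
    simpa [ha'] using hb
  | succ d ih =>
    obtain ⟨a', s', b, ha, ⟨t₀, hb⟩, rfl, hs⟩ := h
    obtain ⟨r, t, hrt⟩ := exists_syz_segre d (fun i j => (ha i j).biproj_eq) hs.symm
    choose p hp using fun i j => exists_of_biproj d (r i j)
    choose p' hp' using fun i j => exists_of_biproj d (t i j)
    set M := (E : Matrix (Fin n) (Fin n) k) with hM
    have hc : ∀ i j, HasSymbol E (d + 1)
        ((∑ l, ∑ a, M i a • (B.gen E a l * p j l)) + ∑ l, ∑ b, M⁻¹ j b • (B.gen E l b * p' i l))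
        (s' i j) := by
      intro i j
      rw [hrt]
      simp only [form, sum_tmul, tmul_sum, Finset.sum_mul, ← smul_tmul', tmul_smul, smul_mul_assoc]
      exact (sum _ fun l _ => sum _ fun a _ => ((hp j l).gen_mul a l).smul _).add
        (sum _ fun l _ => sum _ fun b _ => ((hp' i l).gen_mul l b).smul _)
    have hd : ∀ i j, ∃ t, HasSymbol E d (a' i j - ((∑ l, ∑ a, M i a • (B.gen E a l * p j l)) +
        ∑ l, ∑ b, M⁻¹ j b • (B.gen E l b * p' i l))) t := by
      intro i j
      have := (ha i j).sub (hc i j)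
      rw [sub_self] at this
      exact ih this
    choose s₁ hs₁ using hd
    have h1 : ∑ i, ∑ j, B.gen E i j * (∑ l, ∑ a, M i a • (B.gen E a l * p j l)) =
        ∑ j, ∑ l, M j l • p j l := by
      simp only [Finset.mul_sum, mul_smul_comm, ← mul_assoc]
      rw [Finset.sum_comm]
      refine Finset.sum_congr rfl fun j _ => ?_
      rw [Finset.sum_comm]
      refine Finset.sum_congr rfl fun l _ => ?_
      simp only [← smul_mul_assoc, ← Finset.sum_mul]
      simp only [smul_mul_assoc]
      rw [B.sum_gen_mul_gen, smul_mul_assoc, one_mul]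
    have h2 : ∑ i, ∑ j, B.gen E i j * (∑ l, ∑ b, M⁻¹ j b • (B.gen E l b * p' i l)) =
        ∑ i, ∑ l, M⁻¹ i l • p' i l := by
      simp only [Finset.mul_sum, mul_smul_comm, ← mul_assoc]
      refine Finset.sum_congr rfl fun i _ => ?_
      rw [Finset.sum_comm]
      refine Finset.sum_congr rfl fun l _ => ?_
      simp only [← smul_mul_assoc, ← Finset.sum_mul]
      simp only [smul_mul_assoc]
      rw [B.sum_inv_gen_mul_gen, smul_mul_assoc, one_mul]
    have h3 := ((sum Finset.univ fun i _ => sum Finset.univ fun j _ =>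
      (hs₁ i j).gen_mul i j).add (((sum Finset.univ fun i _ => sum Finset.univ fun j _ =>
      (hp i j).smul (M i j)).add (sum Finset.univ fun i _ => sum Finset.univ fun j _ =>
      (hp' i j).smul (M⁻¹ i j))).lower)).add hb
    obtain ⟨t₁, h4⟩ : ∃ t₁, HasSymbol E (d + 1) _ t₁ := ⟨_, h3⟩
    refine ⟨t₁, ?_⟩
    convert h4 using 1
    simp only [mul_sub, mul_add, Finset.sum_sub_distrib, Finset.sum_add_distrib, h1, h2]
    abel

end HasSymbol
end HasSymbol

section MatrixComplex
universe u
variable {k : Type u} [Field k] {n : ℕ}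

section ScalarMat
variable {A : Type u} [Ring A] [Algebra k A]

theorem trace_scalarMat_mul (M : Matrix (Fin n) (Fin n) k) (X : Matrix (Fin n) (Fin n) A) :
    (scalarMat A M * X).trace = (X * scalarMat A M).trace := by
  simp only [Matrix.trace, Matrix.diag, Matrix.mul_apply, scalarMat_apply]
  rw [Finset.sum_comm]
  simp only [Algebra.commutes]

theorem trace_transpose_mul_transpose (X Y : Matrix (Fin n) (Fin n) A) :
    (Xᵀ * Yᵀ).trace = (X * Y).trace := by
  simp only [Matrix.trace, Matrix.diag, Matrix.mul_apply, Matrix.transpose_apply]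
  rw [Finset.sum_comm]

end ScalarMat

variable (E : GeneralLinearGroup (Fin n) k)

/-- The matrix `Eᵗ E⁻¹ - E u (Eᵗ)⁻¹`. -/
noncomputable def coinvMat : Matrix (Fin n) (Fin n) (B E) :=
  scalarMat (B E) ((E : Matrix (Fin n) (Fin n) k)ᵀ * (E : Matrix (Fin n) (Fin n) k)⁻¹) -
    scalarMat (B E) (E : Matrix (Fin n) (Fin n) k) * B.gen E *
      scalarMat (B E) ((E : Matrix (Fin n) (Fin n) k)⁻¹)ᵀ

theorem coinvMat_apply (i j : Fin n) : coinvMat E i j =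
    ((E : Matrix (Fin n) (Fin n) k)ᵀ * (E : Matrix (Fin n) (Fin n) k)⁻¹) i j • (1 : B E) -
      ∑ a, ∑ b, ((E : Matrix (Fin n) (Fin n) k) i a * (E : Matrix (Fin n) (Fin n) k)⁻¹ j b) •
        B.gen E a b := by
  rw [coinvMat, Matrix.sub_apply, scalarMat_apply, Algebra.algebraMap_eq_smul_one]
  congr 1
  simp only [Matrix.mul_apply, Finset.sum_mul, scalarMat_apply, Matrix.transpose_apply]
  rw [Finset.sum_comm]
  refine Finset.sum_congr rfl fun a _ => Finset.sum_congr rfl fun b _ => ?_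
  rw [mul_assoc, ← Algebra.commutes, ← mul_assoc, ← map_mul, Algebra.smul_def]

/-- The map `φ₁` in coordinates. -/
noncomputable def mapOne : B E →ₗ[k] Matrix (Fin n) (Fin n) (B E) where
  toFun x := Matrix.of fun i j => coinvMat E i j * x
  map_add' x y := by ext i j; simp [mul_add]
  map_smul' c x := by ext i j; simp

theorem mapOne_apply (x : B E) (i j : Fin n) : mapOne E x i j = coinvMat E i j * x := rfl

/-- The map `φ₂` in coordinates. -/
noncomputable def mapTwo : Matrix (Fin n) (Fin n) (B E) →ₗ[k] Matrix (Fin n) (Fin n) (B E) where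
  toFun X := X + (scalarMat (B E) (E : Matrix (Fin n) (Fin n) k)⁻¹ * (B.gen E)ᵀ * X *
    scalarMat (B E) (E : Matrix (Fin n) (Fin n) k))ᵀ
  map_add' X Y := by
    simp only [mul_add, add_mul, Matrix.transpose_add]
    abel
  map_smul' c X := by simp

theorem mapTwo_apply (X : Matrix (Fin n) (Fin n) (B E)) :
    mapTwo E X = X + (scalarMat (B E) (E : Matrix (Fin n) (Fin n) k)⁻¹ * (B.gen E)ᵀ * X *
      scalarMat (B E) (E : Matrix (Fin n) (Fin n) k))ᵀ := rfl

theorem mapTwo_apply_apply (X : Matrix (Fin n) (Fin n) (B E)) (p q : Fin n) :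
    mapTwo E X p q = X p q + ∑ i, ∑ j, ∑ m, ((E : Matrix (Fin n) (Fin n) k)⁻¹ q m *
      (E : Matrix (Fin n) (Fin n) k) j p) • (B.gen E i m * X i j) := by
  rw [mapTwo_apply, Matrix.add_apply, Matrix.transpose_apply]
  congr 1
  simp only [Matrix.mul_apply, Finset.sum_mul, scalarMat_apply, Matrix.transpose_apply]
  rw [Finset.sum_comm]
  refine Finset.sum_congr rfl fun i _ => Finset.sum_congr rfl fun j _ =>
    Finset.sum_congr rfl fun m _ => ?_
  rw [← Algebra.commutes, mul_assoc, ← mul_assoc, ← map_mul, mul_comm, Algebra.smul_def]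

/-- The map `φ₃` in coordinates. -/
noncomputable def mapThree : Matrix (Fin n) (Fin n) (B E) →ₗ[k] B E where
  toFun X := ((B.gen E)ᵀ * X).trace - X.trace
  map_add' X Y := by
    simp only [mul_add, Matrix.trace_add]
    abel
  map_smul' c X := by simp [smul_sub]

theorem mapThree_apply (X : Matrix (Fin n) (Fin n) (B E)) :
    mapThree E X = ((B.gen E)ᵀ * X).trace - X.trace := rfl

theorem mapThree_eq (X : Matrix (Fin n) (Fin n) (B E)) :
    mapThree E X = ∑ i, ∑ j, (B.gen E i j - (1 : Matrix (Fin n) (Fin n) (B E)) i j) * X i j := by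
  simp only [mapThree_apply, Matrix.trace, Matrix.diag, Matrix.mul_apply, Matrix.transpose_apply,
    sub_mul, Finset.sum_sub_distrib]
  rw [Finset.sum_comm]
  simp [Matrix.one_apply]

theorem mapThree_single (i j : Fin n) (x : B E) : mapThree E (Matrix.single i j x) =
    (B.gen E i j - (1 : Matrix (Fin n) (Fin n) (B E)) i j) * x := by
  rw [mapThree_eq, Finset.sum_eq_single i, Finset.sum_eq_single j]
  · simp
  · intro b _ hb
    simp [hb.symm]
  · simp
  · intro b _ hb
    simp [hb.symm]
  · simp

theorem mapTwo_mapOne (x : B E) : mapTwo E (mapOne E x) = 0 := by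
  set F := scalarMat (B E) (E : Matrix (Fin n) (Fin n) k) with hF
  set G := scalarMat (B E) (E : Matrix (Fin n) (Fin n) k)⁻¹ with hG
  have hGF : G * F = 1 := B.scalarMat_inv_mul E
  have h0 : G * (B.gen E)ᵀ * coinvMat E * F = -(coinvMat E)ᵀ := by
    have h1 : (coinvMat E)ᵀ = Gᵀ * F - G * (B.gen E)ᵀ * Fᵀ := by
      rw [coinvMat, Matrix.transpose_sub, B.mul_scalarMat_transpose, B.scalarMat_mul_transpose,
        Matrix.transpose_transpose, B.scalarMat_transpose, Matrix.transpose_mul,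
        Matrix.transpose_transpose, B.scalarMat_mul, ← mul_assoc]
      rfl
    have h2 : coinvMat E = Fᵀ * G - F * B.gen E * Gᵀ := by
      rw [coinvMat, B.scalarMat_mul]
      rfl
    have h3 : G * (B.gen E)ᵀ * F * B.gen E = 1 := B.rel_left E
    rw [h1, h2]
    calc G * (B.gen E)ᵀ * (Fᵀ * G - F * B.gen E * Gᵀ) * F
        = G * (B.gen E)ᵀ * Fᵀ * (G * F) - (G * (B.gen E)ᵀ * F * B.gen E) * Gᵀ * F := by
          noncomm_ring
      _ = _ := by rw [hGF, h3]; noncomm_ring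
  ext p q
  have h1 : ∀ p q, (G * (B.gen E)ᵀ * mapOne E x * F) p q =
      (G * (B.gen E)ᵀ * coinvMat E * F) p q * x := by
    intro p q
    simp only [Matrix.mul_apply (M := _ * _), mapOne_apply,
      Finset.sum_mul, ← mul_assoc]
    refine Finset.sum_congr rfl fun i _ => Finset.sum_congr rfl fun j _ => ?_
    rw [hF, scalarMat_apply, mul_assoc, ← Algebra.commutes, ← mul_assoc]
  rw [mapTwo_apply, Matrix.add_apply, Matrix.transpose_apply, h1, h0, mapOne_apply,
    Matrix.neg_apply, Matrix.transpose_apply, neg_mul, add_neg_cancel, Matrix.zero_apply]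

theorem mapThree_mapTwo (X : Matrix (Fin n) (Fin n) (B E)) : mapThree E (mapTwo E X) = 0 := by
  set F := scalarMat (B E) (E : Matrix (Fin n) (Fin n) k) with hF
  set G := scalarMat (B E) (E : Matrix (Fin n) (Fin n) k)⁻¹ with hG
  have hFG : F * G = 1 := B.scalarMat_mul_inv E
  have h1 : B.gen E * G * (B.gen E)ᵀ = G := B.gen_mul_transpose_gen E
  rw [mapThree_apply, mapTwo_apply, mul_add, Matrix.trace_add, Matrix.trace_add,
    trace_transpose_mul_transpose, Matrix.trace_transpose, ← hF, ← hG]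
  have h2 : (G * (B.gen E)ᵀ * X * F).trace = ((B.gen E)ᵀ * X).trace := by
    rw [← trace_scalarMat_mul, ← hF, ← mul_assoc, ← mul_assoc, hFG, one_mul]
  have h3 : (B.gen E * (G * (B.gen E)ᵀ * X * F)).trace = X.trace := by
    rw [← mul_assoc, ← mul_assoc, ← mul_assoc, h1, ← trace_scalarMat_mul, ← hF, ← mul_assoc, hFG,
      one_mul]
  rw [h2, h3]
  abel

theorem counit_mapThree (X : Matrix (Fin n) (Fin n) (B E)) :
    counit (R := k) (mapThree E X) = 0 := by
  rw [mapThree_eq]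
  simp only [map_sum, Bialgebra.counit_mul, map_sub, B.counit_gen]
  refine Finset.sum_eq_zero fun i _ => Finset.sum_eq_zero fun j _ => ?_
  rw [Matrix.one_apply, Matrix.one_apply]
  split_ifs <;> simp

/-- The sequence is exact at `B(E)`. -/
theorem exists_mapThree (x : B E) : ∃ X, mapThree E X = x - counit (R := k) x • 1 := by
  induction x using B.induction_left with
  | one => exact ⟨0, by simp⟩
  | mul i j p h =>
    obtain ⟨X, hX⟩ := h
    refine ⟨Matrix.single i j p + (1 : Matrix (Fin n) (Fin n) k) i j • X, ?_⟩
    rw [map_add, map_smul, mapThree_single, hX, Bialgebra.counit_mul, B.counit_gen]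
    rcases eq_or_ne i j with rfl | hij
    · simp [sub_mul]
    · simp [hij]
  | add p q h₁ h₂ =>
    obtain ⟨X, hX⟩ := h₁
    obtain ⟨Y, hY⟩ := h₂
    exact ⟨X + Y, by rw [map_add, hX, hY, map_add, add_smul]; abel⟩
  | smul c p h =>
    obtain ⟨X, hX⟩ := h
    exact ⟨c • X, by rw [map_smul, hX, map_smul, smul_sub, smul_assoc]⟩

end MatrixComplex

section Fox
universe u
variable {k : Type u} [Field k] {n : ℕ} (E : GeneralLinearGroup (Fin n) k)

theorem mapTwo_map_mul (X : Matrix (Fin n) (Fin n) (B E)) (b : B E) :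
    mapTwo E (X.map (· * b)) = (mapTwo E X).map (· * b) := by
  ext p q
  simp only [mapTwo_apply_apply, Matrix.map_apply, add_mul, Finset.sum_mul, smul_mul_assoc,
    mul_assoc]

/-- Right multiplication on the cokernel of `mapTwo`. -/
noncomputable def cokerMul (b : B E) :
    (Matrix (Fin n) (Fin n) (B E) ⧸ LinearMap.range (mapTwo E)) →ₗ[k]
      (Matrix (Fin n) (Fin n) (B E) ⧸ LinearMap.range (mapTwo E)) :=
  Submodule.mapQ _ _ (LinearMap.mapMatrix (LinearMap.mulRight k b)) (by
    rintro _ ⟨X, rfl⟩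
    exact ⟨X.map (· * b), mapTwo_map_mul E X b⟩)

theorem cokerMul_mk (b : B E) (X : Matrix (Fin n) (Fin n) (B E)) :
    cokerMul E b (Submodule.Quotient.mk X) = Submodule.Quotient.mk (X.map (· * b)) := rfl

/-- The right action of the generator `u i j` on `k × coker`. -/
noncomputable def cokerOp (i j : Fin n) :
    Module.End k (k × (Matrix (Fin n) (Fin n) (B E) ⧸ LinearMap.range (mapTwo E))) :=
  triangular ((1 : Matrix (Fin n) (Fin n) k) i j, Submodule.Quotient.mk (Matrix.single i j 1),
    cokerMul E (B.gen E i j))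

theorem cokerOp_relation (c : Matrix (Fin n) (Fin n) k) (e : k) (f g : Fin n → Fin n → Fin n × Fin n)
    (h₁ : ∑ a, ∑ b, c a b * ((1 : Matrix (Fin n) (Fin n) k) (g a b).1 (g a b).2 *
      (1 : Matrix (Fin n) (Fin n) k) (f a b).1 (f a b).2) = e)
    (h₂ : ∑ a, ∑ b, c a b • ((1 : Matrix (Fin n) (Fin n) k) (f a b).1 (f a b).2 •
        Matrix.single (g a b).1 (g a b).2 (1 : B E) +
        Matrix.single (f a b).1 (f a b).2 (B.gen E (g a b).1 (g a b).2)) ∈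
      LinearMap.range (mapTwo E))
    (h₃ : ∑ a, ∑ b, c a b • (B.gen E (f a b).1 (f a b).2 * B.gen E (g a b).1 (g a b).2) = e • 1) :
    ∑ a, ∑ b, c a b • (MulOpposite.op (cokerOp E (f a b).1 (f a b).2) *
      MulOpposite.op (cokerOp E (g a b).1 (g a b).2)) = e • 1 := by
  simp only [← MulOpposite.op_mul, ← MulOpposite.op_smul, ← Finset.op_sum, cokerOp, triangular_mul,
    ← map_smul, ← map_sum]
  rw [← MulOpposite.op_one, ← MulOpposite.op_smul, ← triangular_one, ← map_smul]
  congr 2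
  refine Prod.ext ?_ (Prod.ext ?_ ?_)
  · simp only [Prod.fst_sum, Prod.smul_mk, smul_eq_mul, h₁, mul_one]
  · simp only [Prod.fst_sum, Prod.snd_sum, Prod.smul_mk, smul_zero, cokerMul_mk]
    refine Eq.trans ?_ ((Submodule.Quotient.mk_eq_zero _).2 h₂)
    simp only [← Submodule.mkQ_apply, map_sum, map_smul, map_add]
    refine Finset.sum_congr rfl fun a _ => Finset.sum_congr rfl fun b _ => ?_
    congr 3
    ext p q
    simp [Matrix.single_apply]
  · simp only [Prod.snd_sum, Prod.smul_mk]
    refine LinearMap.ext fun m => ?_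
    obtain ⟨v, rfl⟩ := Submodule.Quotient.mk_surjective _ m
    simp only [LinearMap.sum_apply, LinearMap.smul_apply, Module.End.mul_apply, cokerMul_mk,
      ← Submodule.Quotient.mk_smul, Module.End.one_apply]
    simp only [← Submodule.mkQ_apply, ← map_sum]
    congr 1
    ext p q
    have := congrArg (v p q * ·) h₃
    simpa [Matrix.sum_apply, Finset.mul_sum, mul_assoc] using this

theorem exists_foxHom : ∃ D : B E →ₐ[k]
    (Module.End k (k × (Matrix (Fin n) (Fin n) (B E) ⧸ LinearMap.range (mapTwo E))))ᵐᵒᵖ,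
    ∀ i j, D (B.gen E i j) = MulOpposite.op (cokerOp E i j) := by
  refine B.exists_lift E (Matrix.of fun i j => MulOpposite.op (cokerOp E i j)) ?_ ?_
  · intro i j
    refine cokerOp_relation E _ _ (fun a _ => (a, i)) (fun _ b => (b, j)) ?_ ?_
      (B.sum_gen_mul_gen E i j)
    · simp [Matrix.one_apply]
    · refine ⟨scalarMat (B E) (E : Matrix (Fin n) (Fin n) k) * B.gen E * Matrix.single j i 1, ?_⟩
      rw [mapTwo_apply, ← mul_assoc, ← mul_assoc, B.rel_left, one_mul]
      ext p q
      simp only [Matrix.add_apply, Matrix.transpose_apply, Matrix.sum_apply, Matrix.smul_apply,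
        Matrix.mul_apply, scalarMat_apply, Matrix.single_apply, Matrix.one_apply]
      simp only [ite_and, mul_ite, ite_mul, mul_zero, zero_mul, mul_one, one_mul,
        Finset.sum_ite_eq, Finset.mem_univ, if_true, Finset.sum_ite_irrel, Finset.sum_const_zero,
        Algebra.smul_def, apply_ite (algebraMap k (B E)), map_one, map_zero, mul_add,
        Finset.sum_add_distrib, Finset.sum_ite_eq']
      rw [add_comm]
  · intro i j
    refine cokerOp_relation E _ _ (fun a _ => (i, a)) (fun _ b => (j, b)) ?_ ?_
      (B.sum_inv_gen_mul_gen E i j)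
    · simp [Matrix.one_apply]
    · refine ⟨Matrix.single j i 1 * scalarMat (B E) (E : Matrix (Fin n) (Fin n) k)⁻¹, ?_⟩
      rw [mapTwo_apply, ← mul_assoc, mul_assoc _ _ (scalarMat (B E) (E : Matrix (Fin n) (Fin n) k)),
        B.scalarMat_inv_mul, mul_one]
      ext p q
      simp only [Matrix.add_apply, Matrix.transpose_apply, Matrix.sum_apply, Matrix.smul_apply,
        Matrix.mul_apply, scalarMat_apply, Matrix.single_apply, Matrix.one_apply]
      simp only [ite_and, mul_ite, ite_mul, mul_zero, zero_mul, mul_one, one_mul,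
        Finset.sum_ite_eq, Finset.mem_univ, if_true, Finset.sum_ite_irrel, Finset.sum_const_zero,
        Algebra.smul_def, apply_ite (algebraMap k (B E)), map_one, map_zero, mul_add,
        Finset.sum_add_distrib, Finset.sum_ite_eq']

theorem foxHom_single_apply {D : B E →ₐ[k]
    (Module.End k (k × (Matrix (Fin n) (Fin n) (B E) ⧸ LinearMap.range (mapTwo E))))ᵐᵒᵖ}
    (hD : ∀ i j, D (B.gen E i j) = MulOpposite.op (cokerOp E i j)) (b : B E)
    (X : Matrix (Fin n) (Fin n) (B E)) :
    (D b).unop (0, Submodule.Quotient.mk X) = (0, Submodule.Quotient.mk (X.map (· * b))) := by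
  induction b using B.induction_left generalizing X with
  | one => simp
  | mul i j p h =>
    rw [map_mul, MulOpposite.unop_mul, Module.End.mul_apply, hD, MulOpposite.unop_op, cokerOp,
      triangular_apply, mul_zero, zero_smul, zero_add, cokerMul_mk, h]
    congr 2
    ext p q
    simp [mul_assoc]
  | add p q h₁ h₂ =>
    rw [map_add, MulOpposite.unop_add, LinearMap.add_apply, h₁, h₂, Prod.mk_add_mk, add_zero,
      ← Submodule.Quotient.mk_add]
    congr 2
    ext i j
    simp [mul_add]
  | smul c p h =>
    rw [map_smul, MulOpposite.unop_smul, LinearMap.smul_apply, h, Prod.smul_mk, smul_zero,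
      ← Submodule.Quotient.mk_smul]
    congr 2
    ext i j
    simp

/-- The sequence is exact at the source of `mapThree`. -/
theorem exists_mapTwo {X : Matrix (Fin n) (Fin n) (B E)} (h : mapThree E X = 0) :
    ∃ Y, mapTwo E Y = X := by
  obtain ⟨D, hD⟩ := exists_foxHom E
  have h1 : ∀ i j, (D ((B.gen E i j - (1 : Matrix (Fin n) (Fin n) (B E)) i j) * X i j)).unop (1, 0) =
      (0, Submodule.Quotient.mk (Matrix.single i j (X i j))) := by
    intro i j
    have h2 : (D (B.gen E i j - (1 : Matrix (Fin n) (Fin n) (B E)) i j)).unop (1, 0) =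
        (0, Submodule.Quotient.mk (Matrix.single i j 1)) := by
      have h3 : (1 : Matrix (Fin n) (Fin n) (B E)) i j =
          (1 : Matrix (Fin n) (Fin n) k) i j • (1 : B E) := by
        rw [Matrix.one_apply, Matrix.one_apply]
        split_ifs <;> simp
      rw [h3, map_sub, hD, map_smul, map_one, MulOpposite.unop_sub, MulOpposite.unop_op,
        LinearMap.sub_apply, cokerOp, triangular_apply]
      simp
    rw [map_mul, MulOpposite.unop_mul, Module.End.mul_apply, h2, foxHom_single_apply E hD]
    congr 2
    ext p q
    simp [Matrix.single_apply]
  have h2 : (D (mapThree E X)).unop (1, 0) = 0 := by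
    rw [h, map_zero, MulOpposite.unop_zero, LinearMap.zero_apply]
  rw [mapThree_eq] at h2
  simp only [map_sum, Finset.unop_sum, LinearMap.sum_apply, h1] at h2
  have h3 := congrArg Prod.snd h2
  simp only [Prod.snd_sum, Prod.snd_zero, ← Submodule.mkQ_apply, ← map_sum] at h3
  rw [Submodule.mkQ_apply, Submodule.Quotient.mk_eq_zero] at h3
  obtain ⟨Y, hY⟩ := h3
  exact ⟨Y, by rw [hY, ← Matrix.matrix_eq_sum_single]⟩

end Fox

section SymbolExactness
universe u
variable {k : Type u} [Field k] {n : ℕ}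
open QuadAlg

theorem row_ne_zero {F : Matrix (Fin n) (Fin n) k} (hF : IsUnit F) (i : Fin n) : F i ≠ 0 := by
  intro h
  have := congrFun (congrFun (Matrix.mul_nonsing_inv F ((Matrix.isUnit_iff_isUnit_det _).1 hF)) i) i
  rw [Matrix.mul_apply] at this
  simp [h] at this

/-- Common syzygies of the rows and columns of the matrix `x i ⊗ y j`. -/
theorem QuadAlg.exists_syz_both {F F' : Matrix (Fin n) (Fin n) k} (hn : 2 ≤ n) (hF : IsUnit F)
    (hF' : IsUnit F') {s : Fin n → Fin n → QuadAlg F ⊗[k] QuadAlg F'} (l : Fin n)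
    (h₁ : ∀ j, ∑ i, (x F i ⊗ₜ x F' l) * s i j = 0)
    (h₂ : ∀ i, ∑ j, (x F l ⊗ₜ x F' j) * s i j = 0) :
    ∃ z, ∀ i j, s i j = (form F (F i) ⊗ₜ form F' (F' j)) * z := by
  have hl : (Pi.single l 1 : Fin n → k) ≠ 0 := by simp
  have h₃ : ∀ j, ∃ r, ∀ i, s i j = (form F (F i) ⊗ₜ 1) * r := by
    intro j
    refine exists_syz_left (g := fun i => s i j) (eq_zero_of_form_right hn hF' hl ?_)
    rw [form_single, ← h₁ j, Finset.mul_sum]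
    simp only [← mul_assoc, Algebra.TensorProduct.tmul_mul_tmul, one_mul, mul_one]
  choose r hr using h₃
  obtain ⟨z, hz⟩ := exists_syz_right (g := r) (by
    refine eq_zero_of_form_left hn hF (row_ne_zero hF l) (eq_zero_of_form_left hn hF hl ?_)
    rw [form_single, ← h₂ l, Finset.mul_sum, Finset.mul_sum]
    simp only [hr, ← mul_assoc, Algebra.TensorProduct.tmul_mul_tmul, one_mul, mul_one])
  exact ⟨z, fun i j => by
    rw [hr, hz, ← mul_assoc, Algebra.TensorProduct.tmul_mul_tmul, one_mul, mul_one]⟩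

section FormTmulForm
variable {F F' : Matrix (Fin n) (Fin n) k}

theorem QuadAlg.form_tmul_form_mul (c c' : Fin n → k) (g : QuadAlg F ⊗[k] QuadAlg F') :
    (form F c ⊗ₜ form F' c') * g =
      ∑ a, ∑ b, (c a * c' b) • ((x F a ⊗ₜ 1) * ((1 ⊗ₜ x F' b) * g)) := by
  simp only [form, sum_tmul, tmul_sum, Finset.sum_mul, ← smul_tmul', tmul_smul, smul_mul_assoc,
    ← mul_assoc, Algebra.TensorProduct.tmul_mul_tmul, one_mul, mul_one]
  simp only [Finset.smul_sum, smul_smul]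
  rw [Finset.sum_comm]
  simp only [mul_comm]

theorem QuadAlg.biproj_succ_form (d e : ℕ) (c c' : Fin n → k) (g : QuadAlg F ⊗[k] QuadAlg F') :
    biproj F F' (d + 1) (e + 1) ((form F c ⊗ₜ form F' c') * g) =
      (form F c ⊗ₜ form F' c') * biproj F F' d e g := by
  simp only [form_tmul_form_mul, map_sum, map_smul, biproj_succ_left, biproj_succ_right]

theorem QuadAlg.biproj_zero_form (e : ℕ) (c c' : Fin n → k) (g : QuadAlg F ⊗[k] QuadAlg F') :
    biproj F F' 0 e ((form F c ⊗ₜ form F' c') * g) = 0 := by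
  simp only [form_tmul_form_mul, map_sum, map_smul, biproj_zero_left, smul_zero,
    Finset.sum_const_zero]

end FormTmulForm

variable {E : GeneralLinearGroup (Fin n) k}

theorem HasSymbol.mapOne {d : ℕ} {a : B E} {s : Segre E} (h : HasSymbol E d a s) (i j : Fin n) :
    HasSymbol E (d + 1) (mapOne E a i j)
      (-((form (E : Matrix (Fin n) (Fin n) k) ((E : Matrix (Fin n) (Fin n) k) i) ⊗ₜ
        form (E : Matrix (Fin n) (Fin n) k)⁻¹ ((E : Matrix (Fin n) (Fin n) k)⁻¹ j)) * s)) := by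
  rw [mapOne_apply, coinvMat_apply, sub_mul, smul_mul_assoc, one_mul, ← zero_sub]
  refine (h.smul _).lower.sub ?_
  simp only [form_tmul_form_mul, Finset.sum_mul, smul_mul_assoc]
  refine sum _ fun p _ => sum _ fun q _ => ?_
  rw [← mul_assoc, Algebra.TensorProduct.tmul_mul_tmul, one_mul, mul_one]
  exact (h.gen_mul p q).smul _

theorem inv_isUnit : IsUnit (E : Matrix (Fin n) (Fin n) k)⁻¹ :=
  Matrix.isUnit_nonsing_inv_iff.2 E.isUnit

variable [IsAlgClosed k] [NeZero (2 : k)]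

theorem exists_syz_of_mapTwo (hn : 2 ≤ n) {d : ℕ} {X : Matrix (Fin n) (Fin n) (B E)}
    {s : Fin n → Fin n → Segre E} (hX : ∀ i j, HasSymbol E d (X i j) (s i j))
    (h : mapTwo E X = 0) : ∃ z, ∀ i j, s i j =
      (form (E : Matrix (Fin n) (Fin n) k) ((E : Matrix (Fin n) (Fin n) k) i) ⊗ₜ
        form (E : Matrix (Fin n) (Fin n) k)⁻¹ ((E : Matrix (Fin n) (Fin n) k)⁻¹ j)) * z := by
  set F := scalarMat (B E) (E : Matrix (Fin n) (Fin n) k) with hF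
  set G := scalarMat (B E) (E : Matrix (Fin n) (Fin n) k)⁻¹ with hG
  have hGF : G * F = 1 := B.scalarMat_inv_mul E
  have hFG : F * G = 1 := B.scalarMat_mul_inv E
  have h0 : G * (B.gen E)ᵀ * X * F = -Xᵀ := by
    rw [mapTwo_apply, ← hF, ← hG] at h
    rw [← Matrix.transpose_transpose (G * (B.gen E)ᵀ * X * F), ← Matrix.transpose_neg,
      eq_neg_of_add_eq_zero_right h]
  have h1 : (B.gen E)ᵀ * X + F * Xᵀ * G = 0 := by
    have : F * (G * (B.gen E)ᵀ * X * F) * G = F * G * ((B.gen E)ᵀ * X) * (F * G) := by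
      simp only [mul_assoc]
    rw [h0, hFG, one_mul, mul_one] at this
    rw [← this]
    noncomm_ring
  have h2 : B.gen E * Xᵀ + G * X * F = 0 := by
    have : B.gen E * (G * (B.gen E)ᵀ * X * F) = B.gen E * G * (B.gen E)ᵀ * X * F := by
      simp only [mul_assoc]
    rw [h0, hG, B.gen_mul_transpose_gen, ← hG] at this
    rw [← this]
    noncomm_ring
  have hsum : ∀ (M N : Matrix (Fin n) (Fin n) k) (Y : Matrix (Fin n) (Fin n) (B E)) p q,
      (∀ i j, ∃ t, HasSymbol E d (Y i j) t) →
      ∃ t, HasSymbol E d ((scalarMat (B E) M * Y * scalarMat (B E) N) p q) t := by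
    intro M N Y p q hY
    choose t ht using hY
    have : (scalarMat (B E) M * Y * scalarMat (B E) N) p q =
        ∑ j, ∑ i, N j q • M p i • Y i j := by
      simp only [Matrix.mul_apply, scalarMat_apply]
      refine Finset.sum_congr rfl fun j _ => ?_
      rw [← Algebra.commutes, ← Algebra.smul_def, Finset.smul_sum]
      simp only [Algebra.smul_def]
    rw [this]
    exact ⟨_, HasSymbol.sum _ fun j _ => HasSymbol.sum _ fun i _ => ((ht i j).smul _).smul _⟩
  refine exists_syz_both hn E.isUnit inv_isUnit ⟨0, by omega⟩ (fun j => ?_) (fun i => ?_)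
  · obtain ⟨t, ht⟩ := hsum (E : Matrix (Fin n) (Fin n) k) (E : Matrix (Fin n) (Fin n) k)⁻¹ Xᵀ
      ⟨0, by omega⟩ j fun i j => ⟨_, hX j i⟩
    have h3 := congrFun (congrFun h1 ⟨0, by omega⟩) j
    rw [Matrix.add_apply, Matrix.mul_apply, Matrix.zero_apply] at h3
    have h4 := (HasSymbol.sum Finset.univ fun i _ => (hX i j).gen_mul i ⟨0, by omega⟩).add ht.lower
    simp only [Matrix.transpose_apply] at h3
    rw [h3, add_zero] at h4
    exact h4.eq_zero hn
  · obtain ⟨t, ht⟩ := hsum (E : Matrix (Fin n) (Fin n) k)⁻¹ (E : Matrix (Fin n) (Fin n) k) X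
      ⟨0, by omega⟩ i fun i j => ⟨_, hX i j⟩
    have h3 := congrFun (congrFun h2 ⟨0, by omega⟩) i
    rw [Matrix.add_apply, Matrix.mul_apply, Matrix.zero_apply] at h3
    have h4 := (HasSymbol.sum Finset.univ fun j _ => (hX i j).gen_mul ⟨0, by omega⟩ j).add ht.lower
    simp only [Matrix.transpose_apply] at h3
    rw [h3, add_zero] at h4
    exact h4.eq_zero hn

theorem exists_mapOne (hn : 2 ≤ n) {X : Matrix (Fin n) (Fin n) (B E)} (h : mapTwo E X = 0) :
    ∃ a, mapOne E a = X := by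
  obtain ⟨d, hd⟩ := HasSymbol.exists_symbol_family (fun p : Fin n × Fin n => X p.1 p.2)
  replace hd : ∀ i j, ∃ s, HasSymbol E d (X i j) s := fun i j => hd (i, j)
  induction d generalizing X with
  | zero =>
    choose s hs using hd
    obtain ⟨z, hz⟩ := exists_syz_of_mapTwo hn hs h
    refine ⟨0, ?_⟩
    rw [map_zero]
    ext i j
    refine (HasSymbol.eq_zero_of_degree_zero (E := E) ?_).symm
    have h1 := hs i j
    rwa [← h1.biproj_eq, hz, biproj_zero_form] at h1
  | succ d ih =>
    choose s hs using hd
    obtain ⟨z, hz⟩ := exists_syz_of_mapTwo hn hs h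
    obtain ⟨a, ha⟩ := HasSymbol.exists_of_biproj (E := E) d z
    have hs' : ∀ i j, s i j = (form (E : Matrix (Fin n) (Fin n) k) ((E : Matrix (Fin n) (Fin n) k) i) ⊗ₜ
        form (E : Matrix (Fin n) (Fin n) k)⁻¹ ((E : Matrix (Fin n) (Fin n) k)⁻¹ j)) *
        biproj _ _ d d z := by
      intro i j
      rw [← (hs i j).biproj_eq, hz, biproj_succ_form]
    obtain ⟨b, hb⟩ := ih (X := X + mapOne E a) (by rw [map_add, h, mapTwo_mapOne, add_zero])
      fun i j => by
        have := (hs i j).add (ha.mapOne i j)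
        rw [hs', add_neg_cancel] at this
        exact this.exists_lower
    exact ⟨b - a, by rw [map_sub, hb, add_sub_cancel_right]⟩

theorem mapOne_injective (hn : 2 ≤ n) : Function.Injective (mapOne E) := by
  refine (injective_iff_map_eq_zero _).2 fun a h => ?_
  obtain ⟨d, s, hs⟩ := HasSymbol.exists_symbol a
  have h0 : ∀ {d : ℕ} {s : Segre E}, HasSymbol E d a s → s = 0 := by
    intro d s hs
    have h1 := hs.mapOne ⟨0, by omega⟩ ⟨0, by omega⟩
    rw [h, Matrix.zero_apply] at h1
    have h2 := neg_eq_zero.1 (h1.eq_zero hn)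
    rw [← one_mul (form (E : Matrix (Fin n) (Fin n) k)⁻¹ _), ← mul_one (form _ _),
      ← Algebra.TensorProduct.tmul_mul_tmul, mul_assoc] at h2
    exact eq_zero_of_form_right hn inv_isUnit (row_ne_zero inv_isUnit _)
      (eq_zero_of_form_left hn E.isUnit (row_ne_zero E.isUnit _) h2)
  induction d generalizing s with
  | zero => exact HasSymbol.eq_zero_of_degree_zero (h0 hs ▸ hs)
  | succ d ih =>
    obtain ⟨t, ht⟩ := (h0 hs ▸ hs).exists_lower
    exact ih t ht

end SymbolExactness

section FreeModules
universe u
variable {k A : Type u} [Field k] [Ring A] [HopfAlgebra k A]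

/-- The universal property of the free Yetter-Drinfeld module: a colinear map `f : V → N` extends
to the morphism `v ⊗ a ↦ f v ← a`. -/
noncomputable def YDHom.ofFree (V : RightComodule k A) (N : YDModule k A)
    (f : V.carrier →ₗ[k] N.carrier)
    (hf : ∀ v, N.coact (f v) = f.rTensor A (V.coact v)) : YDHom (YDModule.free V) N where
  toLinearMap := TensorProduct.lift (N.act ∘ₗ f)
  map_act x a := by
    change TensorProduct.lift (N.act ∘ₗ f) (YDModule.freeAct V.carrier x a) =
      N.act (TensorProduct.lift (N.act ∘ₗ f) x) a
    induction x using TensorProduct.induction_on with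
    | zero => simp
    | add x y hx hy => simp only [map_add, LinearMap.add_apply, hx, hy]
    | tmul v b => simp [N.act_mul]
  map_coact x := by
    change N.coact (TensorProduct.lift (N.act ∘ₗ f) x) =
      (TensorProduct.lift (N.act ∘ₗ f)).rTensor A (YDModule.freeCoact V x)
    induction x using TensorProduct.induction_on with
    | zero => simp
    | add x y hx hy => simp only [map_add, hx, hy]
    | tmul v a =>
      rw [YDModule.freeCoact_tmul, TensorProduct.lift.tmul, LinearMap.comp_apply, N.coact_act, hf]
      generalize comul₃ k A a = t
      generalize V.coact v = s
      induction s with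
      | zero => simp
      | add x y hx hy => simp only [map_add, add_tmul, hx, hy]
      | tmul w b =>
        induction t with
        | zero => simp
        | add x y hx hy => simp only [map_add, tmul_add, hx, hy]
        | tmul t₁ t =>
          induction t with
          | zero => simp
          | add x y hx hy => simp only [map_add, tmul_add, hx, hy]
          | tmul t₂ t₃ => simp

theorem YDHom.ofFree_tmul (V : RightComodule k A) (N : YDModule k A)
    (f : V.carrier →ₗ[k] N.carrier) (hf) (v : V.carrier) (a : A) :
    (YDHom.ofFree V N f hf).toLinearMap (v ⊗ₜ[k] a) = N.act (f v) a := rfl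

theorem YDModule.isFree_free (V : RightComodule k A) : (YDModule.free V).IsFree :=
  ⟨V, ⟨LinearMap.id, fun _ _ => rfl, fun x => by rw [LinearMap.rTensor_id]; rfl⟩,
    Function.bijective_id⟩

instance YDModule.subsingleton_free_zero :
    Subsingleton (YDModule.free (RightComodule.zero k A)).carrier :=
  inferInstanceAs (Subsingleton (PUnit.{u + 1} ⊗[k] A))

theorem RightComodule.tensorAux_sum {V W : Type u} [AddCommGroup V] [Module k V] [AddCommGroup W]
    [Module k W] {ι ι' : Type*} [Fintype ι] [Fintype ι'] (v : ι → V) (a : ι → A) (w : ι' → W)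
    (b : ι' → A) : tensorAux V W ((∑ p, v p ⊗ₜ[k] a p) ⊗ₜ (∑ q, w q ⊗ₜ[k] b q)) =
      ∑ p : ι × ι', (v p.1 ⊗ₜ[k] w p.2) ⊗ₜ[k] (a p.1 * b p.2) := by
  simp only [sum_tmul, tmul_sum, map_sum, Fintype.sum_prod_type]
  simpa [tensorAux] using Finset.sum_comm

theorem lid_map_proj {n : ℕ} (f : A →ₗ[k] A) (g : Fin n → A) (i : Fin n) :
    TensorProduct.lid k A (TensorProduct.map (LinearMap.proj i) f
      (∑ l, (Pi.single l 1 : Fin n → k) ⊗ₜ[k] g l)) = f (g i) := by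
  simp [Pi.single_apply, ite_smul]

end FreeModules

section Basis
universe u
variable {k : Type u} [Field k] {n : ℕ} (E : GeneralLinearGroup (Fin n) k)

/-- The comodule `V_E* ⊗ V_E`. -/
noncomputable abbrev dualTensorFund : RightComodule k (B E) :=
  RightComodule.tensor (fundComodule E).dual (fundComodule E)

variable (k n) in
/-- The canonical basis of `V* ⊗ V`, where `V = k ^ n`. -/
noncomputable def piDualTensorBasis :
    Module.Basis (Fin n × Fin n) k (Module.Dual k (Fin n → k) ⊗[k] (Fin n → k)) :=
  (Pi.basisFun k (Fin n)).dualBasis.tensorProduct (Pi.basisFun k (Fin n))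

theorem piDualTensorBasis_apply (i j : Fin n) :
    piDualTensorBasis k n (i, j) = LinearMap.proj i ⊗ₜ[k] Pi.single j 1 := by
  have h : (Pi.basisFun k (Fin n)).dualBasis i = LinearMap.proj i := by
    ext j
    simp [Pi.single_apply]
  rw [piDualTensorBasis, Module.Basis.tensorProduct_apply, h, Pi.basisFun_apply]

/-- The basis `e i * ⊗ e j` of `V_E* ⊗ V_E`. -/
noncomputable def dualTensorBasis :
    Module.Basis (Fin n × Fin n) k (dualTensorFund E).carrier :=
  piDualTensorBasis k n

theorem dualTensorBasis_apply (i j : Fin n) : dualTensorBasis E (i, j) =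
    (LinearMap.proj i : Module.Dual k (Fin n → k)) ⊗ₜ[k] (Pi.single j 1 : Fin n → k) :=
  piDualTensorBasis_apply i j

theorem dualTensorBasis_tmul (i j : Fin n) (x : B E) :
    dualTensorBasis E (i, j) ⊗ₜ[k] x = dualTensor E i j x := by
  rw [dualTensorBasis_apply]
  rfl

theorem antipode_gen (i j : Fin n) : antipode k (B.gen E i j) = B.antipodeMat E i j :=
  B.antipodeLin_gen E i j

theorem dual_coact_proj (i : Fin n) :
    (fundComodule E).dual.coact (LinearMap.proj i : Module.Dual k (Fin n → k)) =
      ∑ p, (LinearMap.proj p : Module.Dual k (Fin n → k)) ⊗ₜ[k] B.antipodeMat E i p := by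
  apply (dualTensorHomEquiv k (Fin n → k) (B E)).injective
  refine (LinearEquiv.apply_symm_apply _ _).trans ?_
  refine (Pi.basisFun k (Fin n)).ext fun q => ?_
  refine (RightComodule.dualAux_apply (fundComodule E) _ _).trans ?_
  rw [Pi.basisFun_apply]
  have h : (fundComodule E).coact (Pi.single q 1 : Fin n → k) =
      ∑ l, Pi.single l (1 : k) ⊗ₜ[k] B.gen E l q := fundCoact_single E q
  rw [h]
  refine (lid_map_proj _ _ _).trans ?_
  rw [antipode_gen, map_sum, LinearMap.sum_apply]
  simp [Pi.single_apply]

theorem dualTensorFund_coact (i j : Fin n) :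
    (dualTensorFund E).coact (dualTensorBasis E (i, j)) =
      ∑ p : Fin n × Fin n,
        dualTensorBasis E p ⊗ₜ[k] (B.antipodeMat E i p.1 * B.gen E p.2 j) := by
  rw [dualTensorBasis_apply]
  change RightComodule.tensorAux _ _ ((fundComodule E).dual.coact _ ⊗ₜ fundCoact E _) = _
  rw [dual_coact_proj, fundCoact_single]
  refine (RightComodule.tensorAux_sum _ _ _ _).trans ?_
  exact Finset.sum_congr rfl fun p _ => by rw [dualTensorBasis_apply]; rfl

theorem comul₃_gen (a b : Fin n) : comul₃ k (B E) (B.gen E a b) =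
    ∑ y : Fin n × Fin n, B.gen E a y.1 ⊗ₜ[k] (B.gen E y.1 y.2 ⊗ₜ[k] B.gen E y.2 b) := by
  simp only [comul₃, LinearMap.comp_apply, B.comul_gen, map_sum, LinearMap.lTensor_tmul, tmul_sum,
    Fintype.sum_prod_type]

theorem comul₃_one : comul₃ k (B E) 1 = 1 ⊗ₜ[k] (1 ⊗ₜ[k] 1) := by
  simp [comul₃, Algebra.TensorProduct.one_def]

theorem freeDualTensor_coact (i j : Fin n) (x : B E) :
    (freeDualTensor E).coact (dualTensor E i j x) =
      ∑ p : Fin n × Fin n, ydTwist (TensorProduct.mk k (dualTensorFund E).carrier (B E))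
        ((dualTensorBasis E p ⊗ₜ[k] (B.antipodeMat E i p.1 * B.gen E p.2 j)) ⊗ₜ
          comul₃ k (B E) x) := by
  rw [← dualTensorBasis_tmul]
  refine (YDModule.freeCoact_tmul (dualTensorFund E) _ _).trans ?_
  rw [dualTensorFund_coact, sum_tmul, map_sum]

theorem freeDualTensor_coact_one (i j : Fin n) :
    (freeDualTensor E).coact (dualTensor E i j 1) =
      ∑ p : Fin n × Fin n, dualTensor E p.1 p.2 1 ⊗ₜ[k]
        (B.antipodeMat E i p.1 * B.gen E p.2 j) := by
  rw [freeDualTensor_coact]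
  refine Finset.sum_congr rfl fun p _ => ?_
  rw [comul₃_one, ydTwist_tmul, antipode_one, one_mul, mul_one, TensorProduct.mk_apply,
    dualTensorBasis_tmul]
  rfl

theorem freeDualTensor_coact_gen (i j a b : Fin n) :
    (freeDualTensor E).coact (dualTensor E i j (B.gen E a b)) =
      ∑ p : Fin n × Fin n, ∑ y : Fin n × Fin n, dualTensor E p.1 p.2 (B.gen E y.1 y.2) ⊗ₜ[k]
        (B.antipodeMat E a y.1 * (B.antipodeMat E i p.1 * B.gen E p.2 j) * B.gen E y.2 b) := by
  rw [freeDualTensor_coact]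
  refine Finset.sum_congr rfl fun p _ => ?_
  rw [comul₃_gen, tmul_sum, map_sum]
  refine Finset.sum_congr rfl fun y _ => ?_
  rw [ydTwist_tmul, antipode_gen, TensorProduct.mk_apply, dualTensorBasis_tmul]
  rfl

theorem freeOne_coact_one : (freeOne E).coact (oneTensor E 1) = oneTensor E 1 ⊗ₜ[k] 1 := by
  refine (YDModule.freeCoact_tmul (RightComodule.trivial k (B E)) _ _).trans ?_
  rw [comul₃_one]
  refine (ydTwist_tmul _ _ _ _ _ _).trans ?_
  rw [antipode_one, one_mul, mul_one]
  rfl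

theorem freeOne_coact_gen (i j : Fin n) : (freeOne E).coact (oneTensor E (B.gen E i j)) =
    ∑ y : Fin n × Fin n, oneTensor E (B.gen E y.1 y.2) ⊗ₜ[k]
      (B.antipodeMat E i y.1 * B.gen E y.2 j) := by
  refine (YDModule.freeCoact_tmul (RightComodule.trivial k (B E)) _ _).trans ?_
  rw [comul₃_gen, tmul_sum, map_sum]
  refine Finset.sum_congr rfl fun y _ => ?_
  refine (ydTwist_tmul _ _ _ _ _ _).trans ?_
  rw [antipode_gen, mul_one]
  rfl

end Basis

section Morphisms
universe u
variable {k : Type u} [Field k] {n : ℕ} (E : GeneralLinearGroup (Fin n) k)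

theorem dualTensor_add (i j : Fin n) (x y : B E) :
    dualTensor E i j (x + y) = dualTensor E i j x + dualTensor E i j y := tmul_add _ _ _

theorem dualTensor_smul (i j : Fin n) (c : k) (x : B E) :
    dualTensor E i j (c • x) = c • dualTensor E i j x := tmul_smul _ _ _

theorem freeDualTensor_act (i j : Fin n) (x y : B E) :
    (freeDualTensor E).act (dualTensor E i j x) y = dualTensor E i j (x * y) :=
  YDModule.freeAct_tmul _ _ _ _

theorem freeOne_act (x y : B E) : (freeOne E).act (oneTensor E x) y = oneTensor E (x * y) :=
  YDModule.freeAct_tmul _ _ _ _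

/-- The element `∑ e i * ⊗ e j ⊗ X i j`. -/
noncomputable def ofMatrix : Matrix (Fin n) (Fin n) (B E) →ₗ[k] (freeDualTensor E).carrier where
  toFun X := ∑ i, ∑ j, dualTensor E i j (X i j)
  map_add' X Y := by
    simp only [Matrix.add_apply, dualTensor_add, Finset.sum_add_distrib]
  map_smul' c X := by
    simp only [Matrix.smul_apply, dualTensor_smul, Finset.smul_sum, RingHom.id_apply]

theorem ofMatrix_apply (X : Matrix (Fin n) (Fin n) (B E)) :
    ofMatrix E X = ∑ i, ∑ j, dualTensor E i j (X i j) := rfl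

theorem ofMatrix_single (i j : Fin n) (x : B E) :
    ofMatrix E (Matrix.single i j x) = dualTensor E i j x := by
  have h0 : ∀ i j, dualTensor E i j 0 = 0 := fun i j => tmul_zero _ _
  rw [ofMatrix_apply, Finset.sum_eq_single i, Finset.sum_eq_single j]
  · simp
  · intro b _ hb
    simp [hb.symm, h0]
  · simp
  · intro b _ hb
    simp [hb.symm, h0]
  · simp

theorem ofMatrix_bijective : Function.Bijective (ofMatrix E) := by
  have h : ∀ X, ofMatrix E X = (TensorProduct.equivFinsuppOfBasisLeft (dualTensorBasis E)
      (N := B E)).symm (Finsupp.equivFunOnFinite.symm fun p : Fin n × Fin n => X p.1 p.2) := by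
    intro X
    rw [TensorProduct.equivFinsuppOfBasisLeft_symm_apply, Finsupp.sum_fintype _ _ (by simp),
      Fintype.sum_prod_type, ofMatrix_apply]
    simp only [dualTensorBasis_tmul]
    rfl
  constructor
  · intro X Y hXY
    rw [h, h] at hXY
    have := Finsupp.equivFunOnFinite.symm.injective ((LinearEquiv.injective _) hXY)
    ext i j
    exact congrFun this (i, j)
  · intro y
    refine ⟨Matrix.of fun i j => (TensorProduct.equivFinsuppOfBasisLeft (dualTensorBasis E)
      (N := B E)) y (i, j), ?_⟩
    refine (h _).trans ((LinearEquiv.symm_apply_eq _).2 ?_)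
    ext p
    rfl

theorem oneTensor_bijective : Function.Bijective (oneTensor E) :=
  (TensorProduct.lid k (B E)).symm.bijective

theorem exists_ofFree_trivial {N : YDModule k (B E)} (w : N.carrier)
    (hw : N.coact w = w ⊗ₜ[k] 1) : ∃ φ : YDHom (freeOne E) N, ∀ x,
      φ.toLinearMap (oneTensor E x) = N.act w x := by
  have h : ∀ v : k, N.coact (v • w) =
      (LinearMap.toSpanSingleton k N.carrier w).rTensor (B E) (v ⊗ₜ[k] (1 : B E)) := by
    intro v
    rw [LinearMap.rTensor_tmul, LinearMap.toSpanSingleton_apply, map_smul, hw, smul_tmul']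
  refine ⟨YDHom.ofFree (RightComodule.trivial k (B E)) N
    (LinearMap.toSpanSingleton k N.carrier w) h, fun x => ?_⟩
  refine (YDHom.ofFree_tmul _ _ _ _ _ _).trans ?_
  change N.act ((1 : k) • w) x = _
  rw [one_smul]

theorem exists_augHom : ∃ φ : YDHom (freeOne E) (YDModule.trivial k (B E)), ∀ x : B E,
    φ.toLinearMap (oneTensor E x) = (counit (R := k) x : k) := by
  obtain ⟨φ, hφ⟩ := exists_ofFree_trivial E (N := YDModule.trivial k (B E)) (1 : k) rfl
  exact ⟨φ, fun x => (hφ x).trans (one_mul (counit (R := k) x))⟩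

theorem sum_antipodeMat_mul_gen (p r : Fin n) :
    ∑ q : Fin n × Fin n, ((E : Matrix (Fin n) (Fin n) k)ᵀ * (E : Matrix (Fin n) (Fin n) k)⁻¹) q.1 q.2 •
      (B.antipodeMat E q.1 p * B.gen E r q.2) =
      ((E : Matrix (Fin n) (Fin n) k)ᵀ * (E : Matrix (Fin n) (Fin n) k)⁻¹) p r • (1 : B E) := by
  have h : (B.antipodeMat E)ᵀ * scalarMat (B E)
      ((E : Matrix (Fin n) (Fin n) k)ᵀ * (E : Matrix (Fin n) (Fin n) k)⁻¹) * (B.gen E)ᵀ =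
      scalarMat (B E) ((E : Matrix (Fin n) (Fin n) k)ᵀ * (E : Matrix (Fin n) (Fin n) k)⁻¹) := by
    rw [B.transpose_antipodeMat, B.scalarMat_mul]
    calc _ = scalarMat (B E) (E : Matrix (Fin n) (Fin n) k)ᵀ * B.gen E *
          (scalarMat (B E) ((E : Matrix (Fin n) (Fin n) k)⁻¹)ᵀ *
            scalarMat (B E) (E : Matrix (Fin n) (Fin n) k)ᵀ) *
          scalarMat (B E) (E : Matrix (Fin n) (Fin n) k)⁻¹ * (B.gen E)ᵀ := by
          simp only [mul_assoc]
      _ = _ := by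
          rw [B.scalarMat_transpose_inv_mul, mul_one, mul_assoc, mul_assoc, ← mul_assoc (B.gen E),
            B.gen_mul_transpose_gen]
  have h1 := congrFun (congrFun h p) r
  simp only [Matrix.mul_apply (M := _ * _), Matrix.mul_apply (M := (B.antipodeMat E)ᵀ),
    Matrix.transpose_apply, Finset.sum_mul] at h1
  rw [Finset.sum_comm] at h1
  rw [Fintype.sum_prod_type, ← Algebra.algebraMap_eq_smul_one, ← scalarMat_apply, ← h1]
  refine Finset.sum_congr rfl fun i _ => Finset.sum_congr rfl fun j _ => ?_
  rw [scalarMat_apply, ← Algebra.commutes, mul_assoc, Algebra.smul_def]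

theorem sum_antipodeMat_mul_antipodeMat (p c : Fin n) :
    ∑ i, ∑ a, (E : Matrix (Fin n) (Fin n) k) i a • (B.antipodeMat E a c * B.antipodeMat E i p) =
      (E : Matrix (Fin n) (Fin n) k) p c • (1 : B E) := by
  have h := congrArg (antipode k) (B.sum_gen_mul_gen E p c)
  simpa only [map_sum, map_smul, antipode_mul_antidistrib, antipode_gen, antipode_one] using h

theorem sum_antipodeMat (j p : Fin n) :
    ∑ i, (E : Matrix (Fin n) (Fin n) k) j i • B.antipodeMat E i p =
      ∑ a, (E : Matrix (Fin n) (Fin n) k) a p • B.gen E a j := by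
  have h : scalarMat (B E) (E : Matrix (Fin n) (Fin n) k) * B.antipodeMat E =
      (B.gen E)ᵀ * scalarMat (B E) (E : Matrix (Fin n) (Fin n) k) := by
    rw [B.antipodeMat, ← mul_assoc, ← mul_assoc, B.scalarMat_mul_inv, one_mul]
  have h1 := congrFun (congrFun h j) p
  simpa only [Matrix.mul_apply, scalarMat_apply, Matrix.transpose_apply, ← Algebra.commutes,
    ← Algebra.smul_def] using h1

theorem coact_sum_dualTensor_one : (freeDualTensor E).coact (∑ q : Fin n × Fin n,
      ((E : Matrix (Fin n) (Fin n) k)ᵀ * (E : Matrix (Fin n) (Fin n) k)⁻¹) q.1 q.2 •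
        dualTensor E q.1 q.2 1) =
    (∑ q : Fin n × Fin n,
      ((E : Matrix (Fin n) (Fin n) k)ᵀ * (E : Matrix (Fin n) (Fin n) k)⁻¹) q.1 q.2 •
        dualTensor E q.1 q.2 1) ⊗ₜ[k] 1 := by
  simp only [map_sum, map_smul, freeDualTensor_coact_one, Finset.smul_sum]
  rw [Finset.sum_comm, sum_tmul]
  refine Finset.sum_congr rfl fun p _ => ?_
  simp only [← tmul_smul, ← tmul_sum]
  rw [sum_antipodeMat_mul_gen, tmul_smul, smul_tmul']

theorem coact_sum_dualTensor_gen : (freeDualTensor E).coact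
      (∑ q : Fin n × Fin n, ∑ y : Fin n × Fin n, ((E : Matrix (Fin n) (Fin n) k) q.1 y.1 *
        (E : Matrix (Fin n) (Fin n) k)⁻¹ q.2 y.2) • dualTensor E q.1 q.2 (B.gen E y.1 y.2)) =
    (∑ q : Fin n × Fin n, ∑ y : Fin n × Fin n, ((E : Matrix (Fin n) (Fin n) k) q.1 y.1 *
        (E : Matrix (Fin n) (Fin n) k)⁻¹ q.2 y.2) • dualTensor E q.1 q.2 (B.gen E y.1 y.2)) ⊗ₜ[k]
      1 := by
  have h : ∀ p y : Fin n × Fin n, ∑ q : Fin n × Fin n, ∑ z : Fin n × Fin n,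
      ((E : Matrix (Fin n) (Fin n) k) q.1 z.1 * (E : Matrix (Fin n) (Fin n) k)⁻¹ q.2 z.2) •
        (B.antipodeMat E z.1 y.1 * (B.antipodeMat E q.1 p.1 * B.gen E p.2 q.2) * B.gen E y.2 z.2) =
      ((E : Matrix (Fin n) (Fin n) k) p.1 y.1 * (E : Matrix (Fin n) (Fin n) k)⁻¹ p.2 y.2) •
        (1 : B E) := by
    intro p y
    have h1 := congrArg₂ (· * ·) (sum_antipodeMat_mul_antipodeMat E p.1 y.1)
      (B.sum_inv_gen_mul_gen E p.2 y.2)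
    simp only [Finset.sum_mul] at h1
    simp only [Finset.mul_sum] at h1
    rw [smul_mul_smul_comm, one_mul] at h1
    rw [← h1]
    simp only [Fintype.sum_prod_type]
    refine Finset.sum_congr rfl fun i _ => ?_
    rw [Finset.sum_comm]
    refine Finset.sum_congr rfl fun a _ => Finset.sum_congr rfl fun j _ =>
      Finset.sum_congr rfl fun b _ => ?_
    rw [smul_mul_smul_comm]
    simp only [mul_assoc]
  simp only [map_sum, map_smul, freeDualTensor_coact_gen, Finset.smul_sum, sum_tmul]
  refine (Finset.sum_congr rfl fun q _ => Finset.sum_comm).trans (Finset.sum_comm.trans ?_)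
  refine Finset.sum_congr rfl fun p _ => ?_
  refine (Finset.sum_congr rfl fun q _ => Finset.sum_comm).trans (Finset.sum_comm.trans ?_)
  refine Finset.sum_congr rfl fun y _ => ?_
  simp only [← tmul_smul, ← tmul_sum]
  rw [h, tmul_smul, smul_tmul']

theorem coinvMat_coact : (freeDualTensor E).coact (ofMatrix E (coinvMat E)) =
    ofMatrix E (coinvMat E) ⊗ₜ[k] 1 := by
  have h : ofMatrix E (coinvMat E) = ∑ q : Fin n × Fin n,
      ((E : Matrix (Fin n) (Fin n) k)ᵀ * (E : Matrix (Fin n) (Fin n) k)⁻¹) q.1 q.2 •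
        dualTensor E q.1 q.2 1 - ∑ q : Fin n × Fin n, ∑ y : Fin n × Fin n,
        ((E : Matrix (Fin n) (Fin n) k) q.1 y.1 * (E : Matrix (Fin n) (Fin n) k)⁻¹ q.2 y.2) •
          dualTensor E q.1 q.2 (B.gen E y.1 y.2) := by
    have hs : ∀ i j x y, dualTensor E i j (x - y) = dualTensor E i j x - dualTensor E i j y :=
      fun i j x y => tmul_sub _ _ _
    have hsum : ∀ i j (f : Fin n → B E), dualTensor E i j (∑ a, f a) = ∑ a, dualTensor E i j (f a) :=
      fun i j f => tmul_sum _ _ _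
    simp only [ofMatrix_apply, coinvMat_apply, hs, hsum, dualTensor_smul, Finset.sum_sub_distrib,
      Fintype.sum_prod_type]
  rw [h, map_sub, coact_sum_dualTensor_one, coact_sum_dualTensor_gen, sub_tmul]

theorem exists_homOne : ∃ φ : YDHom (freeOne E) (freeDualTensor E), ∀ x,
    φ.toLinearMap (oneTensor E x) = ofMatrix E (mapOne E x) := by
  obtain ⟨φ, hφ⟩ := exists_ofFree_trivial E _ (coinvMat_coact E)
  refine ⟨φ, fun x => ?_⟩
  rw [hφ, ofMatrix_apply, ofMatrix_apply]
  simp only [map_sum, LinearMap.sum_apply, freeDualTensor_act, mapOne_apply]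

theorem exists_ofFree_dualTensor {N : YDModule k (B E)} (w : Fin n → Fin n → N.carrier)
    (hw : ∀ i j, N.coact (w i j) = ∑ p : Fin n × Fin n,
      w p.1 p.2 ⊗ₜ[k] (B.antipodeMat E i p.1 * B.gen E p.2 j)) :
    ∃ φ : YDHom (freeDualTensor E) N, ∀ i j x,
      φ.toLinearMap (dualTensor E i j x) = N.act (w i j) x := by
  have hb : ∀ i j, (dualTensorBasis E).constr k (fun p => w p.1 p.2) (dualTensorBasis E (i, j)) =
    w i j := fun i j => Module.Basis.constr_basis _ _ _ _
  refine ⟨YDHom.ofFree (dualTensorFund E) N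
    ((dualTensorBasis E).constr k fun p => w p.1 p.2) ?_, fun i j x => ?_⟩
  · intro v
    refine LinearMap.congr_fun (f := N.coact ∘ₗ ((dualTensorBasis E).constr k fun p => w p.1 p.2))
      (g := ((dualTensorBasis E).constr k fun p => w p.1 p.2).rTensor (B E) ∘ₗ
        (dualTensorFund E).coact) ((dualTensorBasis E).ext fun p => ?_) v
    obtain ⟨i, j⟩ := p
    rw [LinearMap.comp_apply, LinearMap.comp_apply, dualTensorFund_coact, hb, hw, map_sum]
    refine Finset.sum_congr rfl fun p _ => ?_
    rw [LinearMap.rTensor_tmul, hb]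
  · rw [← dualTensorBasis_tmul]
    refine (YDHom.ofFree_tmul _ _ _ _ _ _).trans ?_
    rw [hb]

theorem exists_homThree : ∃ φ : YDHom (freeDualTensor E) (freeOne E), ∀ i j x,
    φ.toLinearMap (dualTensor E i j x) =
      oneTensor E ((B.gen E i j - (1 : Matrix (Fin n) (Fin n) (B E)) i j) * x) := by
  have hs : ∀ x y, oneTensor E (x - y) = oneTensor E x - oneTensor E y :=
    fun x y => tmul_sub _ _ _
  obtain ⟨φ, hφ⟩ := exists_ofFree_dualTensor E (N := freeOne E)
    (fun i j => oneTensor E (B.gen E i j - (1 : Matrix (Fin n) (Fin n) (B E)) i j)) (by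
    intro i j
    have h1 : ∀ i j, oneTensor E ((1 : Matrix (Fin n) (Fin n) (B E)) i j) =
        (1 : Matrix (Fin n) (Fin n) k) i j • oneTensor E 1 := by
      intro i j
      rw [Matrix.one_apply, Matrix.one_apply]
      split_ifs
      · rw [one_smul]
      · rw [zero_smul]
        exact tmul_zero _ _
    simp only [hs, sub_tmul, Finset.sum_sub_distrib]
    rw [map_sub, freeOne_coact_gen, h1, map_smul, freeOne_coact_one]
    congr 1
    simp only [h1, Fintype.sum_prod_type, ← smul_tmul', ← tmul_smul, ← tmul_sum]
    congr 1
    have h2 := congrFun (congrFun (B.antipodeMat_mul E) i) j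
    rw [Matrix.mul_apply] at h2
    simp only [Matrix.one_apply, ite_smul, one_smul, zero_smul, Finset.sum_ite_eq,
      Finset.mem_univ, if_true, h2])
  exact ⟨φ, fun i j x => by rw [hφ, freeOne_act]⟩

theorem mapTwo_single (i j : Fin n) (x : B E) (p q : Fin n) :
    mapTwo E (Matrix.single i j x) p q = Matrix.single i j x p q + ∑ m,
      ((E : Matrix (Fin n) (Fin n) k)⁻¹ q m * (E : Matrix (Fin n) (Fin n) k) j p) •
        (B.gen E i m * x) := by
  rw [mapTwo_apply_apply, Finset.sum_eq_single i, Finset.sum_eq_single j]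
  · simp
  · intro b _ hb
    simp [hb.symm]
  · simp
  · intro b _ hb
    simp [hb.symm]
  · simp

theorem ofMatrix_mapTwo_single (i j : Fin n) (x : B E) :
    ofMatrix E (mapTwo E (Matrix.single i j x)) = dualTensor E i j x +
      ∑ p : Fin n × Fin n, ∑ m, ((E : Matrix (Fin n) (Fin n) k)⁻¹ p.2 m *
        (E : Matrix (Fin n) (Fin n) k) j p.1) • dualTensor E p.1 p.2 (B.gen E i m * x) := by
  have hsum : ∀ i j (f : Fin n → B E), dualTensor E i j (∑ a, f a) = ∑ a, dualTensor E i j (f a) :=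
    fun i j f => tmul_sum _ _ _
  rw [← ofMatrix_single, ofMatrix_apply, ofMatrix_apply]
  simp only [mapTwo_single, dualTensor_add, hsum, dualTensor_smul, Finset.sum_add_distrib,
    Fintype.sum_prod_type]

theorem coact_ofMatrix_mapTwo_single (i j : Fin n) :
    (freeDualTensor E).coact (ofMatrix E (mapTwo E (Matrix.single i j 1))) =
      ∑ q : Fin n × Fin n, ofMatrix E (mapTwo E (Matrix.single q.1 q.2 1)) ⊗ₜ[k]
        (B.antipodeMat E i q.1 * B.gen E q.2 j) := by
  have h : ∀ p y : Fin n × Fin n, ∑ z : Fin n × Fin n, ∑ m,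
      ((E : Matrix (Fin n) (Fin n) k)⁻¹ z.2 m * (E : Matrix (Fin n) (Fin n) k) j z.1) •
        (B.antipodeMat E i y.1 * (B.antipodeMat E z.1 p.1 * B.gen E p.2 z.2) * B.gen E y.2 m) =
      ∑ a, ((E : Matrix (Fin n) (Fin n) k)⁻¹ p.2 y.2 * (E : Matrix (Fin n) (Fin n) k) a p.1) •
        (B.antipodeMat E i y.1 * B.gen E a j) := by
    intro p y
    have h1 := congrArg₂ (· * ·) (congrArg (B.antipodeMat E i y.1 * ·) (sum_antipodeMat E j p.1))
      (B.sum_inv_gen_mul_gen E p.2 y.2)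
    simp only [mul_smul_comm, mul_one] at h1
    simp only [Finset.mul_sum, Finset.sum_mul, Finset.smul_sum] at h1
    simp only [mul_smul_comm, smul_mul_assoc, smul_smul] at h1
    rw [← h1, Fintype.sum_prod_type, Finset.sum_comm]
    refine Finset.sum_congr rfl fun b _ => ?_
    rw [Finset.sum_comm]
    refine Finset.sum_congr rfl fun m _ => Finset.sum_congr rfl fun a _ => ?_
    simp only [mul_assoc]
  simp only [ofMatrix_mapTwo_single, mul_one, map_add, map_sum, map_smul, freeDualTensor_coact_gen,
    freeDualTensor_coact_one, add_tmul, sum_tmul, Finset.sum_add_distrib, Finset.smul_sum]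
  congr 1
  refine (Finset.sum_congr rfl fun z _ => Finset.sum_comm).trans (Finset.sum_comm.trans (Eq.symm ?_))
  refine Finset.sum_comm.trans (Finset.sum_congr rfl fun p _ => Eq.symm ?_)
  refine (Finset.sum_congr rfl fun z _ => Finset.sum_comm).trans (Finset.sum_comm.trans ?_)
  simp only [← tmul_smul, ← tmul_sum, h]
  simp only [Fintype.sum_prod_type]
  refine Finset.sum_congr rfl fun c _ => Eq.symm ?_
  rw [Finset.sum_comm]
  simp only [tmul_sum, tmul_smul, smul_tmul']

theorem exists_homTwo : ∃ φ : YDHom (freeDualTensor E) (freeDualTensor E), ∀ i j x,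
    φ.toLinearMap (dualTensor E i j x) = ofMatrix E (mapTwo E (Matrix.single i j x)) := by
  obtain ⟨φ, hφ⟩ := exists_ofFree_dualTensor E (N := freeDualTensor E)
    (fun i j => ofMatrix E (mapTwo E (Matrix.single i j 1))) (coact_ofMatrix_mapTwo_single E)
  refine ⟨φ, fun i j x => ?_⟩
  rw [hφ, ofMatrix_mapTwo_single, ofMatrix_mapTwo_single]
  simp only [map_add, map_sum, map_smul, LinearMap.add_apply, LinearMap.sum_apply,
    LinearMap.smul_apply, freeDualTensor_act, mul_one, one_mul]

end Morphisms

section Exactness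
universe u
variable {k : Type u} [Field k] {n : ℕ} (E : GeneralLinearGroup (Fin n) k)

theorem coinvMat_eq : coinvMat E =
    scalarMat (B E) (E.valᵀ * E.val⁻¹) -
      scalarMat (B E) E.val * B.gen E * scalarMat (B E) (E.valᵀ)⁻¹ := by
  rw [coinvMat, Matrix.transpose_nonsing_inv]

theorem mapTwo_single_coeff (i j : Fin n) (x : B E) (p q : Fin n) :
    mapTwo E (Matrix.single i j x) p q = Matrix.single i j x p q +
      (B.gen E * scalarMat (B E) (E.valᵀ)⁻¹) i q * algebraMap k (B E) (E.val j p) * x := by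
  rw [mapTwo_single, Matrix.mul_apply, Finset.sum_mul, Finset.sum_mul]
  congr 1
  refine Finset.sum_congr rfl fun m _ => ?_
  rw [scalarMat_apply, ← Matrix.transpose_nonsing_inv, Matrix.transpose_apply, mul_assoc (B.gen E i m),
    ← map_mul, ← Algebra.commutes, mul_assoc, Algebra.smul_def]

theorem ofMatrix_mapTwo_single_coeff (i j : Fin n) (x : B E) :
    ofMatrix E (mapTwo E (Matrix.single i j x)) = dualTensor E i j x +
      ∑ p, ∑ q, dualTensor E p q
        ((B.gen E * scalarMat (B E) (E.valᵀ)⁻¹) i q * algebraMap k (B E) (E.val j p) * x) := by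
  rw [← ofMatrix_single, ofMatrix_apply, ofMatrix_apply]
  simp only [mapTwo_single_coeff, dualTensor_add, Finset.sum_add_distrib]

variable {E}

theorem map_ofMatrix_eq {M : YDModule k (B E)} (φ : YDHom (freeDualTensor E) M)
    {f : Matrix (Fin n) (Fin n) (B E) →ₗ[k] M.carrier}
    (h : ∀ i j x, φ.toLinearMap (dualTensor E i j x) = f (Matrix.single i j x))
    (X : Matrix (Fin n) (Fin n) (B E)) : φ.toLinearMap (ofMatrix E X) = f X := by
  conv_rhs => rw [Matrix.matrix_eq_sum_single X]
  simp only [ofMatrix_apply, map_sum, h]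

variable (E) in
/-- The identification of `B(E)` with `k ⊠ B(E)`. -/
noncomputable def oneTensorLin : B E →ₗ[k] (freeOne E).carrier where
  toFun := oneTensor E
  map_add' _ _ := tmul_add _ _ _
  map_smul' _ _ := tmul_smul _ _ _

theorem isFreeYDResolution_threeTerm {A : Type u} [Ring A] [HopfAlgebra k A]
    {V₀ V₁ V₂ V₃ : RightComodule k A} {M : YDModule k A}
    (f₃ : YDHom (YDModule.free V₃) (YDModule.free V₂))
    (f₂ : YDHom (YDModule.free V₂) (YDModule.free V₁))
    (f₁ : YDHom (YDModule.free V₁) (YDModule.free V₀)) (ε : YDHom (YDModule.free V₀) M)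
    (h₃ : Function.Injective f₃.toLinearMap)
    (h₂ : Function.Exact f₃.toLinearMap f₂.toLinearMap)
    (h₁ : Function.Exact f₂.toLinearMap f₁.toLinearMap)
    (h₀ : Function.Exact f₁.toLinearMap ε.toLinearMap)
    (hε : Function.Surjective ε.toLinearMap) :
    IsFreeYDResolution (threeTerm (YDModule.free V₀) (YDModule.free V₁) (YDModule.free V₂)
      (YDModule.free V₃)) (threeMap f₃ f₂ f₁) ε := by
  refine ⟨fun i => ?_, fun i => ?_, h₀, hε⟩
  · match i with
    | 0 | 1 | 2 | 3 | _ + 4 => exact YDModule.isFree_free _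
  · match i with
    | 0 => exact h₁
    | 1 => exact h₂
    | 2 =>
      intro x
      refine ⟨fun h => ⟨0, ?_⟩, ?_⟩
      · exact (h₃ (h.trans (map_zero _).symm)).symm
      · rintro ⟨y, rfl⟩
        exact map_zero f₃.toLinearMap
    | _ + 3 =>
      intro x
      have : x = 0 := Subsingleton.elim (α := (YDModule.free (RightComodule.zero k A)).carrier) x 0
      exact ⟨fun _ => ⟨0, (map_zero _).trans this.symm⟩, fun _ => this ▸ map_zero _⟩

end Exactness
end BilinHopf

theorem theorem5p1 (n : ℕ) (hn : 2 ≤ n) (E : Matrix.GeneralLinearGroup (Fin n) ℂ) :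
    ∃ (φ₁ : YDHom (freeOne E) (freeDualTensor E))
      (φ₂ : YDHom (freeDualTensor E) (freeDualTensor E))
      (φ₃ : YDHom (freeDualTensor E) (freeOne E))
      (ε : YDHom (freeOne E) (YDModule.trivial ℂ (B E))),
      -- the explicit formulas for the four maps
      (∀ x : B E, φ₁.toLinearMap (oneTensor E x) =
        ∑ i, ∑ j, dualTensor E i j
          ((scalarMat (B E) (E.valᵀ * E.val⁻¹) -
            scalarMat (B E) E.val * B.gen E *
              scalarMat (B E) (E.valᵀ)⁻¹) i j * x)) ∧
      (∀ (i j : Fin n) (x : B E), φ₂.toLinearMap (dualTensor E i j x) =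
        dualTensor E i j x +
          ∑ k, ∑ l, dualTensor E k l
            ((B.gen E * scalarMat (B E) (E.valᵀ)⁻¹) i l *
              algebraMap ℂ (B E) (E.val j k) * x)) ∧
      (∀ (i j : Fin n) (x : B E), φ₃.toLinearMap (dualTensor E i j x) =
        oneTensor E ((B.gen E i j - if i = j then 1 else 0) * x)) ∧
      (∀ x : B E, ε.toLinearMap (oneTensor E x) =
        (Coalgebra.counit x : ℂ)) ∧
      -- exactness of the sequence
      Function.Injective φ₁.toLinearMap ∧
      Function.Exact φ₁.toLinearMap φ₂.toLinearMap ∧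
      Function.Exact φ₂.toLinearMap φ₃.toLinearMap ∧
      Function.Exact φ₃.toLinearMap ε.toLinearMap ∧
      Function.Surjective ε.toLinearMap ∧
      -- hence a free Yetter-Drinfeld resolution of length three
      IsFreeYDResolution
        (threeTerm (freeOne E) (freeDualTensor E)
          (freeDualTensor E) (freeOne E))
        (threeMap φ₁ φ₂ φ₃) ε := by
  obtain ⟨φ₁, h₁⟩ := exists_homOne E
  obtain ⟨φ₂, h₂⟩ := exists_homTwo E
  obtain ⟨φ₃, h₃⟩ := exists_homThree E
  obtain ⟨ε, hε⟩ := exists_augHom E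
  have h₂' : ∀ X, φ₂.toLinearMap (ofMatrix E X) = ofMatrix E (mapTwo E X) :=
    map_ofMatrix_eq φ₂ (f := ofMatrix E ∘ₗ mapTwo E) h₂
  have h₃' : ∀ X, φ₃.toLinearMap (ofMatrix E X) = oneTensor E (mapThree E X) := by
    refine map_ofMatrix_eq φ₃ (f := oneTensorLin E ∘ₗ mapThree E) fun i j x => ?_
    rw [h₃, LinearMap.comp_apply, mapThree_single]
    rfl
  have hinj : Function.Injective φ₁.toLinearMap := by
    refine (injective_iff_map_eq_zero _).2 fun y hy => ?_
    obtain ⟨x, rfl⟩ := (oneTensor_bijective E).2 y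
    rw [h₁] at hy
    have hx : mapOne E x = 0 := (ofMatrix_bijective E).1 (hy.trans (map_zero _).symm)
    rw [mapOne_injective hn (hx.trans (map_zero _).symm)]
    exact map_zero (oneTensorLin E)
  have hex₂ : Function.Exact φ₁.toLinearMap φ₂.toLinearMap := by
    intro y
    obtain ⟨X, rfl⟩ := (ofMatrix_bijective E).2 y
    constructor
    · intro h
      rw [h₂'] at h
      obtain ⟨a, ha⟩ := exists_mapOne hn ((ofMatrix_bijective E).1 (h.trans (map_zero _).symm))
      exact ⟨oneTensor E a, by rw [h₁, ha]⟩
    · rintro ⟨z, hz⟩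
      obtain ⟨x, rfl⟩ := (oneTensor_bijective E).2 z
      rw [← hz, h₁, h₂', mapTwo_mapOne, map_zero]
  have hex₁ : Function.Exact φ₂.toLinearMap φ₃.toLinearMap := by
    intro y
    obtain ⟨X, rfl⟩ := (ofMatrix_bijective E).2 y
    constructor
    · intro h
      rw [h₃'] at h
      obtain ⟨Y, hY⟩ := exists_mapTwo E ((oneTensor_bijective E).1 (h.trans (map_zero (oneTensorLin E)).symm))
      exact ⟨ofMatrix E Y, by rw [h₂', hY]⟩
    · rintro ⟨z, hz⟩
      obtain ⟨Y, rfl⟩ := (ofMatrix_bijective E).2 z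
      rw [← hz, h₂', h₃', mapThree_mapTwo]
      exact map_zero (oneTensorLin E)
  have hex₀ : Function.Exact φ₃.toLinearMap ε.toLinearMap := by
    intro y
    obtain ⟨x, rfl⟩ := (oneTensor_bijective E).2 y
    constructor
    · intro h
      have hx : Coalgebra.counit (R := ℂ) x = 0 := (hε x).symm.trans h
      obtain ⟨X, hX⟩ := exists_mapThree E x
      rw [hx, zero_smul, sub_zero] at hX
      exact ⟨ofMatrix E X, by rw [h₃', hX]⟩
    · rintro ⟨z, hz⟩
      obtain ⟨X, rfl⟩ := (ofMatrix_bijective E).2 z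
      rw [← hz, h₃']
      exact (hε _).trans (counit_mapThree E X)
  have hsurj : Function.Surjective ε.toLinearMap := fun (c : ℂ) =>
    ⟨oneTensor E (algebraMap ℂ (B E) c), (hε _).trans (Bialgebra.counit_algebraMap c)⟩
  refine ⟨φ₁, φ₂, φ₃, ε, fun x => ?_, fun i j x => ?_, fun i j x => ?_, hε, hinj, hex₂, hex₁, hex₀,
    hsurj, isFreeYDResolution_threeTerm φ₁ φ₂ φ₃ ε hinj hex₂ hex₁ hex₀ hsurj⟩
  · rw [h₁, ofMatrix_apply, ← coinvMat_eq]
    rfl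
  · rw [h₂, ofMatrix_mapTwo_single_coeff]
  · rw [h₃, Matrix.one_apply]
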